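/- Let $K$ be an algebraically closed field, $n\ge 2$, $q,Q\in K^\times$, and fix square roots $\sqrt q,\sqrt Q\in K$. **The group.** $W(\tilde C_n)$ is the Coxeter group with generators $\sigma_0,\dots,\sigma_n$ whose diagram is the path $0-1-\cdots-n$ with the edges $\{0,1\}$ and $\{n-1,n\}$ labelled $4$ and the others $3$; write $t_n=\sigma_n$. $W^c(\tilde C_n)$ is the set of fully commutative elements, i.e. those any two of whose reduced expressions are linked by commutations $\sigma_i\sigma_j=\sigma_j\sigma_i$, $|i-j|>1$. An element $w\in W^c(\tilde C_n)$ is *left-positive* if no reduced expression of $w$ has $\sigma_1\sigma_0\sigma_1$ as a contiguous subword. **The algebra.** $TL\tilde C_n(q,Q)$ is the unital associative $K$-algebra generated by $g_0,\dots,g_n$ with relations $g_i^2=(Q-1)g_i+Q$ for $i\in\{0,n\}$; $g_i^2=(q-1)g_i+q$ for $0<i<n$; $g_ig_j=g_jg_i$ for $|i-j|>1$; $g_ig_{i+1}g_i=g_{i+1}g_ig_{i+1}$ and $V(g_i,g_{i+1})=0$ for $0<i<n-1$; $g_ig_{i+1}g_ig_{i+1}=g_{i+1}g_ig_{i+1}g_i$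 and $Z(g_i,g_{i+1})=0$ for $i\in\{0,n-1\}$; here $V(x,y)=xyx+xy+yx+x+y+1$ and $Z(x,y)=xyxy+xyx+yxy+xy+yx+x+y+1$. Put $U_i=(g_i+1)/\sqrt Q$ for $i\in\{0,n\}$, $U_i=(g_i+1)/\sqrt q$ for $0<i<n$, and $\kappa_L=\kappa_R=(q+Q)/(\sqrt q\sqrt Q)$. For $w\in W^c(\tilde C_n)$ with reduced expression $\sigma_{i_1}\cdots\sigma_{i_r}$ put $b_w=U_{i_1}\cdots U_{i_r}$ (independent of the expression). Let $Lp$ be the two-sided ideal generated by $U_1U_0U_1-\kappa_LU_1$. **The bar operator.** Put $[i,j]=\sigma_i\sigma_{i+1}\cdots\sigma_j$ for $0\le i\le j<n$, $[n,n-1]=1$, and $[-i,j]=\sigma_i\cdots\sigma_1\sigma_0\sigma_1\cdots\sigma_j$ for $1\le i\le j<n$. A *$B$-form* is a product $[l_1,g_1]\cdots[l_r,g_r]$ ($r\ge0$) with $n>g_1>\dots>g_r\ge0$, $|l_t|\le g_t$, and either $l_1>\dots>l_r>0$, or $l_1>\dots>l_s=l_{s+1}=\dots=l_r=0$ for some $s\le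 r$, or $l_1>\dots>l_{r-1}>-l_r>0$; it is *negative* in the last case. Every $x\in W^c(\tilde C_n)$ that is not left-positive has exactly one reduced expression of the following kinds, and $\overline{b_x}$ is defined accordingly: 1. $x=[i,n-1]\,t_n([-(n-1),n-1]\,t_n)^k[f,n-1]^{-1}$ with $k\ge1$, $-n<i,f\le n$. Let $b(i,k,f)$ be the monomial of this element, also for $k=0$. Then $\overline{b_x}=b(i,k,-f)$ if $f<0$; $\overline{b_x}=U_nU_{n-1}U_n$ if $k=1$ and $i=f=n$; $\overline{b_x}=\kappa_R\,b(i,k-1,f)$ otherwise. 2. $x=[i_1,n-1]t_n\cdots[i_p,n-1]t_n\,w_r$ with $p\ge2$, $n\ge i_1>\dots>i_{p-1}>|i_p|>0$, and either $i_p<0$, $i_p\ne-(n-1)$ and $w_r=1$; or $i_p>0$ and $w_r$ is a negative $B$-form with $|l_1|<i_p$. Then $\overline{b_x}=b_{\bar x}$, where $\bar x$ is obtained by replacing $[i_p,n-1]$ by $[-i_p,n-1]$ in the first case, and $[l_r,g_r]$ by $[-l_r,g_r]$ in the second. 3. $x=[i,n-1]\,t_n\,v$ and $\overline{b_x}=b_{\bar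 x}$, where: if $-n<i<0$ and $v=[h,n-1]^{-1}$ with $-n<h\le n$, then $\bar x=[-i,n-1]t_nv$ if $h\ge0$ and $\bar x=[i,n-1]t_n[-h,n-1]^{-1}$ if $h<0$; if $i=0$ and $v=[h,n-1]^{-1}$ with $-n<h<0$, then $\bar x=[0,n-1]t_n[-h,n-1]^{-1}$; if $0<i\le n$ and $v$ is a negative $B$-form such that for each $j$ either $l_j=n-j$ or $l_j<i$, then $\bar x$ is obtained by replacing $[l_r,g_r]$ by $[-l_r,g_r]$. 4. $x$ is a negative $B$-form, and $\overline{b_x}=b_{\bar x}$, where $\bar x$ is obtained by replacing $[l_r,g_r]$ by $[-l_r,g_r]$. **Theorem.** The elements $b_x-\kappa_L\overline{b_x}$, for $x\in W^c(\tilde C_n)$ not left-positive, form a $K$-basis of $Lp$. Consequently, the images of the $b_w$, for $w\in W^c(\tilde C_n)$ left-positive, form a $K$-basis of $TL\tilde C_n(q,Q)/Lp$. -/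

import Mathlib

namespace CTilde

/-! ### The Coxeter group of type `C̃_n` and fully commutative elements -/

/-- The Coxeter matrix of type `C̃_n`, nodes `0, 1, …, n`: the diagram is the path
`0 — 1 — ⋯ — n`, with the edges `{0, 1}` and `{n - 1, n}` labelled `4` and all others `3`. -/
def coxeterMatrix (n : ℕ) : CoxeterMatrix (Fin (n + 1)) where
  M := Matrix.of fun i j =>
    if i = j then 1
    else if i.val + 1 < j.val ∨ j.val + 1 < i.val then 2
    else if i.val = 0 ∨ j.val = 0 ∨ i.val = n ∨ j.val = n then 4
    else 3
  isSymm := by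
    ext i j
    simp only [Matrix.transpose_apply, Matrix.of_apply]
    grind
  diagonal := by simp
  off_diagonal := by
    intro i j h
    simp only [Matrix.of_apply]
    grind

/-- The group `W(C̃_n)`. -/
abbrev W (n : ℕ) : Type := (coxeterMatrix n).Group

/-- The Coxeter system `(W(C̃_n), {σ_0, …, σ_n})`. -/
abbrev cs (n : ℕ) : CoxeterSystem (coxeterMatrix n) (W n) := (coxeterMatrix n).toCoxeterSystem

/-- `ω` is a reduced expression of `w`. -/
def IsReducedExpr {n : ℕ} (ω : List (Fin (n + 1))) (w : W n) : Prop :=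
  (cs n).IsReduced ω ∧ (cs n).wordProd ω = w

/-- One commutation move on words: two adjacent letters `i`, `j` with `m(i, j) = 2` are swapped. -/
inductive CommMove {n : ℕ} : List (Fin (n + 1)) → List (Fin (n + 1)) → Prop
  | swap (α β : List (Fin (n + 1))) (i j : Fin (n + 1)) (h : coxeterMatrix n i j = 2) :
      CommMove (α ++ i :: j :: β) (α ++ j :: i :: β)

/-- `w` is fully commutative: any two reduced expressions of `w` are linked by commutation
moves. -/
def IsFullyCommutative {n : ℕ} (w : W n) : Prop :=
  ∀ ω ω' : List (Fin (n + 1)), IsReducedExpr ω w → IsReducedExpr ω' w →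
    Relation.ReflTransGen CommMove ω ω'

/-- `w` contains `u`: some reduced expression of `u` is a contiguous subword of some reduced
expression of `w`. -/
def Contains {n : ℕ} (w u : W n) : Prop :=
  ∃ ω υ : List (Fin (n + 1)), IsReducedExpr ω w ∧ IsReducedExpr υ u ∧ υ <:+: ω

/-- The index `i` as a node of the diagram (meant for `i ≤ n`). -/
def node (n i : ℕ) : Fin (n + 1) := Fin.ofNat (n + 1) i

/-- `w` avoids `σ_1 σ_0 σ_1`. -/
def IsLeftPositive {n : ℕ} (w : W n) : Prop :=
  ¬ Contains w ((cs n).wordProd [node n 1, node n 0, node n 1])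

/-- The left-positive fully commutative elements. -/
abbrev LeftPos (n : ℕ) : Type := {w : W n // IsFullyCommutative w ∧ IsLeftPositive w}

/-- The fully commutative elements that are not left-positive. -/
abbrev NonLeftPos (n : ℕ) : Type := {w : W n // IsFullyCommutative w ∧ ¬ IsLeftPositive w}

/-! ### The Temperley-Lieb algebra of type `C̃_n` -/

/-- `V(x, y)`. -/
def polyV {R : Type*} [Ring R] (x y : R) : R :=
  x * y * x + x * y + y * x + x + y + 1

/-- `Z(x, y)`. -/
def polyZ {R : Type*} [Ring R] (x y : R) : R :=
  x * y * x * y + x * y * x + y * x * y + x * y + y * x + x + y + 1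

/-- The defining relations among `g_0, …, g_n`: the relations of the two-parameter Hecke algebra
of type `C̃_n`, together with `Z(g_0, g_1) = Z(g_{n-1}, g_n) = 0` and `V(g_i, g_{i+1}) = 0` for
`0 < i < n - 1`. -/
inductive TLRel {K : Type*} [Field K] (n : ℕ) (q Q : K) :
    FreeAlgebra K (Fin (n + 1)) → FreeAlgebra K (Fin (n + 1)) → Prop
  | quadratic_end (i : Fin (n + 1)) (h : i.val = 0 ∨ i.val = n) :
      TLRel n q Q (FreeAlgebra.ι K i ^ 2)
        ((Q - 1) • FreeAlgebra.ι K i + algebraMap K (FreeAlgebra K (Fin (n + 1))) Q)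
  | quadratic_mid (i : Fin (n + 1)) (h : 0 < i.val ∧ i.val < n) :
      TLRel n q Q (FreeAlgebra.ι K i ^ 2)
        ((q - 1) • FreeAlgebra.ι K i + algebraMap K (FreeAlgebra K (Fin (n + 1))) q)
  | comm (i j : Fin (n + 1)) (h : i.val + 1 < j.val ∨ j.val + 1 < i.val) :
      TLRel n q Q (FreeAlgebra.ι K i * FreeAlgebra.ι K j)
        (FreeAlgebra.ι K j * FreeAlgebra.ι K i)
  | braid_three (i j : Fin (n + 1)) (h : i.val + 1 = j.val) (hi : 0 < i.val) (hj : j.val < n) :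
      TLRel n q Q (FreeAlgebra.ι K i * FreeAlgebra.ι K j * FreeAlgebra.ι K i)
        (FreeAlgebra.ι K j * FreeAlgebra.ι K i * FreeAlgebra.ι K j)
  | braid_four (i j : Fin (n + 1)) (h : i.val + 1 = j.val) (hij : i.val = 0 ∨ j.val = n) :
      TLRel n q Q
        (FreeAlgebra.ι K i * FreeAlgebra.ι K j * FreeAlgebra.ι K i * FreeAlgebra.ι K j)
        (FreeAlgebra.ι K j * FreeAlgebra.ι K i * FreeAlgebra.ι K j * FreeAlgebra.ι K i)
  | z_end (i j : Fin (n + 1)) (h : i.val + 1 = j.val) (hij : i.val = 0 ∨ j.val = n) :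
      TLRel n q Q (polyZ (FreeAlgebra.ι K i) (FreeAlgebra.ι K j)) 0
  | v_mid (i j : Fin (n + 1)) (h : i.val + 1 = j.val) (hi : 0 < i.val) (hj : j.val < n) :
      TLRel n q Q (polyV (FreeAlgebra.ι K i) (FreeAlgebra.ι K j)) 0

/-- The Temperley-Lieb algebra `TLC̃_n(q, Q)`. -/
abbrev TL {K : Type*} [Field K] (n : ℕ) (q Q : K) : Type _ := RingQuot (TLRel n q Q)

/-- The generator `g_i`. -/
noncomputable def g {K : Type*} [Field K] (n : ℕ) (q Q : K) (i : Fin (n + 1)) : TL n q Q :=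
  RingQuot.mkAlgHom K (TLRel n q Q) (FreeAlgebra.ι K i)

/-- The generator `U_i`: it is `(g_i + 1) / √Q` for `i = 0, n` and `(g_i + 1) / √q` for
`0 < i < n`. The arguments `r` and `R` are the square roots of `q` and `Q`, so that the algebra is
`TLC̃_n(r², R²)`. -/
noncomputable def U {K : Type*} [Field K] (n : ℕ) (r R : K) (i : Fin (n + 1)) :
    TL n (r ^ 2) (R ^ 2) :=
  (if i.val = 0 ∨ i.val = n then R⁻¹ else r⁻¹) • (g n (r ^ 2) (R ^ 2) i + 1)

/-- `κ_L = κ_R = (q + Q) / √(qQ)`, where `q = r²`, `Q = R²`. -/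
def kappa {K : Type*} [Field K] (r R : K) : K := (r ^ 2 + R ^ 2) / (r * R)

/-- The product `U_{i_1} ⋯ U_{i_k}` along a word. -/
noncomputable def wordU {K : Type*} [Field K] {n : ℕ} (r R : K) (ω : List (Fin (n + 1))) :
    TL n (r ^ 2) (R ^ 2) :=
  (ω.map (U n r R)).prod

/-- The monomial `b_w`: the product of the `U_i` along a reduced expression of `w`. For fully
commutative `w` it does not depend on the expression, see `b_eq_wordU`. -/
noncomputable def b {K : Type*} [Field K] {n : ℕ} (r R : K) (w : W n) : TL n (r ^ 2) (R ^ 2) :=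
  wordU r R ((cs n).exists_isReduced w).choose

theorem U_comm {K : Type*} [Field K] {n : ℕ} (r R : K) (i j : Fin (n + 1))
    (h : coxeterMatrix n i j = 2) : U n r R i * U n r R j = U n r R j * U n r R i := by
  have hij : i.val + 1 < j.val ∨ j.val + 1 < i.val := by
    have h' : (if i = j then 1
      else if i.val + 1 < j.val ∨ j.val + 1 < i.val then 2
      else if i.val = 0 ∨ j.val = 0 ∨ i.val = n ∨ j.val = n then 4
      else 3) = 2 := h
    by_contra hc
    split_ifs at h' <;> omega
  have hg : Commute (g n (r ^ 2) (R ^ 2) i) (g n (r ^ 2) (R ^ 2) j) := by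
    have := RingQuot.mkAlgHom_rel K (TLRel.comm (q := r ^ 2) (Q := R ^ 2) i j hij)
    rw [map_mul, map_mul] at this
    exact this
  have hc : Commute (g n (r ^ 2) (R ^ 2) i + 1) (g n (r ^ 2) (R ^ 2) j + 1) :=
    (hg.add_left (Commute.one_left _)).add_right (Commute.one_right _)
  exact ((hc.smul_left _).smul_right _).eq

theorem wordU_commMove {K : Type*} [Field K] {n : ℕ} (r R : K) {ω ω' : List (Fin (n + 1))}
    (h : CommMove ω ω') : wordU r R ω = wordU r R ω' := by
  obtain ⟨α, β, i, j, h⟩ := h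
  simp only [wordU, List.map_append, List.map_cons, List.prod_append, List.prod_cons]
  rw [← mul_assoc (U n r R i), U_comm r R i j h, mul_assoc]

/-- `b_w` is computed by any reduced expression of a fully commutative `w`. -/
theorem b_eq_wordU {K : Type*} [Field K] {n : ℕ} (r R : K) {w : W n} (hw : IsFullyCommutative w)
    {ω : List (Fin (n + 1))} (hω : IsReducedExpr ω w) : b r R w = wordU r R ω := by
  have hs := ((cs n).exists_isReduced w).choose_spec
  have h := hw _ ω ⟨hs.1, hs.2.symm⟩ hω
  have key : ∀ ω₁ ω₂ : List (Fin (n + 1)), Relation.ReflTransGen CommMove ω₁ ω₂ →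
      wordU r R ω₁ = wordU r R ω₂ := by
    intro ω₁ ω₂ h
    induction h with
    | refl => rfl
    | tail _ h ih => rw [ih, wordU_commMove r R h]
  exact key _ _ h

/-! ### Normal forms of fully commutative elements and the bar operator -/

/-- The block `[i, j]`, as a word in the indices: `i, i+1, …, j` for `i ≥ 0` (empty for `i = j + 1`)
and `|i|, …, 1, 0, 1, …, j` for `i < 0`. -/
def block (i : ℤ) (j : ℕ) : List ℕ :=
  if 0 ≤ i then List.range' i.toNat (j + 1 - i.toNat)
  else (List.range' 1 (-i).toNat).reverse ++ List.range (j + 1)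

/-- The word `[l_1, g_1][l_2, g_2] ⋯ [l_r, g_r]`; a list of pairs `(l_t, g_t)` encodes it. -/
def blocks (v : List (ℤ × ℕ)) : List ℕ := v.flatMap fun p => block p.1 p.2

/-- The normal forms of the fully commutative elements of type `B_n` (the empty list stands for
the identity). -/
def IsTypeBForm (n : ℕ) (v : List (ℤ × ℕ)) : Prop :=
  (v.map Prod.snd).Pairwise (· > ·) ∧
  (∀ p ∈ v, p.2 < n ∧ |p.1| ≤ (p.2 : ℤ)) ∧
  ( -- `l_1 > ⋯ > l_r > 0`
    ((v.map Prod.fst).Pairwise (· > ·) ∧ ∀ p ∈ v, 0 < p.1) ∨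
    -- `l_1 > ⋯ > l_s = ⋯ = l_r = 0`
    (∃ (a : List ℤ) (m : ℕ), v.map Prod.fst = a ++ List.replicate (m + 1) 0 ∧
      a.Pairwise (· > ·) ∧ ∀ l ∈ a, 0 < l) ∨
    -- `l_1 > ⋯ > l_{r-1} > -l_r > 0`
    (∃ (a : List ℤ) (l : ℤ), v.map Prod.fst = a ++ [-l] ∧
      (a ++ [l]).Pairwise (· > ·) ∧ 0 < l))

/-- The shapes of the normal forms of fully commutative elements of `W(C̃_n)`; the corresponding
words are given by `NormalForm.word` and the conditions on the data by `NormalForm.IsValid`. -/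
inductive NormalForm : Type
  /-- affine length `0` -/
  | zero (v : List (ℤ × ℕ))
  /-- affine length `1`, `[i, n-1] t_n v` with `i > 0` -/
  | onePos (i : ℤ) (v : List (ℤ × ℕ))
  /-- affine length `1`, `[i, n-1] t_n [h, n-1]⁻¹` with `i < 0` -/
  | oneNeg (i h : ℤ)
  /-- affine length `1`, `[0, n-1] t_n [h, n-1]⁻¹` -/
  | oneZero (h : ℤ)
  /-- affine length `1`, `[0, n-1] t_n [z, n-1]⁻¹ [0, r_1] ⋯ [0, r_m]` -/
  | oneZeroTail (z : ℕ) (rs : List ℕ)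
  /-- first type, `[i, n-1] t_n ([-(n-1), n-1] t_n)^k [f, n-1]⁻¹` -/
  | first (i : ℤ) (k : ℕ) (f : ℤ)
  /-- second type, `[i_1, n-1] t_n ⋯ [i_p, n-1] t_n ([0, n-1] t_n)^k w_r` -/
  | second (is : List ℤ) (k : ℕ) (v : List (ℤ × ℕ))

/-- Change the sign of the last entry. -/
def negLast : List ℤ → List ℤ
  | [] => []
  | [i] => [-i]
  | i :: j :: is => i :: negLast (j :: is)

/-- Replace the last block `[l_r, g_r]` by `[-l_r, g_r]`. -/
def negLastBlock : List (ℤ × ℕ) → List (ℤ × ℕ)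
  | [] => []
  | [p] => [(-p.1, p.2)]
  | p :: p' :: v => p :: negLastBlock (p' :: v)

namespace NormalForm

/-- The conditions on the parameters of a normal form. -/
def IsValid (n : ℕ) : NormalForm → Prop
  | zero v => IsTypeBForm n v
  | onePos i v => 0 < i ∧ i ≤ n ∧ IsTypeBForm n v ∧
      ∀ (j : ℕ) (hj : j < v.length), v[j].1 = (n : ℤ) - (j + 1) ∨ v[j].1 < i
  | oneNeg i h => -(n : ℤ) < i ∧ i < 0 ∧ -(n : ℤ) < h ∧ h ≤ n
  | oneZero h => -(n : ℤ) < h ∧ h ≤ n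
  | oneZeroTail z rs => z ≤ n ∧ rs ≠ [] ∧ (z :: rs).Pairwise (· > ·)
  | first i k f => 1 ≤ k ∧ -(n : ℤ) < i ∧ i ≤ n ∧ -(n : ℤ) < f ∧ f ≤ n
  | second is k v => 2 ≤ is.length + k ∧ IsTypeBForm n v ∧
      -- `n ≥ i_1 > ⋯ > i_{p-1} > |i_p| > 0`
      (is.map fun i => |i|).Pairwise (· > ·) ∧ (∀ i ∈ is, 0 < |i| ∧ i ≤ n) ∧
      (∀ i ∈ is.dropLast, 0 < i) ∧
      -- `k > 0`: `w_r = [0, r_1] ⋯ [0, r_u]`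
      (0 < k → ∀ p ∈ v, p.1 = 0) ∧
      -- `i_p < 0`
      (∀ i ∈ is, i < 0 → k = 0 ∧ v = [] ∧ i ≠ -((n : ℤ) - 1)) ∧
      -- `k = 0` and `i_p > 0`: `|l_1| < i_p`
      (k = 0 → ∀ i ∈ is.getLast?, 0 < i → ∀ p ∈ v.head?, |p.1| < i)

/-- The word of a first type element; `k = 0` is allowed here. -/
def firstWord (n : ℕ) (i : ℤ) (k : ℕ) (f : ℤ) : List ℕ :=
  block i (n - 1) ++ [n] ++
    (List.replicate k (block (-((n : ℤ) - 1)) (n - 1) ++ [n])).flatten ++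
    (block f (n - 1)).reverse

/-- The word of a second type element. -/
def secondWord (n : ℕ) (is : List ℤ) (k : ℕ) (v : List (ℤ × ℕ)) : List ℕ :=
  (is.flatMap fun i => block i (n - 1) ++ [n]) ++
    (List.replicate k (block 0 (n - 1) ++ [n])).flatten ++ blocks v

/-- The word of a normal form, as a list of indices in `{0, …, n}` (`t_n` is `σ_n`). -/
def word (n : ℕ) : NormalForm → List ℕ
  | zero v => blocks v
  | onePos i v => block i (n - 1) ++ [n] ++ blocks v
  | oneNeg i h => block i (n - 1) ++ [n] ++ (block h (n - 1)).reverse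
  | oneZero h => block 0 (n - 1) ++ [n] ++ (block h (n - 1)).reverse
  | oneZeroTail z rs => block 0 (n - 1) ++ [n] ++ (block z (n - 1)).reverse ++
      rs.flatMap fun s => block 0 s
  | first i k f => firstWord n i k f
  | second is k v => secondWord n is k v

/-- The word of the element `w̄`, where `w` is the element with the given normal form. (The value
is of interest only if `w` is not left-positive.) -/
def barWord (n : ℕ) : NormalForm → List ℕ
  | zero v => word n (zero (negLastBlock v))
  | onePos i v => word n (onePos i (negLastBlock v))
  | oneNeg i h => if 0 ≤ h then word n (oneNeg (-i) h) else word n (oneNeg i (-h))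
  | oneZero h => word n (oneZero (-h))
  | oneZeroTail z rs => word n (oneZeroTail z rs)
  | first i k f =>
      if f < 0 then firstWord n i k (-f)
      else if k = 1 ∧ f = n ∧ i = n then [n, n - 1, n]
      else firstWord n i (k - 1) f
  | second is k v =>
      if ∃ i ∈ is, i < 0 then secondWord n (negLast is) k v
      else secondWord n is k (negLastBlock v)

/-- The coefficient `1` or `κ_R` in the definition of the bar of a monomial. -/
def barCoeff {K : Type*} [Field K] (n : ℕ) (κR : K) : NormalForm → K
  | first i k f => if f < 0 ∨ (k = 1 ∧ f = n ∧ i = n) then 1 else κR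
  | _ => 1

/-- `N` is a normal form of `w`: its parameters satisfy the required conditions and its word is a
reduced expression of `w`. -/
def IsNormalFormOf {n : ℕ} (N : NormalForm) (w : W n) : Prop :=
  N.IsValid n ∧ IsReducedExpr ((N.word n).map (node n)) w

end NormalForm

/-- The normal form of `w`. Every fully commutative element has one, and it is unique if the
element is not left-positive. -/
noncomputable def normalForm {n : ℕ} (w : W n) : NormalForm :=
  @Classical.epsilon NormalForm ⟨.zero []⟩ fun N => N.IsNormalFormOf w

/-- The element `w̄`, for `w` fully commutative and not left-positive. -/
noncomputable def bar {n : ℕ} (w : W n) : W n :=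
  (cs n).wordProd (((normalForm w).barWord n).map (node n))

/-- The bar of the monomial `b_w`, for `w` fully commutative and not left-positive. -/
noncomputable def barMonomial {K : Type*} [Field K] {n : ℕ} (r R : K) (w : W n) :
    TL n (r ^ 2) (R ^ 2) :=
  (normalForm w).barCoeff n (kappa r R) • b r R (bar w)

/-! ### The ideal `Lp` -/

/-- The two-sided ideal generated by `U_1 U_0 U_1 - κ_L U_1`. -/
noncomputable def Lp {K : Type*} [Field K] (n : ℕ) (r R : K) :
    TwoSidedIdeal (TL n (r ^ 2) (R ^ 2)) :=
  TwoSidedIdeal.span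
    {U n r R (node n 1) * U n r R (node n 0) * U n r R (node n 1) -
      kappa r R • U n r R (node n 1)}

/-- `Lp` as a `K`-subspace. -/
noncomputable def LpSubmodule {K : Type*} [Field K] (n : ℕ) (r R : K) :
    Submodule K (TL n (r ^ 2) (R ^ 2)) where
  carrier := {a | a ∈ Lp n r R}
  add_mem' := fun ha hb => (Lp n r R).add_mem ha hb
  zero_mem' := (Lp n r R).zero_mem
  smul_mem' := fun c a ha => by
    rw [Algebra.smul_def]
    exact (Lp n r R).mul_mem_left _ _ ha

/-- The quotient algebra `TLC̃_n(q, Q) / Lp`. -/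
abbrev TLQuot {K : Type*} [Field K] (n : ℕ) (r R : K) : Type _ := (Lp n r R).ringCon.Quotient

end CTilde

/-! In terms of the `U_i`, the algebra is presented by commutations and by `U_i² = d_i U_i`, `U_i
U_j U_i = U_i` on edges labelled `3`, and `U_i U_j U_i U_j = κ U_i U_j` on edges labelled `4`. The
quotient by `Lp` adds `U_1 U_0 U_1 = κ U_1`. Read from left to right, these are length-decreasing
weighted rewriting rules on words modulo commutation (traces); `tlSystem` treats the algebra (`ε =
False`) and the quotient (`ε = True`) together. Levi's lemma and a study of overlaps prove local
confluence (`join_of_rule`), so every trace has a well-defined normal form, and left multiplication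
on normal forms is a representation. It separates the monomials of irreducible traces. The same
representation at `q = Q = 1`, viewed on the Coxeter group, identifies the irreducible traces for `ε
= False` with the fully commutative elements (`trace_eq_of_wordProd_eq`,
`IsFullyCommutative.isIrred`). The left-positive elements among them are those without the factor
`101`, so they stay irreducible for `ε = True`.

The rest of the linear algebra is triangularity (`exists_basis_of_shorter`). Suppose every `b_x`
with `x` not left-positive is congruent modulo `Lp` to a multiple of a shorter monomial. Then the
differences are independent by leading terms, and together with the left-positive monomials they
span. The left-positive monomials are independent modulo `Lp`, hence the differences fill `Lp`.

It remains to check that the bar operator is such a shortening. In a normal form it replaces a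
palindrome `l ⋯ 1 0 1 ⋯ l` by `l`. Modulo `Lp` this costs a factor `κ` (`quotTrace_palin`), with a
second `κ` or an exceptional value when `l = n` (`quotTrace_palin_top`, `isBar_shrink_top`). The
shorter word is again irreducible (`IsIrred.shrink`).

Normal forms exist (`exists_isNormalFormOf`) because letters can be inserted one at a time on the
left of a sequence of blocks, and irreducibility then constrains neighbouring blocks. Any valid
normal form of `x` serves in the argument. -/

namespace CTilde

/-! ### The trace monoid of the path graph -/

/-- Two letters of the infinite path `0 — 1 — 2 — ⋯` are independent if they are distinct and not
joined by an edge. -/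
def Ind (i j : ℕ) : Prop := i + 1 < j ∨ j + 1 < i

instance (i j : ℕ) : Decidable (Ind i j) := inferInstanceAs (Decidable (_ ∨ _))

theorem Ind.symm {i j : ℕ} (h : Ind i j) : Ind j i := Or.symm h

theorem Ind.ne {i j : ℕ} (h : Ind i j) : i ≠ j := by unfold Ind at h; omega

/-- The commutations of independent letters. -/
def traceRel (a b : FreeMonoid ℕ) : Prop :=
  ∃ i j, Ind i j ∧ a = FreeMonoid.of i * FreeMonoid.of j ∧ b = FreeMonoid.of j * FreeMonoid.of i

/-- The monoid of words modulo commutations of independent letters. -/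
abbrev Tr : Type := PresentedMonoid traceRel

namespace Tr

/-- The letter `i` as a trace. -/
def of (i : ℕ) : Tr := PresentedMonoid.of traceRel i

theorem of_comm {i j : ℕ} (h : Ind i j) : of i * of j = of j * of i :=
  PresentedMonoid.mk_eq_mk_of_rel ⟨i, j, h, rfl, rfl⟩

/-- The trace of a word. -/
def mk (ω : List ℕ) : Tr := (ω.map of).prod

@[simp] theorem mk_nil : mk [] = 1 := rfl

theorem mk_cons (i : ℕ) (ω : List ℕ) : mk (i :: ω) = of i * mk ω := by simp [mk]

theorem mk_append (ω ω' : List ℕ) : mk (ω ++ ω') = mk ω * mk ω' := by simp [mk]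

@[simp] theorem mk_singleton (i : ℕ) : mk [i] = of i := by simp [mk]

theorem mk_surjective : Function.Surjective mk := by
  intro t
  obtain ⟨a, rfl⟩ := PresentedMonoid.surjective_mk t
  refine ⟨FreeMonoid.toList a, ?_⟩
  induction a using FreeMonoid.inductionOn' with
  | one => rfl
  | of_mul x a ih => rw [FreeMonoid.toList_of_mul, mk_cons, ih, map_mul]; rfl

theorem induction {motive : Tr → Prop} (t : Tr) (one : motive 1)
    (cons : ∀ i t, motive t → motive (of i * t)) : motive t := by
  obtain ⟨ω, rfl⟩ := mk_surjective t
  induction ω with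
  | nil => exact one
  | cons i ω ih => rw [mk_cons]; exact cons _ _ ih

/-- The homomorphism defined by the images of the letters. -/
def lift {M : Type*} [Monoid M] (f : ℕ → M) (h : ∀ i j, Ind i j → f i * f j = f j * f i) :
    Tr →* M :=
  PresentedMonoid.lift f (by
    rintro _ _ ⟨i, j, hij, rfl, rfl⟩
    simpa using h i j hij)

@[simp] theorem lift_of {M : Type*} [Monoid M] (f : ℕ → M)
    (h : ∀ i j, Ind i j → f i * f j = f j * f i) (i : ℕ) : lift f h (of i) = f i := rfl

theorem map_mk {M : Type*} [Monoid M] (φ : Tr →* M) (ω : List ℕ) :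
    φ (mk ω) = (ω.map fun i => φ (of i)).prod := by
  simp [mk, map_list_prod, Function.comp_def]

/-- The multiset of letters of a trace. -/
def letters (t : Tr) : Multiset ℕ :=
  (lift (fun i => Multiplicative.ofAdd {i}) (fun _ _ _ => mul_comm _ _) t).toAdd

@[simp] theorem letters_one : letters 1 = 0 := by simp [letters]

@[simp] theorem letters_mul (s t : Tr) : letters (s * t) = letters s + letters t := by
  simp [letters]

@[simp] theorem letters_of (i : ℕ) : letters (of i) = {i} := rfl

theorem letters_mk (ω : List ℕ) : letters (mk ω) = (ω : Multiset ℕ) := by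
  induction ω with
  | nil => simp
  | cons i ω ih => rw [mk_cons, letters_mul, ih]; simp

theorem mem_letters_mk {i : ℕ} {ω : List ℕ} : i ∈ letters (mk ω) ↔ i ∈ ω := by
  rw [letters_mk, Multiset.mem_coe]

/-- The length of a trace. -/
def length (t : Tr) : ℕ := Multiset.card (letters t)

@[simp] theorem length_one : length 1 = 0 := by simp [length]

@[simp] theorem length_mul (s t : Tr) : length (s * t) = length s + length t := by simp [length]

@[simp] theorem length_of (i : ℕ) : length (of i) = 1 := by simp [length]

@[simp] theorem length_mk (ω : List ℕ) : length (mk ω) = ω.length := by simp [length, letters_mk]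

theorem eq_one_of_letters {t : Tr} (h : letters t = 0) : t = 1 := by
  obtain ⟨ω, rfl⟩ := mk_surjective t
  rw [letters_mk] at h
  simp_all

/-- Every letter of `s` is independent of every letter of `t`. -/
def Indep (s t : Tr) : Prop := ∀ i ∈ letters s, ∀ j ∈ letters t, Ind i j

theorem Indep.symm {s t : Tr} (h : Indep s t) : Indep t s := fun i hi j hj => (h j hj i hi).symm

@[simp] theorem indep_one_left (t : Tr) : Indep 1 t := by simp [Indep]

@[simp] theorem indep_one_right (t : Tr) : Indep t 1 := by simp [Indep]

@[simp] theorem indep_mul_left {s s' t : Tr} : Indep (s * s') t ↔ Indep s t ∧ Indep s' t := by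
  simp only [Indep, letters_mul, Multiset.mem_add]
  grind

@[simp] theorem indep_mul_right {s t t' : Tr} : Indep s (t * t') ↔ Indep s t ∧ Indep s t' := by
  simp only [Indep, letters_mul, Multiset.mem_add]
  grind

@[simp] theorem indep_of_of {i j : ℕ} : Indep (of i) (of j) ↔ Ind i j := by simp [Indep]

theorem Indep.mono_left {s s' t : Tr} (h : Indep s t) (hs : ∀ i ∈ letters s', i ∈ letters s) :
    Indep s' t := fun i hi j hj => h i (hs i hi) j hj

theorem Indep.mono_right {s t t' : Tr} (h : Indep s t) (ht : ∀ i ∈ letters t', i ∈ letters t) :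
    Indep s t' := fun i hi j hj => h i hi j (ht j hj)

theorem Indep.commute {s t : Tr} (h : Indep s t) : Commute s t := by
  have key : ∀ i (t : Tr), Indep (of i) t → Commute (of i) t := by
    intro i t
    induction t using induction with
    | one => intro _; exact Commute.one_right _
    | cons j t ih =>
      intro h
      rw [indep_mul_right, indep_of_of] at h
      exact Commute.mul_right (of_comm h.1) (ih h.2)
  induction s using induction with
  | one => exact Commute.one_left _
  | cons i s ih =>
    rw [indep_mul_left] at h
    exact Commute.mul_left (key i t h.1) (ih h.2)

/-- The step of the left action that computes the removal of the letter `x`. -/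
def removeStep (x a : ℕ) : Function.End (Tr × Option Tr) := fun p =>
  (of a * p.1, if a = x then some p.1 else if Ind a x then p.2.map (of a * ·) else none)

/-- This makes removal well defined on traces. The state pairs the trace built so far with the
outcome of the removal; if one of the two independent letters is `x`, the other one passes it. -/
theorem removeStep_comm (x a b : ℕ) (h : Ind a b) :
    removeStep x a * removeStep x b = removeStep x b * removeStep x a := by
  funext p
  change removeStep x a (removeStep x b p) = removeStep x b (removeStep x a p)
  simp only [removeStep]
  refine Prod.ext ?_ ?_
  · change of a * (of b * p.1) = of b * (of a * p.1)
    rw [← mul_assoc, of_comm h, mul_assoc]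
  · have hne := h.ne
    obtain ⟨t, o⟩ := p
    simp only
    by_cases hax : a = x
    · subst hax
      simp [h.symm, hne.symm]
    · by_cases hbx : b = x
      · subst hbx
        simp [h, hne]
      · simp only [hax, hbx, if_false]
        by_cases h1 : Ind a x <;> by_cases h2 : Ind b x <;> simp [h1, h2]
        cases o <;> simp [of_comm h]

/-- Remove the first letter `x` of the trace, if it can be moved to the front. -/
def remove (x : ℕ) (t : Tr) : Option Tr := (lift (removeStep x) (removeStep_comm x) t (1, none)).2

theorem lift_removeStep_fst (x : ℕ) (t : Tr) :
    (lift (removeStep x) (removeStep_comm x) t (1, none)).1 = t := by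
  induction t using induction with
  | one => rfl
  | cons i t ih =>
    rw [map_mul, lift_of]
    change of i * _ = _
    rw [ih]

theorem remove_of_mul (x a : ℕ) (t : Tr) :
    remove x (of a * t) =
      if a = x then some t else if Ind a x then (remove x t).map (of a * ·) else none := by
  unfold remove
  rw [map_mul, lift_of]
  change (removeStep x a _).2 = _
  simp only [removeStep, lift_removeStep_fst]

theorem eq_of_remove {x : ℕ} {t u : Tr} (h : remove x t = some u) : t = of x * u := by
  induction t using induction generalizing u with
  | one => simp [remove, map_one] at h; cases h
  | cons a t ih =>
    rw [remove_of_mul] at h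
    split_ifs at h with h1 h2
    · simp_all
    · obtain ⟨v, hv, rfl⟩ := Option.map_eq_some_iff.1 h
      rw [ih hv, ← mul_assoc, of_comm h2, mul_assoc]

/-- Removal of `x` is a function on traces, so it may be applied to both sides: this gives left
cancellation when `x = y`, and otherwise shows that `x` can be moved to the front past `y`. -/
theorem of_mul_eq_of_mul {x y : ℕ} {u v : Tr} (h : of x * u = of y * v) :
    (x = y ∧ u = v) ∨ (Ind x y ∧ ∃ w, u = of y * w ∧ v = of x * w) := by
  have h' := congrArg (remove x) h
  rw [remove_of_mul, remove_of_mul, if_pos rfl] at h'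
  split_ifs at h' with h1 h2
  · left; simp_all
  · right
    obtain ⟨w, hw, rfl⟩ := Option.map_eq_some_iff.1 h'.symm
    exact ⟨h2.symm, w, rfl, eq_of_remove hw⟩

theorem of_mul_eq_mul {x : ℕ} {u c d : Tr} (h : of x * u = c * d) :
    (∃ c', c = of x * c' ∧ u = c' * d) ∨
      (∃ d', d = of x * d' ∧ Indep (of x) c ∧ u = c * d') := by
  induction c using induction generalizing u with
  | one => right; exact ⟨u, by simpa using h.symm, by simp, by simp⟩
  | cons y c ih =>
    rw [mul_assoc] at h
    rcases of_mul_eq_of_mul h with ⟨rfl, rfl⟩ | ⟨hxy, w, rfl, hw⟩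
    · left; exact ⟨c, rfl, rfl⟩
    · rcases ih hw.symm with ⟨c', rfl, rfl⟩ | ⟨d', rfl, hc, rfl⟩
      · left
        refine ⟨of y * c', ?_, by rw [mul_assoc]⟩
        rw [← mul_assoc, ← of_comm hxy, mul_assoc]
      · right
        exact ⟨d', rfl, by simp [hxy, hc], by rw [mul_assoc]⟩

/-- Levi's lemma for traces. -/
theorem levi {a b c d : Tr} (h : a * b = c * d) :
    ∃ p r s q, a = p * r ∧ b = s * q ∧ c = p * s ∧ d = r * q ∧ Indep r s := by
  induction a using induction generalizing c d with
  | one => exact ⟨1, 1, c, d, by simp, by simpa using h, by simp, by simp, by simp⟩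
  | cons x a ih =>
    rw [mul_assoc] at h
    rcases of_mul_eq_mul h with ⟨c', rfl, h'⟩ | ⟨d', rfl, hc, h'⟩
    · obtain ⟨p, r, s, q, rfl, rfl, rfl, rfl, hrs⟩ := ih h'
      exact ⟨of x * p, r, s, q, by rw [mul_assoc], rfl, by rw [mul_assoc], rfl, hrs⟩
    · obtain ⟨p, r, s, q, rfl, rfl, rfl, rfl, hrs⟩ := ih h'
      rw [indep_mul_right] at hc
      refine ⟨p, of x * r, s, q, ?_, rfl, rfl, by rw [mul_assoc], by simp [hrs, hc.2]⟩
      rw [← mul_assoc, hc.1.commute.eq, mul_assoc]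

/-- The common refinement of two factorizations of a trace into three factors. -/
theorem levi_three {a P b a' P' b' : Tr} (h : a * P * b = a' * P' * b') :
    ∃ p₁₁ p₁₂ p₁₃ p₂₁ p₂₂ p₂₃ p₃₁ p₃₂ p₃₃,
      a = p₁₁ * p₁₂ * p₁₃ ∧ P = p₂₁ * p₂₂ * p₂₃ ∧ b = p₃₁ * p₃₂ * p₃₃ ∧
      a' = p₁₁ * p₂₁ * p₃₁ ∧ P' = p₁₂ * p₂₂ * p₃₂ ∧ b' = p₁₃ * p₂₃ * p₃₃ ∧
      Indep p₁₂ p₂₁ ∧ Indep p₁₂ p₃₁ ∧ Indep p₁₃ p₂₁ ∧ Indep p₁₃ p₃₁ ∧ Indep p₁₃ p₂₂ ∧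
      Indep p₁₃ p₃₂ ∧ Indep p₂₂ p₃₁ ∧ Indep p₂₃ p₃₁ ∧ Indep p₂₃ p₃₂ := by
  rw [mul_assoc, mul_assoc] at h
  obtain ⟨p₁₁, r, s, q, rfl, h1, rfl, h2, h3⟩ := levi h
  obtain ⟨p₁₂, p₁₃, s₂, q₂, rfl, h4, rfl, rfl, h5⟩ := levi h2.symm
  obtain ⟨p₂₁, p₃₁, s₃, q₃, rfl, h6, rfl, rfl, h7⟩ := levi h1.symm
  obtain ⟨p₂₂, p₃₂, p₂₃, p₃₃, rfl, rfl, rfl, rfl, h8⟩ := levi (h4.symm.trans h6)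
  simp only [indep_mul_left, indep_mul_right] at h3 h5 h7
  refine ⟨p₁₁, p₁₂, p₁₃, p₂₁, p₂₂, p₂₃, p₃₁, p₃₂, p₃₃, ?_, ?_, ?_, ?_, ?_, ?_, h3.1.1, h3.2.1,
    h3.1.2, h3.2.2, h5.1, h5.2, h7.1.symm, h7.2.symm, h8.symm⟩ <;> simp only [mul_assoc]

/-- Factorizations of the trace of a word without commuting neighbours are factorizations of the
word. -/
theorem exists_append_of_mk_eq_mul {ω : List ℕ} (hω : ω.IsChain fun i j => ¬ Ind i j) {c d : Tr}
    (h : mk ω = c * d) : ∃ α β, ω = α ++ β ∧ c = mk α ∧ d = mk β := by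
  induction ω generalizing c d with
  | nil =>
    have := congrArg length h
    simp only [mk_nil, length_one, length_mul] at this
    have hc : c = 1 := eq_one_of_letters (Multiset.card_eq_zero.1 (show length c = 0 by omega))
    have hd : d = 1 := eq_one_of_letters (Multiset.card_eq_zero.1 (show length d = 0 by omega))
    exact ⟨[], [], rfl, hc, hd⟩
  | cons x ω ih =>
    rw [mk_cons] at h
    rcases of_mul_eq_mul h with ⟨c', rfl, h'⟩ | ⟨d', rfl, hc, h'⟩
    · obtain ⟨α, β, rfl, rfl, rfl⟩ := ih hω.of_cons h'
      exact ⟨x :: α, β, rfl, mk_cons _ _, rfl⟩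
    · obtain ⟨α, β, rfl, rfl, rfl⟩ := ih hω.of_cons h'
      cases α with
      | nil => exact ⟨[], x :: β, rfl, rfl, (mk_cons _ _).symm⟩
      | cons y α =>
        exfalso
        have h1 : Ind x y := hc x (by simp) y (by simp [mk_cons])
        simp only [List.cons_append, List.isChain_cons_cons] at hω
        exact hω.1 h1

/-- No two neighbours can be swapped, so the commutation class is a single word. The letters are
recovered one by one from factorizations of the trace. -/
theorem mk_injOn_rigid {ω ω' : List ℕ} (hω : ω.IsChain fun i j => ¬ Ind i j)
    (h : mk ω = mk ω') : ω = ω' := by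
  induction ω' generalizing ω with
  | nil =>
    have := congrArg length h
    simpa using this
  | cons x ω' ih =>
    rw [mk_cons] at h
    obtain ⟨α, β, rfl, h1, h2⟩ := exists_append_of_mk_eq_mul hω h
    have hα : α = [x] := by
      have := congrArg letters h1
      simp only [letters_of, letters_mk] at this
      exact Multiset.coe_eq_singleton.1 this.symm
    subst hα
    rw [List.isChain_append] at hω
    rw [ih hω.2.1 h2.symm]
    rfl

/-- The projection of a trace to two letters that do not commute. -/
def proj (i : ℕ) : Tr →* FreeMonoid ℕ :=
  lift (fun x => if x = i ∨ x = i + 1 then FreeMonoid.of x else 1) (by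
    intro x y h
    unfold Ind at h
    split_ifs <;> first | (exfalso; omega) | simp)

theorem proj_mk (i : ℕ) (ω : List ℕ) :
    proj i (mk ω) = FreeMonoid.ofList (ω.filter fun x => x = i ∨ x = i + 1) := by
  induction ω with
  | nil => rfl
  | cons x ω ih =>
    rw [mk_cons, map_mul, ih]
    simp only [proj, lift_of, List.filter_cons]
    by_cases h : x = i ∨ x = i + 1 <;> simp [h, FreeMonoid.ofList_cons]

/-- One commutation of neighbouring independent letters in a word. -/
inductive Swap : List ℕ → List ℕ → Prop
  | swap (α β : List ℕ) (i j : ℕ) (h : Ind i j) : Swap (α ++ i :: j :: β) (α ++ j :: i :: β)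

theorem Swap.append {ω ω' : List ℕ} (h : Swap ω ω') (α β : List ℕ) :
    Swap (α ++ ω ++ β) (α ++ ω' ++ β) := by
  obtain ⟨γ, δ, i, j, h⟩ := h
  simpa using Swap.swap (α ++ γ) (δ ++ β) i j h

theorem reflTransGen_swap_append {ω ω' : List ℕ} (h : Relation.ReflTransGen Swap ω ω')
    (α β : List ℕ) : Relation.ReflTransGen Swap (α ++ ω ++ β) (α ++ ω' ++ β) :=
  Relation.ReflTransGen.lift (fun ω => α ++ ω ++ β) (fun _ _ h => h.append α β) _ _ h

/-- Turns equality in the presented monoid into explicit moves: the first letter of `ω` is brought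
to the front of `ω'` by swaps, and the tails are handled by induction. -/
theorem reflTransGen_swap_of_mk_eq {ω ω' : List ℕ} (h : mk ω = mk ω') :
    Relation.ReflTransGen Swap ω ω' := by
  induction ω generalizing ω' with
  | nil =>
    have := congrArg length h
    obtain rfl : ω' = [] := by simpa [eq_comm] using this
    rfl
  | cons x ω ih =>
    have key : ∀ (ω' : List ℕ) (u : Tr), of x * u = mk ω' →
        ∃ γ, u = mk γ ∧ Relation.ReflTransGen Swap (x :: γ) ω' := by
      intro ω'
      induction ω' with
      | nil =>
        intro u hu
        have := congrArg length hu
        simp at this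
      | cons y ω' ih' =>
        intro u hu
        rw [mk_cons] at hu
        rcases of_mul_eq_of_mul hu with ⟨rfl, rfl⟩ | ⟨hxy, w, rfl, hw⟩
        · exact ⟨ω', rfl, .refl⟩
        · obtain ⟨γ, rfl, hγ⟩ := ih' w hw.symm
          refine ⟨y :: γ, (mk_cons _ _).symm, .head (Swap.swap [] γ x y hxy) ?_⟩
          simpa using reflTransGen_swap_append hγ [y] []
    rw [mk_cons] at h
    obtain ⟨γ, h1, h2⟩ := key ω' _ h
    exact Relation.ReflTransGen.trans (by simpa using reflTransGen_swap_append (ih h1) [x] []) h2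

end Tr

end CTilde

namespace CTilde

/-! ### Weighted rewriting of traces -/

/-- The data of a rewriting system on traces with the rules `ii → d i · i`, `iji → c i j · i` for
`T i j`, and `ijij → c i j · ij` for `F i j`. -/
structure RewritingSystem (K : Type*) [Field K] where
  ofData ::
  /-- the weight of `ii → i` -/
  d : ℕ → K
  /-- the weight of `iji → i` and `ijij → ij` -/
  c : ℕ → ℕ → K
  /-- `iji` is reducible -/
  T : ℕ → ℕ → Prop
  /-- `ijij` is reducible -/
  F : ℕ → ℕ → Prop
  T_adj : ∀ i j, T i j → i + 1 = j ∨ j + 1 = i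
  F_adj : ∀ i j, F i j → i + 1 = j ∨ j + 1 = i
  F_symm : ∀ i j, F i j → F j i
  -- With `F_symm`, neither `iji` nor `jij` is reducible when `ijij` is.
  not_T_of_F : ∀ i j, F i j → ¬ T i j
  c_symm : ∀ i j, c i j = c j i
  -- The one critical pair that constrains the weights: `y y' z y y'`, where `y` and `y'` are the
  -- two neighbours of `z`, contains both `yzy` and `y'zy'`. The two reductions reach `y y'` with
  -- weights `c y z * d y'` and `c y' z * d y`.
  cross : ∀ y y' z, T y z → T y' z → y ≠ y' → c y z * d y' = c y' z * d y

namespace RewritingSystem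

variable {K : Type*} [Field K] (S : RewritingSystem K)

/-- The rewriting rules. -/
inductive Rule : List ℕ → K → List ℕ → Prop
  | sq (i : ℕ) : Rule [i, i] (S.d i) [i]
  | three (i j : ℕ) (h : S.T i j) : Rule [i, j, i] (S.c i j) [i]
  | four (i j : ℕ) (h : S.F i j) : Rule [i, j, i, j] (S.c i j) [i, j]

variable {S}

/-- Consequently overlaps of left sides inside a trace are overlaps of words, by
`Tr.exists_append_of_mk_eq_mul`. -/
theorem Rule.rigid {P Q : List ℕ} {c : K} (h : S.Rule P c Q) :
    P.IsChain fun i j => ¬ Ind i j := by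
  cases h with
  | sq i => simp [Ind]
  | three i j h => have := S.T_adj i j h; simp [Ind]; omega
  | four i j h => have := S.F_adj i j h; simp [Ind]; omega

theorem Rule.subset {P Q : List ℕ} {c : K} (h : S.Rule P c Q) : ∀ x ∈ Q, x ∈ P := by
  cases h <;> simp

theorem Rule.length_lt {P Q : List ℕ} {c : K} (h : S.Rule P c Q) : Q.length < P.length := by
  cases h <;> simp

theorem Rule.two_le_length {P Q : List ℕ} {c : K} (h : S.Rule P c Q) : 2 ≤ P.length := by
  cases h <;> simp

/-- Every rule preserves the first letter, and by `Rule.exists_concat` the last letter, of its left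
side. Two rules that share a single end letter therefore remain applicable one after the other. -/
theorem Rule.exists_cons {x : ℕ} {γ Q : List ℕ} {c : K} (h : S.Rule (x :: γ) c Q) :
    ∃ γ', Q = x :: γ' := by
  cases h <;> simp

theorem Rule.exists_concat {x : ℕ} {α P Q : List ℕ} {c : K} (h : S.Rule P c Q)
    (hP : P = α ++ [x]) : ∃ α', Q = α' ++ [x] := by
  cases h with
  | sq i => rcases α with _ | ⟨a, _ | ⟨b, α⟩⟩ <;> simp at hP; exact ⟨[], by simp; omega⟩
  | three i j h =>
    rcases α with _ | ⟨a, _ | ⟨b, _ | ⟨e, α⟩⟩⟩ <;> simp at hP; exact ⟨[], by simp; omega⟩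
  | four i j h =>
    rcases α with _ | ⟨a, _ | ⟨b, _ | ⟨e, _ | ⟨f, α⟩⟩⟩⟩ <;> simp at hP
    exact ⟨[i], by simp; omega⟩

/-- Left sides involve at most two letters, which alternate, so the longer piece already has all of
them. Whatever is independent of that piece is then independent of the whole left side. -/
theorem Rule.full {P Q α β : List ℕ} {c : K} (h : S.Rule P c Q) (hP : P = α ++ β) :
    (∀ x ∈ P, x ∈ α) ∨ (∀ x ∈ P, x ∈ β) := by
  cases h with
  | sq i => rcases α with _ | ⟨a, _ | ⟨b, α⟩⟩ <;> simp at hP ⊢ <;> grind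
  | three i j h => rcases α with _ | ⟨a, _ | ⟨b, _ | ⟨e, α⟩⟩⟩ <;> simp at hP ⊢ <;> grind
  | four i j h =>
    rcases α with _ | ⟨a, _ | ⟨b, _ | ⟨e, _ | ⟨f, α⟩⟩⟩⟩ <;> simp at hP ⊢ <;> grind

theorem Rule.mem_of_two_le {P Q α β γ : List ℕ} {c : K} (h : S.Rule P c Q)
    (hP : P = α ++ β ++ γ) (hβ : 2 ≤ β.length) : ∀ x ∈ P, x ∈ β := by
  have hl := congrArg List.length hP
  cases h <;>
    rcases α with _ | ⟨a, _ | ⟨b, _ | ⟨e, α⟩⟩⟩ <;>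
    rcases β with _ | ⟨a', _ | ⟨b', β⟩⟩ <;>
    simp at hP hβ hl ⊢ <;> first | (exfalso; omega) | grind

/-- Two rules that overlap in at least two letters. -/
theorem Rule.overlap {P Q P' Q' α β γ : List ℕ} {c c' : K} (h : S.Rule P c Q)
    (h' : S.Rule P' c' Q') (hP' : P' = α ++ β) (hP : P = β ++ γ) (hβ : 2 ≤ β.length) :
    c = c' ∧ Q' ++ γ = α ++ Q := by
  have hT := S.T_adj
  have hF := S.F_adj
  have hs := S.F_symm
  have hTF := S.not_T_of_F
  have hc := S.c_symm
  cases h <;> cases h' <;>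
    rcases α with _ | ⟨a, _ | ⟨b, _ | ⟨e, _ | ⟨f, α⟩⟩⟩⟩ <;>
    rcases β with _ | ⟨a', _ | ⟨b', _ | ⟨e', _ | ⟨f', _ | ⟨g', β⟩⟩⟩⟩⟩ <;>
    simp at hP hP' hβ ⊢ <;> grind

/-- A rule whose left side contains the left side of another one. -/
theorem Rule.nested {P Q P' Q' α γ : List ℕ} {c c' : K} (h : S.Rule P c Q)
    (h' : S.Rule P' c' Q') (hP' : P' = α ++ P ++ γ) : c = c' ∧ Q' = α ++ Q ++ γ := by
  have hT := S.T_adj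
  have hF := S.F_adj
  have hs := S.F_symm
  have hTF := S.not_T_of_F
  have hl := congrArg List.length hP'
  cases h <;> cases h' <;>
    rcases α with _ | ⟨a, _ | ⟨b, _ | ⟨e, α⟩⟩⟩ <;>
    simp at hP' hl ⊢ <;> first | (exfalso; omega) | grind

/-- Two rules that cross in one letter. -/
theorem Rule.crossing {P Q P' Q' α β γ α' γ' : List ℕ} {c c' : K} (h : S.Rule P c Q)
    (h' : S.Rule P' c' Q') (hP : P = α ++ β ++ γ) (hP' : P' = α' ++ β ++ γ') (hβ : β ≠ [])
    (hα : ∀ x ∈ α', ∀ y ∈ α, Ind x y) (hγ : ∀ x ∈ γ, ∀ y ∈ γ', Ind x y)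
    (hne : (α ≠ [] ∧ α' ≠ []) ∨ (γ ≠ [] ∧ γ' ≠ [])) :
    ∃ y y' z, S.T y z ∧ S.T y' z ∧ Ind y y' ∧ α = [y] ∧ β = [z] ∧ γ = [y] ∧ α' = [y'] ∧
      γ' = [y'] ∧ c = S.c y z ∧ c' = S.c y' z ∧ Q = [y] ∧ Q' = [y'] := by
  have hT := S.T_adj
  have hF := S.F_adj
  cases h <;>
    rcases α with _ | ⟨a, _ | ⟨b, _ | ⟨e, _ | ⟨f, α⟩⟩⟩⟩ <;>
    rcases β with _ | ⟨a', _ | ⟨b', _ | ⟨e', _ | ⟨f', β⟩⟩⟩⟩ <;>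
    simp only [List.cons_append, List.nil_append, List.append_assoc, List.cons.injEq,
      reduceCtorEq, ne_eq, not_true_eq_false, List.nil_eq, and_false, List.append_eq_nil_iff] at hP hβ <;>
    cases h' <;>
    rcases α' with _ | ⟨a'', _ | ⟨b'', _ | ⟨e'', _ | ⟨f'', α'⟩⟩⟩⟩ <;>
    simp only [List.cons_append, List.nil_append, List.append_assoc, List.cons.injEq,
      reduceCtorEq, List.nil_eq, and_false, List.append_eq_nil_iff] at hP' <;>
    (repeat' (obtain ⟨rfl, hP⟩ := hP)) <;> (repeat' (obtain ⟨rfl, hP'⟩ := hP')) <;>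
    (try obtain ⟨-, rfl⟩ := hP') <;>
    simp [Ind] at hα hγ hne ⊢ <;> grind

end RewritingSystem

end CTilde

/-! ### Local confluence of weighted rewriting. -/

namespace CTilde

namespace RewritingSystem

variable {K : Type*} [Field K] {S : RewritingSystem K}

variable (S)

/-- One rewriting step. -/
def Step (t : Tr) (c : K) (t' : Tr) : Prop :=
  ∃ a b P Q, S.Rule P c Q ∧ t = a * Tr.mk P * b ∧ t' = a * Tr.mk Q * b

/-- A trace to which no rule applies. -/
def Irred (t : Tr) : Prop := ∀ c u, ¬ S.Step t c u

variable {S}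

theorem Step.mul_mul {t t' : Tr} {c : K} (h : S.Step t c t') (x y : Tr) :
    S.Step (x * t * y) c (x * t' * y) := by
  obtain ⟨a, b, P, Q, h, rfl, rfl⟩ := h
  exact ⟨x * a, b * y, P, Q, h, by simp only [mul_assoc], by simp only [mul_assoc]⟩

theorem Step.length_lt {t t' : Tr} {c : K} (h : S.Step t c t') : t'.length < t.length := by
  obtain ⟨a, b, P, Q, h, rfl, rfl⟩ := h
  have := h.length_lt
  simp
  omega

/-- The results of two rewriting steps, with their weights, have a common reduct. -/
def Join (S : RewritingSystem K) (c : K) (t : Tr) (c' : K) (t' : Tr) : Prop :=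
  (c = c' ∧ t = t') ∨ ∃ e e' u, S.Step t e u ∧ S.Step t' e' u ∧ c * e = c' * e'

theorem Join.symm {c c' : K} {t t' : Tr} (h : S.Join c t c' t') : S.Join c' t' c t := by
  rcases h with ⟨rfl, rfl⟩ | ⟨e, e', u, h, h', he⟩
  · exact .inl ⟨rfl, rfl⟩
  · exact .inr ⟨e', e, u, h', h, he.symm⟩

/-- Rewriting two disjoint factors commutes. -/
theorem Join.of_disjoint {P Q P' Q' : List ℕ} {c c' : K} (h : S.Rule P c Q)
    (h' : S.Rule P' c' Q') (X Y Z : Tr) :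
    S.Join c (X * Tr.mk Q * Y * Tr.mk P' * Z) c' (X * Tr.mk P * Y * Tr.mk Q' * Z) := by
  refine .inr ⟨c', c, X * Tr.mk Q * Y * Tr.mk Q' * Z, ⟨_, _, _, _, h', rfl, rfl⟩,
    ⟨X, Y * Tr.mk Q' * Z, _, _, h, ?_, ?_⟩, mul_comm _ _⟩ <;> simp only [mul_assoc]

open Tr in
/-- Local confluence in the case where the two left sides have no common letter. -/
theorem join_of_disjoint {P Q P' Q' : List ℕ} {c c' : K} (h : S.Rule P c Q)
    (h' : S.Rule P' c' Q') {p₁₁ p₁₂ p₁₃ p₂₁ p₂₃ p₃₁ p₃₂ p₃₃ : Tr}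
    (hP : mk P = p₂₁ * p₂₃) (hP' : mk P' = p₁₂ * p₃₂)
    (i1221 : Indep p₁₂ p₂₁) (i1231 : Indep p₁₂ p₃₁) (i1321 : Indep p₁₃ p₂₁)
    (i1331 : Indep p₁₃ p₃₁) (i1332 : Indep p₁₃ p₃₂) (i2331 : Indep p₂₃ p₃₁)
    (i2332 : Indep p₂₃ p₃₂) :
    S.Join c (p₁₁ * p₁₂ * p₁₃ * mk Q * (p₃₁ * p₃₂ * p₃₃)) c'
      (p₁₁ * p₂₁ * p₃₁ * mk Q' * (p₁₃ * p₂₃ * p₃₃)) := by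
  obtain ⟨α, γ, hα, rfl, rfl⟩ := exists_append_of_mk_eq_mul h.rigid hP
  obtain ⟨α', γ', hα', rfl, rfl⟩ := exists_append_of_mk_eq_mul h'.rigid hP'
  have hsub : ∀ x ∈ letters (mk Q), x ∈ letters (mk P) := by
    simpa only [mem_letters_mk] using h.subset
  have hsub' : ∀ x ∈ letters (mk Q'), x ∈ letters (mk P') := by
    simpa only [mem_letters_mk] using h'.subset
  -- Each left side has one piece with all its letters. In each of the four cases the resulting
  -- independences move the pieces together, so that `P` and `P'` become disjoint factors of one
  -- product.
  rcases h.full hα with hf | hf <;> rcases h'.full hα' with hf' | hf' <;>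
    replace hf : ∀ x ∈ letters (mk P), _ ∈ letters (mk _) :=
      fun x hx => mem_letters_mk.2 (hf x (mem_letters_mk.1 hx)) <;>
    replace hf' : ∀ x ∈ letters (mk P'), _ ∈ letters (mk _) :=
      fun x hx => mem_letters_mk.2 (hf' x (mem_letters_mk.1 hx))
  · have hPP' : Indep (mk P') (mk P) := (i1221.mono_left hf').mono_right hf
    have h13P : Indep p₁₃ (mk P) := i1321.mono_right hf
    have e1 := (i1221.mono_right fun x hx => hf x (hsub x hx)).commute
    have e2 := (h13P.mono_right hsub).commute
    have e3 := (h13P.mono_right (t' := mk γ) (by simp +contextual [hα, mem_letters_mk])).commute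
    have e4 := ((hPP'.mono_left hsub').mono_right (t' := mk γ)
      (by simp +contextual [hα, mem_letters_mk])).commute
    convert Join.of_disjoint h h' p₁₁ p₃₁ (p₁₃ * p₃₃) using 1
    · rw [hP']
      simp only [mul_assoc, e1.left_comm, e2.left_comm, i1231.commute.left_comm,
        i1331.commute.left_comm, i1332.commute.left_comm]
    · rw [hP]
      simp only [mul_assoc, e3.left_comm, e4.left_comm, i2331.symm.commute.left_comm]
  · have h13P : Indep p₁₃ (mk P) := i1321.mono_right hf
    have h12P : Indep (mk α') (mk P) := i1221.mono_right hf
    have h23P' : Indep (mk γ) (mk P') := i2332.mono_right hf'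
    have e1 := (h12P.mono_right hsub).commute
    have e2 := (h13P.mono_right hsub).commute
    have e3 := (h13P.mono_right (t' := mk γ) (by simp +contextual [hα, mem_letters_mk])).commute
    have e4 := (h23P'.mono_right hsub').symm.commute
    convert Join.of_disjoint h h' p₁₁ p₃₁ (p₁₃ * p₃₃) using 1
    · rw [hP']
      simp only [mul_assoc, e1.left_comm, e2.left_comm, i1231.commute.left_comm,
        i1331.commute.left_comm, i1332.commute.left_comm]
    · rw [hP]
      simp only [mul_assoc, e3.left_comm, e4.left_comm, i2331.symm.commute.left_comm]
  · have h21P' : Indep (mk P') (mk α) := i1221.mono_left hf'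
    have h32P : Indep (mk P) (mk γ') := i2332.mono_left hf
    have h31P : Indep (mk P) p₃₁ := i2331.mono_left hf
    have h31P' : Indep (mk P') p₃₁ := i1231.mono_left hf'
    have e1 := (h31P'.mono_left (s' := mk γ') (by simp +contextual [hα', mem_letters_mk])).symm.commute
    have e2 := (h32P.mono_left hsub).commute
    have e3 := (h21P'.mono_left hsub').symm.commute
    have e4 := (h31P.mono_left (s' := mk α) (by simp +contextual [hα, mem_letters_mk])).symm.commute
    have e5 := (h31P'.mono_left hsub').symm.commute
    refine Join.symm ?_
    convert Join.of_disjoint h' h p₁₁ p₁₃ (p₃₁ * p₃₃) using 1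
    · rw [hP]
      simp only [mul_assoc, e3.left_comm, e5.left_comm,
        i1331.symm.commute.left_comm, i1321.symm.commute.left_comm,
        i2331.symm.commute.left_comm]
    · rw [hP']
      simp only [mul_assoc, e1.left_comm, e2.left_comm, i1332.commute.left_comm]
  · have hPP' : Indep (mk P) (mk P') := (i2332.mono_left hf).mono_right hf'
    have h31P : Indep (mk P) p₃₁ := i2331.mono_left hf
    have e1 := (h31P.mono_left hsub).commute
    have e2 := ((hPP'.mono_left hsub).mono_right (t' := mk γ')
      (by simp +contextual [hα', mem_letters_mk])).commute
    have e3 := (h31P.mono_left (s' := mk α) (by simp +contextual [hα, mem_letters_mk])).commute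
    have e4 := ((hPP'.mono_right hsub').mono_left (s' := mk α)
      (by simp +contextual [hα, mem_letters_mk])).commute
    refine Join.symm ?_
    convert Join.of_disjoint h' h (p₁₁ * p₃₁) p₁₃ p₃₃ using 1
    · rw [hP]
      simp only [mul_assoc, e3.left_comm, e4.left_comm, i1321.symm.commute.left_comm]
    · rw [hP']
      simp only [mul_assoc, e1.left_comm, e2.left_comm, i1231.commute.left_comm,
        i1331.commute.left_comm, i1332.commute.left_comm]

open Tr in
/-- Local confluence in the case where the left side `P'` ends with the beginning of `P`. -/
theorem join_of_overlap {α β γ Q Q' : List ℕ} {c c' : K} (h : S.Rule (β ++ γ) c Q)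
    (h' : S.Rule (α ++ β) c' Q') (hβ : β ≠ []) {p₁₁ p₁₃ p₃₁ p₃₃ : Tr}
    (i1331 : Indep p₁₃ p₃₁) (i1231 : Indep (mk α) p₃₁) (i2331 : Indep (mk γ) p₃₁)
    (i13 : Indep p₁₃ (mk β)) (i31 : Indep (mk β) p₃₁) :
    S.Join c (p₁₁ * mk α * p₁₃ * mk Q * (p₃₁ * p₃₃)) c'
      (p₁₁ * p₃₁ * mk Q' * (p₁₃ * mk γ * p₃₃)) := by
  have e1 : Indep (mk Q) p₃₁ := by
    refine Indep.mono_left (s := mk (β ++ γ)) ?_ ?_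
    · simp [mk_append, i2331, i31]
    · simpa only [mem_letters_mk] using h.subset
  have e2 : Indep (mk Q') p₃₁ := by
    refine Indep.mono_left (s := mk (α ++ β)) ?_ ?_
    · simp [mk_append, i1231, i31]
    · simpa only [mem_letters_mk] using h'.subset
  -- If at least two letters are shared, the two results already coincide. A single shared letter
  -- survives either rule, so the other rule can still be applied.
  by_cases hl : 2 ≤ β.length
  · left
    obtain ⟨rfl, hQ⟩ := h.overlap h' rfl rfl hl
    refine ⟨rfl, ?_⟩
    have e3 : Indep p₁₃ (mk Q) := i13.mono_right fun x hx => mem_letters_mk.2 <|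
      h.mem_of_two_le (α := []) rfl hl x (h.subset x (mem_letters_mk.1 hx))
    have e4 : Indep p₁₃ (mk α) := i13.mono_right fun x hx => mem_letters_mk.2 <|
      h'.mem_of_two_le (α := α) (γ := []) (by simp) hl x (by simp [mem_letters_mk.1 hx])
    have e5 : Indep p₁₃ (mk Q') := i13.mono_right fun x hx => mem_letters_mk.2 <|
      h'.mem_of_two_le (α := α) (γ := []) (by simp) hl x (h'.subset x (mem_letters_mk.1 hx))
    have hQ' := congrArg mk hQ
    rw [mk_append, mk_append] at hQ'
    calc _ = p₁₁ * p₃₁ * p₁₃ * (mk α * mk Q) * p₃₃ := by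
          simp only [mul_assoc, e1.commute.left_comm, e4.symm.commute.left_comm,
            i1331.commute.left_comm, i1231.commute.left_comm]
      _ = _ := by
          rw [← hQ']
          simp only [mul_assoc, e5.commute.left_comm]
  · obtain ⟨x, rfl⟩ : ∃ x, β = [x] := by
      rcases β with _ | ⟨x, _ | ⟨y, β⟩⟩ <;> simp at hl hβ ⊢
    obtain ⟨γ', rfl⟩ := h.exists_cons
    obtain ⟨α', rfl⟩ := h'.exists_concat rfl
    rw [mk_cons, indep_mul_left] at e1
    rw [mk_append, indep_mul_left] at e2
    rw [mk_singleton] at i13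
    right
    refine ⟨c', c, p₁₁ * mk α' * p₁₃ * of x * mk γ' * p₃₁ * p₃₃,
      ⟨p₁₁, p₁₃ * mk γ' * p₃₁ * p₃₃, _, _, h', ?_, ?_⟩,
      ⟨p₁₁ * mk α' * p₁₃, p₃₁ * p₃₃, _, _, h, ?_, ?_⟩, mul_comm _ _⟩
    all_goals
      simp only [mk_append, mk_cons, mk_nil, mul_one, mul_assoc, List.cons_append, List.nil_append,
        i13.commute.left_comm, i1331.commute.left_comm, i2331.commute.left_comm,
        e1.1.commute.left_comm, e1.2.commute.left_comm, e2.1.commute.left_comm]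

open Tr in
/-- Local confluence in the case where one left side contains the other one. -/
theorem join_of_nested {P Q P' Q' α γ : List ℕ} {c c' : K} (h : S.Rule P c Q)
    (h' : S.Rule P' c' Q') (hP' : P' = α ++ P ++ γ) {p₁₁ p₁₃ p₃₁ p₃₃ : Tr}
    (i1231 : Indep (mk α) p₃₁) (i1331 : Indep p₁₃ p₃₁) (i1322 : Indep p₁₃ (mk P))
    (i1332 : Indep p₁₃ (mk γ)) (i2231 : Indep (mk P) p₃₁) :
    S.Join c (p₁₁ * mk α * p₁₃ * mk Q * (p₃₁ * mk γ * p₃₃)) c'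
      (p₁₁ * mk [] * p₃₁ * mk Q' * (p₁₃ * mk [] * p₃₃)) := by
  left
  obtain ⟨rfl, rfl⟩ := h.nested h' hP'
  refine ⟨rfl, ?_⟩
  have e1 : Indep p₁₃ (mk Q) := i1322.mono_right fun x hx =>
    mem_letters_mk.2 (h.subset x (mem_letters_mk.1 hx))
  have e2 : Indep (mk Q) p₃₁ := i2231.mono_left fun x hx =>
    mem_letters_mk.2 (h.subset x (mem_letters_mk.1 hx))
  simp only [mk_append, mk_nil, mul_one, mul_assoc, e1.commute.left_comm, e2.commute.left_comm,
    i1332.commute.left_comm, i1331.commute.left_comm, i1231.commute.left_comm]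

open Tr in
/-- Local confluence. -/
theorem join_of_rule {P Q P' Q' : List ℕ} {c c' : K} (h : S.Rule P c Q) (h' : S.Rule P' c' Q')
    {a b a' b' : Tr} (heq : a * mk P * b = a' * mk P' * b') :
    S.Join c (a * mk Q * b) c' (a' * mk Q' * b') := by
  obtain ⟨p₁₁, p₁₂, p₁₃, p₂₁, p₂₂, p₂₃, p₃₁, p₃₂, p₃₃, rfl, hP, rfl, rfl, hP', rfl, i1221, i1231,
    i1321, i1331, i1322, i1332, i2231, i2331, i2332⟩ := levi_three heq
  -- `p₂₂` is the common part of the two left sides. If it is nontrivial, then `P = α β γ` and `P' =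
  -- α' β γ'` with the same word `β`. The emptiness pattern of the outer pieces distinguishes
  -- crossing, nesting and end-to-end overlap.
  by_cases h22 : p₂₂ = 1
  · subst h22
    rw [mul_one] at hP hP'
    exact join_of_disjoint h h' hP hP' i1221 i1231 i1321 i1331 i1332 i2331 i2332
  obtain ⟨_, γ, hPγ, h1, rfl⟩ := exists_append_of_mk_eq_mul h.rigid hP
  have hr := h.rigid
  rw [hPγ, List.isChain_append] at hr
  obtain ⟨α, β, rfl, rfl, rfl⟩ := exists_append_of_mk_eq_mul hr.1 h1.symm
  obtain ⟨_, γ', hPγ', h1', rfl⟩ := exists_append_of_mk_eq_mul h'.rigid hP'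
  have hr' := h'.rigid
  rw [hPγ', List.isChain_append] at hr'
  obtain ⟨α', β', rfl, rfl, hββ'⟩ := exists_append_of_mk_eq_mul hr'.1 h1'.symm
  obtain rfl := mk_injOn_rigid (List.isChain_append.1 hr.1).2.1 hββ'
  have hβ : β ≠ [] := by rintro rfl; exact h22 rfl
  have hα : ∀ x ∈ α', ∀ y ∈ α, Ind x y := fun x hx y hy =>
    i1221 x (mem_letters_mk.2 hx) y (mem_letters_mk.2 hy)
  have hγ : ∀ x ∈ γ, ∀ y ∈ γ', Ind x y := fun x hx y hy =>
    i2332 x (mem_letters_mk.2 hx) y (mem_letters_mk.2 hy)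
  by_cases hne : (α ≠ [] ∧ α' ≠ []) ∨ (γ ≠ [] ∧ γ' ≠ [])
  · obtain ⟨y, y', z, hT, hT', hy, rfl, rfl, rfl, rfl, rfl, rfl, rfl, rfl, rfl⟩ :=
      h.crossing h' hPγ hPγ' hβ hα hγ hne
    right
    refine ⟨S.d y', S.d y, p₁₁ * p₁₃ * of y * of y' * p₃₁ * p₃₃,
      ⟨p₁₁ * p₁₃ * of y, p₃₁ * p₃₃, _, _, .sq y', ?_, ?_⟩,
      ⟨p₁₁ * p₁₃, of y' * p₃₁ * p₃₃, _, _, .sq y, ?_, ?_⟩, S.cross y y' z hT hT' hy.ne⟩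
    all_goals
      simp only [mk_singleton] at i1332 i1231 i2331 i1321
      simp only [mk_cons, mk_nil, mul_one, mul_assoc, i1332.symm.commute.left_comm,
        i1231.commute.left_comm, i1331.symm.commute.left_comm, i2331.symm.commute.left_comm,
        i1321.symm.commute.left_comm, (indep_of_of.2 hy).symm.commute.left_comm]
  · rw [not_or, not_and_or, not_and_or, not_not, not_not, not_not, not_not] at hne
    obtain ⟨rfl | rfl, rfl | rfl⟩ := hne
    · simp only [List.nil_append, List.append_nil] at hPγ
      subst hPγ
      exact join_of_nested h h' hPγ' i1231 i1331 i1322 i1332 i2231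
    · subst hPγ hPγ'
      simp only [List.nil_append, List.append_nil, mk_nil, mul_one, one_mul] at *
      exact join_of_overlap h h' hβ i1331 i1231 i2331 i1322 i2231
    · subst hPγ hPγ'
      simp only [List.nil_append, List.append_nil, mk_nil, mul_one, one_mul] at *
      have := join_of_overlap h' h hβ i1331.symm i1321.symm i1332.symm i2231.symm i1322.symm
        (p₁₁ := p₁₁) (p₃₃ := p₃₃)
      exact this.symm
    · simp only [List.nil_append, List.append_nil] at hPγ'
      subst hPγ'
      exact (join_of_nested h' h hPγ i1321.symm i1331.symm i2231.symm i2331.symm i1322.symm).symm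

theorem Step.join {t u u' : Tr} {c c' : K} (h : S.Step t c u) (h' : S.Step t c' u') :
    S.Join c u c' u' := by
  obtain ⟨a, b, P, Q, h, rfl, rfl⟩ := h
  obtain ⟨a', b', P', Q', h', heq, rfl⟩ := h'
  exact join_of_rule h h' heq

/-! ### Normal forms of traces -/

open Classical in
/-- The normal form of a trace, an element of the free module on the traces. -/
noncomputable def nf (S : RewritingSystem K) (t : Tr) : Tr →₀ K :=
  if h : ∃ p : K × Tr, S.Step t p.1 p.2 then h.choose.1 • nf S h.choose.2
  else Finsupp.single t 1
termination_by t.length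
decreasing_by exact h.choose_spec.length_lt

theorem nf_of_irred {t : Tr} (h : S.Irred t) : S.nf t = Finsupp.single t 1 := by
  rw [nf, dif_neg]
  rintro ⟨p, hp⟩
  exact h _ _ hp

/-- Newman's argument with weights, by induction on the length: the step chosen in `nf` and the
given step join after at most one further step on each side, with equal products of weights. Hence
the choice does not matter. -/
theorem Step.nf_eq {t u : Tr} {c : K} (h : S.Step t c u) : S.nf t = c • S.nf u := by
  induction hl : t.length using Nat.strong_induction_on generalizing t u c with
  | _ l ih =>
    have hex : ∃ p : K × Tr, S.Step t p.1 p.2 := ⟨(c, u), h⟩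
    rw [nf, dif_pos hex]
    have hs := hex.choose_spec
    rcases hs.join h with ⟨h1, h2⟩ | ⟨e, e', v, h1, h2, h3⟩
    · rw [h1, h2]
    · rw [ih _ (hl ▸ hs.length_lt) h1 rfl, ih _ (hl ▸ h.length_lt) h2 rfl, smul_smul, smul_smul,
        h3]

/-- Every trace is, up to a weight, equal to an irreducible one. -/
theorem exists_nf_eq_smul (t : Tr) : ∃ (c : K) (u : Tr), S.nf t = c • Finsupp.single u 1 ∧
    S.Irred u ∧ u.length ≤ t.length ∧ (∀ x y, S.nf (x * t * y) = c • S.nf (x * u * y)) ∧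
    (¬ S.Irred t → u.length < t.length) := by
  induction hl : t.length using Nat.strong_induction_on generalizing t with
  | _ l ih =>
    by_cases h : S.Irred t
    · exact ⟨1, t, by rw [nf_of_irred h, one_smul], h, hl.le, by simp, fun h' => (h' h).elim⟩
    · unfold Irred at h
      push Not at h
      obtain ⟨c, u, hu⟩ := h
      obtain ⟨e, v, h1, h2, h3, h4, -⟩ := ih _ (hl ▸ hu.length_lt) u rfl
      have := hu.length_lt
      refine ⟨c * e, v, by rw [hu.nf_eq, h1, smul_smul], h2, by omega, fun x y => ?_,
        fun _ => by omega⟩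
      rw [(hu.mul_mul x y).nf_eq, h4, smul_smul]

/-- Left multiplication by the letter `i` on normal forms. -/
noncomputable def leftOp (S : RewritingSystem K) (i : ℕ) : Module.End K (Tr →₀ K) :=
  Finsupp.lift _ K Tr fun t => S.nf (Tr.of i * t)

theorem leftOp_single (i : ℕ) (t : Tr) : S.leftOp i (Finsupp.single t 1) = S.nf (Tr.of i * t) := by
  simp [leftOp]

/-- Normalizing before or after a multiplication gives the same result, since `exists_nf_eq_smul`
carries its scalar through any context. Commutations and rules thus pass from traces to operators.
-/
theorem leftOp_nf (i : ℕ) (t : Tr) : S.leftOp i (S.nf t) = S.nf (Tr.of i * t) := by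
  obtain ⟨c, u, h1, -, -, h4, -⟩ := exists_nf_eq_smul (S := S) t
  have := h4 (Tr.of i) 1
  rw [mul_one, mul_one] at this
  rw [h1, map_smul, leftOp_single, this]

theorem leftOp_comm {i j : ℕ} (h : Ind i j) :
    S.leftOp i * S.leftOp j = S.leftOp j * S.leftOp i := by
  refine Finsupp.lhom_ext' fun t => LinearMap.ext_ring ?_
  simp only [LinearMap.comp_apply, Finsupp.lsingle_apply, Module.End.mul_apply, leftOp_single,
    leftOp_nf]
  rw [← mul_assoc, Tr.of_comm h, mul_assoc]

/-- The action of traces by left multiplication on normal forms. -/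
noncomputable def leftMul (S : RewritingSystem K) : Tr →* Module.End K (Tr →₀ K) :=
  Tr.lift S.leftOp fun _ _ h => leftOp_comm h

@[simp] theorem leftMul_of (i : ℕ) : S.leftMul (Tr.of i) = S.leftOp i := rfl

theorem leftMul_nf (s t : Tr) : S.leftMul s (S.nf t) = S.nf (s * t) := by
  induction s using Tr.induction with
  | one => simp
  | cons i s ih =>
    rw [map_mul, Module.End.mul_apply, ih, leftMul_of, leftOp_nf, mul_assoc]

theorem irred_one : S.Irred 1 := by
  rintro c u ⟨a, b, P, Q, h, h1, -⟩
  have h2 := congrArg Tr.length h1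
  have := h.two_le_length
  simp at h2
  omega

theorem leftMul_single_one (t : Tr) : S.leftMul t (Finsupp.single 1 1) = S.nf t := by
  rw [← nf_of_irred irred_one, leftMul_nf, mul_one]

/-- The rules hold for the operators of left multiplication. -/
theorem Rule.leftMul_eq {P Q : List ℕ} {c : K} (h : S.Rule P c Q) :
    S.leftMul (Tr.mk P) = c • S.leftMul (Tr.mk Q) := by
  refine Finsupp.lhom_ext' fun t => LinearMap.ext_ring ?_
  simp only [LinearMap.comp_apply, Finsupp.lsingle_apply, LinearMap.smul_apply]
  -- The operators act on all traces, including reducible ones. Only after at least one letter has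
  -- acted is the result normalized, which is why `s ≠ 1` is needed.
  have h1 : ∀ (s : Tr), s ≠ 1 → S.leftMul s (Finsupp.single t 1) = S.nf (s * t) := by
    intro s
    induction s using Tr.induction with
    | one => intro h; exact absurd rfl h
    | cons i s ih =>
      intro _
      by_cases hs : s = 1
      · subst hs; simp [leftOp_single]
      · rw [map_mul, Module.End.mul_apply, ih hs, leftMul_of, leftOp_nf, mul_assoc]
  have h2 : Tr.mk P ≠ 1 := fun h' => by
    have := congrArg Tr.length h'
    cases h <;> simp at this
  have h3 : Tr.mk Q ≠ 1 := fun h' => by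
    have := congrArg Tr.length h'
    cases h <;> simp at this
  rw [h1 _ h2, h1 _ h3]
  exact Step.nf_eq ⟨1, t, P, Q, h, by simp, by simp⟩

end RewritingSystem

end CTilde

namespace CTilde

theorem coxeterMatrix_apply {n : ℕ} (i j : Fin (n + 1)) : coxeterMatrix n i j =
    if i = j then 1 else if i.val + 1 < j.val ∨ j.val + 1 < i.val then 2
    else if i.val = 0 ∨ j.val = 0 ∨ i.val = n ∨ j.val = n then 4 else 3 := rfl

theorem coxeterMatrix_eq_two_iff {n : ℕ} {i j : Fin (n + 1)} :
    coxeterMatrix n i j = 2 ↔ Ind i j := by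
  unfold Ind
  rw [coxeterMatrix_apply]
  split_ifs with h1 h2 h3 <;> simp_all

/-! ### The rewriting systems of `TLC̃_n` and of its quotient -/

/-- The edge `{i, j}` of the diagram is labelled `4`. -/
def IsFour (n i j : ℕ) : Prop := i = 0 ∨ j = 0 ∨ i = n ∨ j = n

open Classical in
/-- The rewriting system of the relations among the `U_i`; the rule `101 → κ 1` is added if `ε`
holds. -/
noncomputable def tlSystem {K : Type*} [Field K] (n : ℕ) (r R : K) (ε : Prop) :
    RewritingSystem K where
  d i := if i = 0 ∨ i = n then (R ^ 2 + 1) / R else (r ^ 2 + 1) / r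
  c i j := if IsFour n i j then kappa r R else 1
  -- When `ε` holds, `101` becomes reducible, and the rules for `1010` and `0101`, which contain it,
  -- are dropped from `F`.
  T i j := (i + 1 = j ∨ j + 1 = i) ∧ (¬ IsFour n i j ∨ (ε ∧ i = 1 ∧ j = 0))
  F i j := (i + 1 = j ∨ j + 1 = i) ∧ IsFour n i j ∧
    ¬ (ε ∧ ((i = 0 ∧ j = 1) ∨ (i = 1 ∧ j = 0)))
  T_adj _ _ h := h.1
  F_adj _ _ h := h.1
  F_symm i j h := by
    unfold IsFour at *
    refine ⟨by omega, by omega, fun h' => h.2.2 ⟨h'.1, by omega⟩⟩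
  not_T_of_F i j h h' := by
    rcases h'.2 with h1 | ⟨h1, h2⟩
    · exact h1 h.2.1
    · exact h.2.2 ⟨h1, .inr h2⟩
  c_symm i j := by
    have : IsFour n i j ↔ IsFour n j i := by unfold IsFour; omega
    simp only [this]
  cross y y' z h h' hne := by
    -- The rule `101` never takes part in a crossing: `0` has the single neighbour `1`, so distinct
    -- `y` and `y'` exclude `z = 0`. Both edges are then labelled `3`, the weights `c` are `1` and
    -- the weights `d` agree.
    have key : ∀ y y', y ≠ y' → (y' + 1 = z ∨ z + 1 = y') →
        (¬ IsFour n y z ∨ (ε ∧ y = 1 ∧ z = 0)) → ¬ IsFour n y z := by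
      rintro y y' h1 h2 (h3 | ⟨-, rfl, rfl⟩)
      · exact h3
      · omega
    have h1 := key y y' hne h'.1 h.2
    have h2 := key y' y hne.symm h.1 h'.2
    rw [if_neg h1, if_neg h2, if_neg, if_neg]
    · unfold IsFour at h1; tauto
    · unfold IsFour at h2; tauto

/-! ### Presentations by the `g_i` and by the `U_i` -/

section Ring

variable {K A : Type*} [Field K] [Ring A] [Algebra K A]

/-- In the variables `X = g + 1` the lower-order terms of `V` and `Z` recombine, and the quadratic
relations turn their vanishing into relations between monomials. -/
theorem polyV_sub_one (X Y : A) : polyV (X - 1) (Y - 1) = X * Y * X - X * X + X := by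
  unfold polyV; noncomm_ring

theorem polyZ_sub_one (X Y : A) :
    polyZ (X - 1) (Y - 1) = X * Y * X * Y - X * Y * Y - X * X * Y + X * Y + X * Y := by
  unfold polyZ; noncomm_ring

/-- The terms of `V` below degree three are symmetric in `x` and `y`, so `V(x, y) - V(y, x) = xyx -
yxy`. The braid relation follows as soon as `V` vanishes in both orders; the same holds for `Z` and
the relation of length four. -/
theorem braid_three_iff (x y : A) : x * y * x = y * x * y ↔ polyV x y = polyV y x := by
  rw [← sub_eq_zero, ← sub_eq_zero (b := polyV y x)]
  unfold polyV
  constructor <;> intro h <;> rw [← h] <;> noncomm_ring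

theorem braid_four_iff (x y : A) : x * y * x * y = y * x * y * x ↔ polyZ x y = polyZ y x := by
  rw [← sub_eq_zero, ← sub_eq_zero (b := polyZ y x)]
  unfold polyZ
  constructor <;> intro h <;> rw [← h] <;> noncomm_ring

theorem quadratic_iff (X : A) (a : K) :
    (X - 1) ^ 2 = (a - 1) • (X - 1) + algebraMap K A a ↔ X * X = (a + 1) • X := by
  have h1 : (X - 1) ^ 2 = X * X - 2 • X + 1 := by noncomm_ring
  have h2 : (a - 1) • (X - 1) + algebraMap K A a = (a + 1) • X - 2 • X + 1 := by
    rw [Algebra.algebraMap_eq_smul_one]; module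
  rw [h1, h2]
  constructor
  · intro h
    have := congrArg (fun z => z + 2 • X - 1) h
    simpa [sub_add_cancel] using this
  · intro h; rw [h]

theorem polyV_eq_zero_iff (X Y : A) (a : K) (hX : X * X = (a + 1) • X) :
    polyV (X - 1) (Y - 1) = 0 ↔ X * Y * X = a • X := by
  rw [polyV_sub_one, hX]
  rw [show X * Y * X - (a + 1) • X + X = X * Y * X - a • X by module, sub_eq_zero]

theorem polyZ_eq_zero_iff (X Y : A) (a a' : K) (hX : X * X = (a + 1) • X)
    (hY : Y * Y = (a' + 1) • Y) :
    polyZ (X - 1) (Y - 1) = 0 ↔ X * Y * X * Y = (a + a') • (X * Y) := by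
  rw [polyZ_sub_one, hX, mul_assoc X Y Y, hY, mul_smul_comm, smul_mul_assoc]
  rw [show X * Y * X * Y - (a' + 1) • (X * Y) - (a + 1) • (X * Y) + X * Y + X * Y =
    X * Y * X * Y - (a + a') • (X * Y) by module, sub_eq_zero]

end Ring

/-- The square root of the parameter of the node `i`. -/
def root {K : Type*} [Field K] (n : ℕ) (r R : K) (i : ℕ) : K := if i = 0 ∨ i = n then R else r

/-- The relations among the `U_i`. -/
structure URelations {K A : Type*} [Field K] [Ring A] [Algebra K A] (n : ℕ) (r R : K)
    (u : ℕ → A) : Prop where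
  sq : ∀ i ≤ n, u i * u i = ((root n r R i ^ 2 + 1) / root n r R i) • u i
  comm : ∀ i ≤ n, ∀ j ≤ n, Ind i j → u i * u j = u j * u i
  three : ∀ i ≤ n, ∀ j ≤ n, i + 1 = j ∨ j + 1 = i → ¬ IsFour n i j → u i * u j * u i = u i
  four : ∀ i ≤ n, ∀ j ≤ n, i + 1 = j ∨ j + 1 = i → IsFour n i j →
    u i * u j * u i * u j = kappa r R • (u i * u j)

section

variable {K A : Type*} [Field K] [Ring A] [Algebra K A] {n : ℕ} {r R : K}

theorem root_ne_zero (hr : r ≠ 0) (hR : R ≠ 0) (i : ℕ) : root n r R i ≠ 0 := by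
  unfold root; split_ifs <;> assumption

theorem root_of_isFour (hn : 2 ≤ n) {i j : ℕ} (h : i + 1 = j ∨ j + 1 = i) (h' : IsFour n i j) :
    (root n r R i = R ∧ root n r R j = r) ∨ (root n r R i = r ∧ root n r R j = R) := by
  unfold IsFour at h'
  unfold root
  split_ifs <;> first | (exfalso; omega) | simp

theorem URelations.rel {u : ℕ → A} (hu : URelations n r R u) (hn : 2 ≤ n) (hr : r ≠ 0) (hR : R ≠ 0)
    {x y : FreeAlgebra K (Fin (n + 1))} (h : TLRel n (r ^ 2) (R ^ 2) x y) :
    FreeAlgebra.lift K (fun i : Fin (n + 1) => root n r R i • u i - 1) x =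
      FreeAlgebra.lift K (fun i : Fin (n + 1) => root n r R i • u i - 1) y := by
  have sq : ∀ i ≤ n, (root n r R i • u i) * (root n r R i • u i) =
      (root n r R i ^ 2 + 1) • (root n r R i • u i) := by
    intro i hi
    rw [smul_mul_smul_comm, hu.sq i hi, smul_smul, smul_smul]
    congr 1
    field_simp [root_ne_zero (n := n) hr hR i]
  have three : ∀ i ≤ n, ∀ j ≤ n, i + 1 = j ∨ j + 1 = i → ¬ IsFour n i j →
      polyV (root n r R i • u i - 1) (root n r R j • u j - 1) = 0 := by
    intro i hi j hj h1 h2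
    rw [polyV_eq_zero_iff _ _ _ (sq i hi), smul_mul_smul_comm, smul_mul_smul_comm,
      hu.three i hi j hj h1 h2, smul_smul]
    unfold IsFour at h2
    simp only [root]
    rw [if_neg (by tauto), if_neg (by tauto)]
    congr 1; ring
  have four : ∀ i ≤ n, ∀ j ≤ n, i + 1 = j ∨ j + 1 = i → IsFour n i j →
      polyZ (root n r R i • u i - 1) (root n r R j • u j - 1) = 0 := by
    intro i hi j hj h1 h2
    rw [polyZ_eq_zero_iff _ _ _ _ (sq i hi) (sq j hj), smul_mul_smul_comm, smul_mul_smul_comm,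
      smul_mul_smul_comm, hu.four i hi j hj h1 h2, smul_smul, smul_smul]
    congr 1
    have h3 := root_of_isFour (r := r) (R := R) hn h1 h2
    unfold kappa
    rcases h3 with ⟨h3, h4⟩ | ⟨h3, h4⟩ <;> rw [h3, h4] <;> field_simp <;> ring
  cases h with
  | quadratic_end i h =>
    rw [map_pow, map_add, map_smul, FreeAlgebra.lift_ι_apply, AlgHom.commutes]
    rw [quadratic_iff, sq i i.is_le, show root n r R i = R from if_pos h]
  | quadratic_mid i h =>
    rw [map_pow, map_add, map_smul, FreeAlgebra.lift_ι_apply, AlgHom.commutes]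
    rw [quadratic_iff, sq i i.is_le, show root n r R i = r from if_neg (by omega)]
  | comm i j h =>
    simp only [map_mul, FreeAlgebra.lift_ι_apply]
    have h1 : Commute (u i) (u j) := hu.comm i i.is_le j j.is_le h
    exact (((h1.smul_left _).smul_right _).sub_left (Commute.one_left _)).sub_right
      (Commute.one_right _)
  | braid_three i j h hi hj =>
    simp only [map_mul, FreeAlgebra.lift_ι_apply]
    rw [braid_three_iff, three i i.is_le j j.is_le (.inl h), three j j.is_le i i.is_le (.inr h)] <;>
      (unfold IsFour; omega)
  | braid_four i j h hij =>
    simp only [map_mul, FreeAlgebra.lift_ι_apply]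
    rw [braid_four_iff, four i i.is_le j j.is_le (.inl h), four j j.is_le i i.is_le (.inr h)] <;>
      (unfold IsFour; omega)
  | z_end i j h hij =>
    have := four i i.is_le j j.is_le (.inl h) (by unfold IsFour; omega)
    simpa only [polyZ, map_mul, map_add, map_one, map_zero, FreeAlgebra.lift_ι_apply] using this
  | v_mid i j h hi hj =>
    have := three i i.is_le j j.is_le (.inl h) (by unfold IsFour; omega)
    simpa only [polyV, map_mul, map_add, map_one, map_zero, FreeAlgebra.lift_ι_apply] using this

/-- The homomorphism from `TLC̃_n` given by elements satisfying the relations of the `U_i`. -/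
noncomputable def URelations.lift {u : ℕ → A} (hu : URelations n r R u) (hn : 2 ≤ n) (hr : r ≠ 0)
    (hR : R ≠ 0) : TL n (r ^ 2) (R ^ 2) →ₐ[K] A :=
  RingQuot.liftAlgHom K ⟨FreeAlgebra.lift K fun i : Fin (n + 1) => root n r R i • u i - 1,
    fun _ _ h => hu.rel hn hr hR h⟩

theorem U_eq (i : Fin (n + 1)) :
    U n r R i = (root n r R i)⁻¹ • (g n (r ^ 2) (R ^ 2) i + 1) := by
  unfold U root
  split_ifs <;> rfl

theorem URelations.lift_U {u : ℕ → A} (hu : URelations n r R u) (hn : 2 ≤ n) (hr : r ≠ 0)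
    (hR : R ≠ 0) (i : Fin (n + 1)) : hu.lift hn hr hR (U n r R i) = u i := by
  rw [U_eq, map_smul, map_add, map_one]
  have : hu.lift hn hr hR (g n (r ^ 2) (R ^ 2) i) = root n r R i • u i - 1 := by
    unfold URelations.lift g
    rw [RingQuot.liftAlgHom_mkAlgHom_apply, FreeAlgebra.lift_ι_apply]
  rw [this, sub_add_cancel, smul_smul, inv_mul_cancel₀ (root_ne_zero hr hR _), one_smul]

/-- The elements `U_i`, extended by zero. -/
noncomputable def extU (n : ℕ) (r R : K) (i : ℕ) : TL n (r ^ 2) (R ^ 2) :=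
  if i ≤ n then U n r R (node n i) else 0

theorem node_val {i : ℕ} (hi : i ≤ n) : (node n i).val = i := by
  simp [node, Nat.mod_eq_of_lt (Nat.lt_succ_of_le hi)]

theorem node_coe (i : Fin (n + 1)) : node n i = i := Fin.ext (node_val i.is_le)

/-- The elements `U_i` of `TLC̃_n` satisfy the relations. -/
theorem uRelations_extU (hn : 2 ≤ n) (hr : r ≠ 0) (hR : R ≠ 0) :
    URelations n r R (extU n r R) := by
  let X : Fin (n + 1) → TL n (r ^ 2) (R ^ 2) := fun i => g n (r ^ 2) (R ^ 2) i + 1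
  have hg : ∀ i, g n (r ^ 2) (R ^ 2) i = X i - 1 := fun i => (add_sub_cancel_right _ _).symm
  have rel : ∀ {x y : FreeAlgebra K (Fin (n + 1))}, TLRel n (r ^ 2) (R ^ 2) x y →
      RingQuot.mkAlgHom K (TLRel n (r ^ 2) (R ^ 2)) x = RingQuot.mkAlgHom K _ y :=
    fun h => RingQuot.mkAlgHom_rel K h
  have sq : ∀ i : Fin (n + 1), X i * X i = (root n r R i ^ 2 + 1) • X i := by
    intro i
    rw [← quadratic_iff, ← hg]
    by_cases h : i.val = 0 ∨ i.val = n
    · have := rel (.quadratic_end i h)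
      rw [map_pow, map_add, map_smul, AlgHom.commutes] at this
      rw [root, if_pos h]
      exact this
    · have := rel (.quadratic_mid i (by have := i.is_le; omega))
      rw [map_pow, map_add, map_smul, AlgHom.commutes] at this
      rw [root, if_neg h]
      exact this
  have three : ∀ i j : Fin (n + 1), i.val + 1 = j.val ∨ j.val + 1 = i.val → ¬ IsFour n i j →
      X i * X j * X i = (r ^ 2) • X i := by
    intro i j h1 h2
    have hi := i.is_le
    have hj := j.is_le
    unfold IsFour at h2
    have hs := sq i
    rw [show root n r R i = r from if_neg (by omega)] at hs
    rw [← polyV_eq_zero_iff _ _ _ hs, ← hg, ← hg]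
    rcases h1 with h1 | h1
    · have := rel (.v_mid i j h1 (by omega) (by omega))
      simp only [polyV, map_mul, map_add, map_one, map_zero] at this
      exact this
    -- Only `V(g_i, g_{i+1}) = 0` is imposed; the braid relation supplies the opposite order.
    · have h3 := rel (.v_mid j i h1 (by omega) (by omega))
      have h4 := rel (.braid_three j i h1 (by omega) (by omega))
      rw [map_mul, map_mul, map_mul, map_mul] at h4
      refine Eq.trans ((braid_three_iff _ _).1 h4).symm ?_
      simp only [polyV, map_mul, map_add, map_one, map_zero] at h3
      exact h3
  have four : ∀ i j : Fin (n + 1), i.val + 1 = j.val ∨ j.val + 1 = i.val → IsFour n i j →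
      X i * X j * X i * X j = (r ^ 2 + R ^ 2) • (X i * X j) := by
    intro i j h1 h2
    have hi := i.is_le
    have hj := j.is_le
    have h3 := root_of_isFour (r := r) (R := R) hn h1 h2
    have h4 : r ^ 2 + R ^ 2 = root n r R i ^ 2 + root n r R j ^ 2 := by
      rcases h3 with ⟨h3, h4⟩ | ⟨h3, h4⟩ <;> rw [h3, h4]; ring
    unfold IsFour at h2
    rw [h4, ← polyZ_eq_zero_iff _ _ _ _ (sq i) (sq j), ← hg, ← hg]
    rcases h1 with h1 | h1
    · have := rel (.z_end i j h1 (by omega))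
      simp only [polyZ, map_mul, map_add, map_one, map_zero] at this
      exact this
    · have h5 := rel (.z_end j i h1 (by omega))
      have h6 := rel (.braid_four j i h1 (by omega))
      simp only [map_mul] at h6
      refine Eq.trans ((braid_four_iff _ _).1 h6).symm ?_
      simp only [polyZ, map_mul, map_add, map_one, map_zero] at h5
      exact h5
  have hX : ∀ i (hi : i ≤ n), extU n r R i = (root n r R i)⁻¹ • X (node n i) := by
    intro i hi
    rw [extU, if_pos hi, U_eq, node_val hi]
  have hne := root_ne_zero (n := n) hr hR
  refine ⟨?_, ?_, ?_, ?_⟩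
  · intro i hi
    have := sq (node n i)
    rw [node_val hi] at this
    rw [hX i hi, smul_mul_smul_comm, this, smul_smul, smul_smul]
    congr 1
    field_simp [hne i]
  · intro i hi j hj hij
    rw [extU, extU, if_pos hi, if_pos hj]
    refine U_comm r R _ _ (coxeterMatrix_eq_two_iff.2 ?_)
    rwa [node_val hi, node_val hj]
  · intro i hi j hj h1 h2
    have := three (node n i) (node n j) (by rwa [node_val hi, node_val hj])
      (by rwa [node_val hi, node_val hj])
    rw [hX i hi, hX j hj, smul_mul_smul_comm, smul_mul_smul_comm, this, smul_smul]
    congr 1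
    unfold IsFour at h2
    rw [show root n r R i = r from if_neg (by omega), show root n r R j = r from if_neg (by omega)]
    field_simp
  · intro i hi j hj h1 h2
    have := four (node n i) (node n j) (by rwa [node_val hi, node_val hj])
      (by rwa [node_val hi, node_val hj])
    rw [hX i hi, hX j hj, smul_mul_smul_comm, smul_mul_smul_comm, smul_mul_smul_comm, this,
      smul_smul, smul_smul]
    congr 1
    have h3 := root_of_isFour (r := r) (R := R) hn h1 h2
    unfold kappa
    rcases h3 with ⟨h3, h4⟩ | ⟨h3, h4⟩ <;> rw [h3, h4] <;> field_simp

end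

end CTilde

namespace CTilde

/-! ### Irreducible traces -/

/-- The words to which a rule of `tlSystem` applies. -/
inductive Redex (n : ℕ) (ε : Prop) : List ℕ → Prop
  | sq (i : ℕ) : Redex n ε [i, i]
  | three (i j : ℕ) (h : i + 1 = j ∨ j + 1 = i) (h' : ¬ IsFour n i j ∨ (ε ∧ i = 1 ∧ j = 0)) :
      Redex n ε [i, j, i]
  | four (i j : ℕ) (h : i + 1 = j ∨ j + 1 = i) (h' : IsFour n i j)
      (h'' : ¬ (ε ∧ ((i = 0 ∧ j = 1) ∨ (i = 1 ∧ j = 0)))) : Redex n ε [i, j, i, j]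

/-- A trace to which no rule of `tlSystem` applies. -/
def IsIrred (n : ℕ) (ε : Prop) (t : Tr) : Prop :=
  ∀ a P b, Redex n ε P → t ≠ a * Tr.mk P * b

section

variable {K : Type*} [Field K] {n : ℕ} {r R : K} {ε : Prop}

theorem irred_tlSystem_iff {t : Tr} : (tlSystem n r R ε).Irred t ↔ IsIrred n ε t := by
  constructor
  · intro h a P b hP ht
    cases hP with
    | sq i => exact h _ _ ⟨a, b, _, _, .sq i, ht, rfl⟩
    | three i j h1 h2 => exact h _ _ ⟨a, b, _, _, .three i j ⟨h1, h2⟩, ht, rfl⟩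
    | four i j h1 h2 h3 => exact h _ _ ⟨a, b, _, _, .four i j ⟨h1, h2, h3⟩, ht, rfl⟩
  · rintro h c u ⟨a, b, P, Q, hP, ht, -⟩
    refine h a P b ?_ ht
    cases hP with
    | sq i => exact .sq i
    | three i j h => exact .three i j h.1 h.2
    | four i j h => exact .four i j h.1 h.2.1 h.2.2

theorem tlSystem_d (i : ℕ) :
    (tlSystem n r R ε).d i = (root n r R i ^ 2 + 1) / root n r R i := by
  unfold root
  simp only [tlSystem]
  split_ifs <;> rfl

theorem tlSystem_c_of_isFour {i j : ℕ} (h : IsFour n i j) :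
    (tlSystem n r R ε).c i j = kappa r R := by
  simp only [tlSystem]
  exact if_pos h

theorem tlSystem_c_of_not_isFour {i j : ℕ} (h : ¬ IsFour n i j) :
    (tlSystem n r R ε).c i j = 1 := by
  simp only [tlSystem]
  exact if_neg h

/-- In the quotient system `101 = κ 1`. -/
theorem leftOp_one_zero_one (h : ε) :
    (tlSystem n r R ε).leftOp 1 * (tlSystem n r R ε).leftOp 0 * (tlSystem n r R ε).leftOp 1 =
      kappa r R • (tlSystem n r R ε).leftOp 1 := by
  have hT : (tlSystem n r R ε).T 1 0 := ⟨by omega, .inr ⟨h, rfl, rfl⟩⟩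
  have := (RewritingSystem.Rule.three 1 0 hT).leftMul_eq
  simpa [Tr.mk_cons, ← mul_assoc, tlSystem_c_of_isFour (n := n) (i := 1) (j := 0)
    (.inr (.inl rfl))] using this

/-- The operators of left multiplication satisfy the relations of the `U_i`. -/
theorem uRelations_leftOp (n : ℕ) (r R : K) (ε : Prop) :
    URelations n r R (tlSystem n r R ε).leftOp := by
  refine ⟨fun i _ => ?_, fun i _ j _ h => RewritingSystem.leftOp_comm h, fun i _ j _ h h' => ?_,
    fun i _ j _ h h' => ?_⟩
  · have := (RewritingSystem.Rule.sq (S := tlSystem n r R ε) i).leftMul_eq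
    simpa [Tr.mk_cons, tlSystem_d] using this
  · have := (RewritingSystem.Rule.three (S := tlSystem n r R ε) i j ⟨h, .inl h'⟩).leftMul_eq
    simpa [Tr.mk_cons, ← mul_assoc, tlSystem_c_of_not_isFour h'] using this
  -- For the edge `{0, 1}` in the quotient system the four-letter relation is not a rule, but it
  -- follows from `101 = κ 1`.
  · by_cases h3 : ε ∧ ((i = 0 ∧ j = 1) ∨ (i = 1 ∧ j = 0))
    · obtain ⟨h3, ⟨rfl, rfl⟩ | ⟨rfl, rfl⟩⟩ := h3
      · rw [mul_assoc, mul_assoc, ← mul_assoc (RewritingSystem.leftOp _ 1),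
          leftOp_one_zero_one h3, mul_smul_comm]
      · rw [leftOp_one_zero_one h3, smul_mul_assoc]
    · have := (RewritingSystem.Rule.four (S := tlSystem n r R ε) i j ⟨h, h', h3⟩).leftMul_eq
      simpa [Tr.mk_cons, ← mul_assoc, tlSystem_c_of_isFour h'] using this

end

/-- The word over `ℕ` of a word in the nodes. -/
def vals {n : ℕ} (ω : List (Fin (n + 1))) : List ℕ := ω.map Fin.val

section Words

variable {n : ℕ}

@[simp] theorem vals_append (ω ω' : List (Fin (n + 1))) : vals (ω ++ ω') = vals ω ++ vals ω' := by
  simp [vals]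

@[simp] theorem length_vals (ω : List (Fin (n + 1))) : (vals ω).length = ω.length := by
  simp [vals]

theorem vals_map_node {ω : List ℕ} (h : ∀ x ∈ ω, x ≤ n) : vals (ω.map (node n)) = ω := by
  unfold vals
  rw [List.map_map]
  conv_rhs => rw [← List.map_id ω]
  exact List.map_congr_left fun x hx => node_val (h x hx)

theorem map_node_vals (ω : List (Fin (n + 1))) : (vals ω).map (node n) = ω := by
  unfold vals
  rw [List.map_map]
  conv_rhs => rw [← List.map_id ω]
  exact List.map_congr_left fun x _ => node_coe x

theorem le_of_mem_vals {ω : List (Fin (n + 1))} {x : ℕ} (h : x ∈ vals ω) : x ≤ n := by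
  obtain ⟨y, -, rfl⟩ := List.mem_map.1 h
  exact y.is_le

/-- The trace of a word in the nodes. -/
def trace (ω : List (Fin (n + 1))) : Tr := Tr.mk (vals ω)

theorem trace_append (ω ω' : List (Fin (n + 1))) : trace (ω ++ ω') = trace ω * trace ω' := by
  simp [trace, Tr.mk_append]

theorem trace_cons (i : Fin (n + 1)) (ω : List (Fin (n + 1))) :
    trace (i :: ω) = Tr.of i * trace ω := by
  simp [trace, vals, Tr.mk_cons]

theorem length_trace (ω : List (Fin (n + 1))) : (trace ω).length = ω.length := by simp [trace]

theorem CommMove.trace_eq {ω ω' : List (Fin (n + 1))} (h : CommMove ω ω') :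
    trace ω = trace ω' := by
  obtain ⟨α, β, i, j, h⟩ := h
  simp only [trace_append, trace_cons]
  rw [← mul_assoc (Tr.of _), Tr.of_comm (coxeterMatrix_eq_two_iff.1 h), mul_assoc]

theorem trace_eq_of_reflTransGen {ω ω' : List (Fin (n + 1))}
    (h : Relation.ReflTransGen CommMove ω ω') : trace ω = trace ω' := by
  induction h with
  | refl => rfl
  | tail _ h ih => rw [ih, h.trace_eq]

theorem CommMove.wordProd_eq {ω ω' : List (Fin (n + 1))} (h : CommMove ω ω') :
    (cs n).wordProd ω = (cs n).wordProd ω' := by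
  obtain ⟨α, β, i, j, h⟩ := h
  have hij : (cs n).simple i * (cs n).simple j = (cs n).simple j * (cs n).simple i := by
    have := (cs n).wordProd_braidWord_eq i j
    rw [CoxeterSystem.braidWord, CoxeterSystem.braidWord, (coxeterMatrix n).symmetric j i, h] at this
    simpa [CoxeterSystem.alternatingWord, CoxeterSystem.wordProd_cons] using this
  simp only [CoxeterSystem.wordProd_append, CoxeterSystem.wordProd_cons]
  rw [← mul_assoc ((cs n).simple i), hij, mul_assoc]

theorem wordProd_eq_of_reflTransGen {ω ω' : List (Fin (n + 1))}
    (h : Relation.ReflTransGen CommMove ω ω') : (cs n).wordProd ω = (cs n).wordProd ω' := by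
  induction h with
  | refl => rfl
  | tail _ h ih => rw [ih, h.wordProd_eq]

/-- Traces use all natural numbers as letters, but swaps create no new letters, so a chain of swaps
between words in `0, …, n` lifts to moves of nodes. -/
theorem reflTransGen_of_trace_eq {ω ω' : List (Fin (n + 1))} (h : trace ω = trace ω') :
    Relation.ReflTransGen CommMove ω ω' := by
  have key : ∀ υ υ' : List ℕ, Relation.ReflTransGen Tr.Swap υ υ' → (∀ x ∈ υ, x ≤ n) →
      (∀ x ∈ υ', x ≤ n) ∧ Relation.ReflTransGen CommMove (υ.map (node n)) (υ'.map (node n)) := by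
    intro υ υ' h hυ
    induction h with
    | refl => exact ⟨hυ, .refl⟩
    | tail _ h ih =>
      obtain ⟨α, β, i, j, h⟩ := h
      obtain ⟨h1, h2⟩ := ih
      have hi : i ≤ n := h1 i (by simp)
      have hj : j ≤ n := h1 j (by simp)
      refine ⟨fun x hx => h1 x ?_, h2.tail ?_⟩
      · simp only [List.mem_append, List.mem_cons] at hx ⊢; tauto
      · simp only [List.map_append, List.map_cons]
        refine .swap _ _ _ _ (coxeterMatrix_eq_two_iff.2 ?_)
        rwa [node_val hi, node_val hj]
  have := (key _ _ (Tr.reflTransGen_swap_of_mk_eq h) fun x => le_of_mem_vals).2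
  rwa [map_node_vals, map_node_vals] at this

end Words

end CTilde

namespace CTilde

/-! ### Irreducible traces and fully commutative elements -/

section

variable {n : ℕ}

/-- The action of the Coxeter group at `q = Q = 1`. -/
theorem isLiftable_leftOp (n : ℕ) : (coxeterMatrix n).IsLiftable
    fun i => (tlSystem n (1 : ℚ) 1 False).leftOp i - 1 := by
  have hu := uRelations_leftOp n (1 : ℚ) 1 False
  set L := (tlSystem n (1 : ℚ) 1 False).leftOp
  have hroot : ∀ i, root n (1 : ℚ) 1 i = 1 := fun i => by unfold root; split_ifs <;> rfl
  have hX : ∀ i ≤ n, L i * L i = ((1 : ℚ) + 1) • L i := by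
    intro i hi
    have := hu.sq i hi
    rw [hroot] at this
    rw [this]; norm_num
  have hsq : ∀ i ≤ n, (L i - 1) * (L i - 1) = 1 := by
    intro i hi
    have := (quadratic_iff (L i) (1 : ℚ)).2 (hX i hi)
    rwa [sub_self, zero_smul, zero_add, map_one, pow_two] at this
  intro i j
  have hi := i.is_le
  have hj := j.is_le
  rw [coxeterMatrix_apply]
  set a := L i - 1 with ha
  set b := L j - 1 with hb
  have haa : a * a = 1 := hsq i hi
  have hbb : b * b = 1 := hsq j hj
  split_ifs with h1 h2 h3
  · subst h1
    rw [pow_one]; exact haa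
  · have hab : a * b = b * a := by
      have h1 : Commute (L i) (L j) := hu.comm i hi j hj h2
      exact ((h1.sub_left (Commute.one_left _)).sub_right (Commute.one_right _)).eq
    calc (a * b) ^ 2 = a * (b * a) * b := by noncomm_ring
      _ = 1 := by rw [← hab, ← mul_assoc, haa, one_mul, hbb]
  · have hadj : i.val + 1 = j.val ∨ j.val + 1 = i.val := by
      have := fun h => h1 (Fin.ext h); omega
    have h4 := hu.four i hi j hj hadj h3
    have h5 := hu.four j hj i hi hadj.symm (by unfold IsFour; omega)
    -- The form `1 + 1` matches the coefficient `a + a'` in `polyZ_eq_zero_iff` at `q = Q = 1`.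
    have hk : kappa (1 : ℚ) 1 = 1 + 1 := by norm_num [kappa]
    rw [hk] at h4 h5
    rw [← polyZ_eq_zero_iff _ _ _ _ (hX i hi) (hX j hj)] at h4
    rw [← polyZ_eq_zero_iff _ _ _ _ (hX j hj) (hX i hi)] at h5
    have h6 := (braid_four_iff a b).2 (h4.trans h5.symm)
    calc (a * b) ^ 4 = (a * b * a * b) * (a * b * a * b) := by noncomm_ring
      _ = a * b * a * (b * b) * a * b * a := by nth_rw 2 [h6]; noncomm_ring
      _ = a * b * (a * a) * b * a := by rw [hbb]; noncomm_ring
      _ = a * (b * b) * a := by rw [haa]; noncomm_ring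
      _ = 1 := by rw [hbb, mul_one, haa]
  · have hadj : i.val + 1 = j.val ∨ j.val + 1 = i.val := by
      have := fun h => h1 (Fin.ext h); omega
    have h4 := hu.three i hi j hj hadj h3
    have h5 := hu.three j hj i hi hadj.symm (by unfold IsFour; omega)
    rw [← one_smul ℚ (L i.val)] at h4
    nth_rw 1 3 [one_smul] at h4
    rw [← one_smul ℚ (L j.val)] at h5
    nth_rw 1 3 [one_smul] at h5
    rw [one_smul] at h4 h5
    have h4' := (polyV_eq_zero_iff _ (L j) (1 : ℚ) (hX i hi)).2 (by rw [one_smul]; exact h4)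
    have h5' := (polyV_eq_zero_iff _ (L i) (1 : ℚ) (hX j hj)).2 (by rw [one_smul]; exact h5)
    have h6 := (braid_three_iff a b).2 (h4'.trans h5'.symm)
    calc (a * b) ^ 3 = (a * b * a) * (b * a * b) := by noncomm_ring
      _ = a * b * (a * a) * b * a := by rw [← h6]; noncomm_ring
      _ = a * (b * b) * a := by rw [haa]; noncomm_ring
      _ = 1 := by rw [hbb, mul_one, haa]

/-- The representation of the Coxeter group at `q = Q = 1`. -/
noncomputable def coxeterRep (n : ℕ) : W n →* Module.End ℚ (Tr →₀ ℚ) :=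
  (cs n).lift ⟨_, isLiftable_leftOp n⟩

theorem coxeterRep_simple (i : Fin (n + 1)) :
    coxeterRep n ((cs n).simple i) = (tlSystem n (1 : ℚ) 1 False).leftOp i - 1 :=
  (cs n).lift_apply_simple (isLiftable_leftOp n) i

/-- The functions supported on traces of length less than `k`. -/
abbrev shortTraces (k : ℕ) : Submodule ℚ (Tr →₀ ℚ) :=
  Finsupp.supported ℚ ℚ {t : Tr | t.length < k}

theorem nf_mem_shortTraces {S : RewritingSystem ℚ} {t : Tr} {k : ℕ} (h : t.length < k) :
    S.nf t ∈ shortTraces k := by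
  obtain ⟨c, u, h1, -, h3, -⟩ := RewritingSystem.exists_nf_eq_smul (S := S) t
  rw [h1]
  exact Submodule.smul_mem _ _ (Finsupp.single_mem_supported _ _ (lt_of_le_of_lt h3 h))

theorem leftOp_mem_shortTraces {S : RewritingSystem ℚ} {v : Tr →₀ ℚ} {k : ℕ}
    (h : v ∈ shortTraces k) (i : ℕ) : S.leftOp i v ∈ shortTraces (k + 1) := by
  have : shortTraces k ≤ (shortTraces (k + 1)).comap (S.leftOp i) := by
    rw [shortTraces, Finsupp.supported_eq_span_single, Submodule.span_le]
    rintro _ ⟨t, ht, rfl⟩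
    rw [SetLike.mem_coe, Submodule.mem_comap, RewritingSystem.leftOp_single]
    refine nf_mem_shortTraces ?_
    have : t.length < k := ht
    simp
    omega
  exact this h

theorem shortTraces_mono {k l : ℕ} (h : k ≤ l) : shortTraces k ≤ shortTraces l :=
  Finsupp.supported_mono fun _ ht => lt_of_lt_of_le ht h

theorem single_notMem_shortTraces {t : Tr} : Finsupp.single t (1 : ℚ) ∉ shortTraces t.length := by
  intro h
  have := (Finsupp.mem_supported _ _).1 h (Finsupp.mem_support_iff.2 (by simp) : t ∈ _)
  simp at this

/-- The action of a word on the vacuum is, up to shorter terms, its normal form. -/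
theorem coxeterRep_wordProd_sub_mem (ω : List (Fin (n + 1))) :
    coxeterRep n ((cs n).wordProd ω) (Finsupp.single 1 1) -
      (tlSystem n (1 : ℚ) 1 False).nf (trace ω) ∈ shortTraces ω.length := by
  induction ω with
  | nil =>
    rw [CoxeterSystem.wordProd_nil, map_one, trace, vals, List.map_nil, Tr.mk_nil,
      RewritingSystem.nf_of_irred RewritingSystem.irred_one]
    simp
  | cons i ω ih =>
    rw [CoxeterSystem.wordProd_cons, map_mul, coxeterRep_simple, trace_cons,
      ← RewritingSystem.leftOp_nf, Module.End.mul_apply]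
    generalize coxeterRep n ((cs n).wordProd ω) (Finsupp.single 1 1) = x at ih
    have hshort : (tlSystem n (1 : ℚ) 1 False).nf (trace ω) ∈ shortTraces (ω.length + 1) :=
      nf_mem_shortTraces (by rw [length_trace]; omega)
    generalize (tlSystem n (1 : ℚ) 1 False).nf (trace ω) = y at ih hshort
    generalize tlSystem n (1 : ℚ) 1 False = S
    -- A generator acts as `leftOp i - 1`. The new error consists of the image of the old error, the
    -- old error itself, and the previous normal form; all are supported on traces of length at most
    -- that of the tail.
    rw [LinearMap.sub_apply, Module.End.one_apply,
      show S.leftOp i x - x - S.leftOp i y = S.leftOp i (x - y) - (x - y) - y by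
        rw [map_sub]; abel, List.length_cons]
    exact Submodule.sub_mem _ (Submodule.sub_mem _ (leftOp_mem_shortTraces ih _)
      (shortTraces_mono (Nat.le_succ _) ih)) hshort

/-- An irreducible word has no shorter expression, and the expressions of the same length are
linked to it by commutations. -/
theorem trace_eq_of_wordProd_eq {ω ω' : List (Fin (n + 1))}
    (hω : IsIrred n False (trace ω)) (h : (cs n).wordProd ω' = (cs n).wordProd ω)
    (hl : ω'.length ≤ ω.length) : trace ω' = trace ω := by
  have h1 := coxeterRep_wordProd_sub_mem ω
  have h2 := coxeterRep_wordProd_sub_mem ω'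
  rw [h] at h2
  -- Both words act equally on the vacuum, so their normal forms agree up to traces shorter than
  -- `ω`. That of `ω` is the trace itself, of full length, so the normal form of `ω'` cannot be a
  -- different trace or a shorter one.
  have h3 := Submodule.sub_mem _ (shortTraces_mono hl h2) h1
  rw [sub_sub_sub_cancel_left,
    RewritingSystem.nf_of_irred (irred_tlSystem_iff.2 hω)] at h3
  by_contra hne
  refine single_notMem_shortTraces (t := trace ω) ?_
  rw [length_trace]
  obtain ⟨c, u, h4, h5, h6, -, h7⟩ :=
    RewritingSystem.exists_nf_eq_smul (S := tlSystem n (1 : ℚ) 1 False) (trace ω')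
  by_cases hir : (tlSystem n (1 : ℚ) 1 False).Irred (trace ω')
  · rw [RewritingSystem.nf_of_irred hir] at h3
    by_contra h8
    have h9 := (Finsupp.mem_supported _ _).1 h3
      (Finsupp.mem_support_iff.2 (by simp [hne]) : trace ω ∈ _)
    simp [length_trace] at h9
  · have h8 := h7 hir
    rw [length_trace] at h8
    have h9 : (tlSystem n (1 : ℚ) 1 False).nf (trace ω') ∈ shortTraces ω.length := by
      rw [h4]
      exact Submodule.smul_mem _ _ (Finsupp.single_mem_supported _ _ (lt_of_lt_of_le h8 hl))
    simpa using Submodule.add_mem _ h3 h9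

theorem isReduced_of_isIrred {ω : List (Fin (n + 1))}
    (hω : IsIrred n False (trace ω)) : (cs n).IsReduced ω := by
  obtain ⟨ω', h1, h2⟩ := (cs n).exists_isReduced ((cs n).wordProd ω)
  have hl : ω'.length ≤ ω.length := by
    rw [← h1.eq, ← h2]; exact (cs n).length_wordProd_le ω
  have h3 := congrArg Tr.length (trace_eq_of_wordProd_eq hω h2.symm hl)
  rw [length_trace, length_trace] at h3
  rw [CoxeterSystem.IsReduced, h2, h1.eq, h3]

theorem isFullyCommutative_of_isIrred {ω : List (Fin (n + 1))}
    (hω : IsIrred n False (trace ω)) : IsFullyCommutative ((cs n).wordProd ω) := by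
  have key : ∀ υ, IsReducedExpr υ ((cs n).wordProd ω) → trace υ = trace ω := fun υ hυ =>
    trace_eq_of_wordProd_eq hω hυ.2 (by
      rw [← hυ.1.eq, hυ.2, (isReduced_of_isIrred hω).eq])
  intro υ υ' h h'
  exact reflTransGen_of_trace_eq ((key υ h).trans (key υ' h').symm)

theorem IsReducedExpr.congr {ω ω' : List (Fin (n + 1))} {w : W n} (h : IsReducedExpr ω w)
    (ht : trace ω = trace ω') : IsReducedExpr ω' w := by
  have h1 := wordProd_eq_of_reflTransGen (reflTransGen_of_trace_eq ht)
  have h2 := congrArg Tr.length ht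
  rw [length_trace, length_trace] at h2
  refine ⟨?_, h1.symm.trans h.2⟩
  rw [CoxeterSystem.IsReduced, ← h1, ← h2]
  exact h.1

theorem IsFullyCommutative.trace_eq {w : W n} (hw : IsFullyCommutative w)
    {ω ω' : List (Fin (n + 1))} (h₁ : IsReducedExpr ω w) (h₂ : IsReducedExpr ω' w) :
    trace ω = trace ω' :=
  trace_eq_of_reflTransGen (hw _ _ h₁ h₂)

/-- Words with the same trace as a word in the nodes. -/
theorem exists_trace_eq {ω : List (Fin (n + 1))} {υ : List ℕ} (h : trace ω = Tr.mk υ) :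
    (∀ x ∈ υ, x ≤ n) ∧ trace ω = trace (υ.map (node n)) := by
  have h1 : ∀ x ∈ υ, x ≤ n := fun x hx => le_of_mem_vals (ω := ω) (by
    rw [← Tr.mem_letters_mk, show Tr.mk (vals ω) = Tr.mk υ from h, Tr.mem_letters_mk]; exact hx)
  exact ⟨h1, by rw [trace, trace, vals_map_node h1]; exact h⟩

/-- The trace of a fully commutative element is irreducible. -/
theorem IsFullyCommutative.isIrred {w : W n} (hw : IsFullyCommutative w)
    {ω : List (Fin (n + 1))} (h : IsReducedExpr ω w) : IsIrred n False (trace ω) := by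
  intro a P b hP ht
  obtain ⟨α, rfl⟩ := Tr.mk_surjective a
  obtain ⟨β, rfl⟩ := Tr.mk_surjective b
  rw [← Tr.mk_append, ← Tr.mk_append] at ht
  obtain ⟨hle, ht'⟩ := exists_trace_eq ht
  have h1 := h.congr ht'
  -- Exchanging a braid factor gives another reduced expression, hence the same trace by full
  -- commutativity. But the projection to the letters `k`, `k + 1` keeps `P` and `P'` whole and
  -- tells them apart.
  have braid : ∀ (P' : List ℕ) (k : ℕ), P'.length = P.length → (∀ x ∈ P', x ∈ P) → P ≠ P' →
      (∀ x ∈ P, x = k ∨ x = k + 1) → (cs n).wordProd (P.map (node n)) =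
      (cs n).wordProd (P'.map (node n)) → False := by
    intro P' k hlen hsub hne hk hprod
    have hred : IsReducedExpr ((α ++ P' ++ β).map (node n)) w := by
      have hprod' : (cs n).wordProd ((α ++ P' ++ β).map (node n)) =
          (cs n).wordProd ((α ++ P ++ β).map (node n)) := by
        simp only [List.map_append, CoxeterSystem.wordProd_append, hprod]
      refine ⟨?_, hprod'.trans h1.2⟩
      have := h1.1.eq
      rw [CoxeterSystem.IsReduced, hprod', this]
      simp [hlen]
    have h2 := hw.trace_eq h1 hred
    rw [trace, trace, vals_map_node hle, vals_map_node] at h2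
    · have h3 := congrArg (Tr.proj k) h2
      rw [Tr.proj_mk, Tr.proj_mk] at h3
      have h4 := FreeMonoid.ofList.injective h3
      simp only [List.filter_append, List.append_cancel_right_eq, List.append_cancel_left_eq] at h4
      rw [List.filter_eq_self.2 (by simpa using hk),
        List.filter_eq_self.2 (by simpa using fun x hx => hk x (hsub x hx))] at h4
      exact hne h4
    · intro x hx
      refine hle x ?_
      simp only [List.mem_append] at hx ⊢
      rcases hx with (hx | hx) | hx
      · simp [hx]
      · simp [hsub x hx]
      · simp [hx]
  cases hP with
  | sq i =>
    have h2 : (cs n).wordProd ((α ++ [i, i] ++ β).map (node n)) =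
        (cs n).wordProd ((α ++ β).map (node n)) := by
      simp only [List.map_append, List.map_cons, List.map_nil, CoxeterSystem.wordProd_append,
        CoxeterSystem.wordProd_cons, CoxeterSystem.wordProd_nil, mul_one,
        CoxeterSystem.simple_mul_simple_self]
    have h3 := h1.1.eq
    have h4 := (cs n).length_wordProd_le ((α ++ β).map (node n))
    rw [← h2, h3] at h4
    simp at h4
  | three i j hij h' =>
    have hi : i ≤ n := hle i (by simp)
    have hj : j ≤ n := hle j (by simp)
    have h' : ¬ IsFour n i j := by tauto
    have hm : coxeterMatrix n (node n i) (node n j) = 3 := by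
      unfold IsFour at h'
      rw [coxeterMatrix_apply, node_val hi, node_val hj, if_neg, if_neg, if_neg h']
      · omega
      · intro h; have := congrArg Fin.val h; rw [node_val hi, node_val hj] at this; omega
    refine braid [j, i, j] (min i j) rfl (by simp) ?_ ?_ ?_
    · simp; omega
    · simp; omega
    · have := (cs n).wordProd_braidWord_eq (node n i) (node n j)
      rw [CoxeterSystem.braidWord, CoxeterSystem.braidWord,
        (coxeterMatrix n).symmetric (node n j) (node n i), hm] at this
      simpa [CoxeterSystem.alternatingWord, CoxeterSystem.wordProd_cons] using this.symm
  | four i j hij h' _ =>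
    have hi : i ≤ n := hle i (by simp)
    have hj : j ≤ n := hle j (by simp)
    have hm : coxeterMatrix n (node n i) (node n j) = 4 := by
      unfold IsFour at h'
      rw [coxeterMatrix_apply, node_val hi, node_val hj, if_neg, if_neg, if_pos h']
      · omega
      · intro h; have := congrArg Fin.val h; rw [node_val hi, node_val hj] at this; omega
    refine braid [j, i, j, i] (min i j) rfl (by simp) ?_ ?_ ?_
    · simp; omega
    · simp; omega
    · have := (cs n).wordProd_braidWord_eq (node n i) (node n j)
      rw [CoxeterSystem.braidWord, CoxeterSystem.braidWord,
        (coxeterMatrix n).symmetric (node n j) (node n i), hm] at this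
      simpa [CoxeterSystem.alternatingWord, CoxeterSystem.wordProd_cons] using this

/-- The elements that are not left-positive are those whose trace has the factor `101`. -/
theorem isLeftPositive_iff (hn : 2 ≤ n) {w : W n} (hw : IsFullyCommutative w)
    {ω : List (Fin (n + 1))} (h : IsReducedExpr ω w) :
    IsLeftPositive w ↔ ∀ a b, trace ω ≠ a * Tr.mk [1, 0, 1] * b := by
  have hv : vals [node n 1, node n 0, node n 1] = [1, 0, 1] := by
    simp [vals, node_val (show 1 ≤ n by omega), node_val (Nat.zero_le n)]
  constructor
  · intro hp a b ht
    obtain ⟨α, rfl⟩ := Tr.mk_surjective a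
    obtain ⟨β, rfl⟩ := Tr.mk_surjective b
    rw [← Tr.mk_append, ← Tr.mk_append] at ht
    obtain ⟨-, ht'⟩ := exists_trace_eq ht
    have h1 := h.congr ht'
    refine hp ⟨_, [node n 1, node n 0, node n 1], h1, ⟨?_, rfl⟩, α.map (node n), β.map (node n), by
      simp⟩
    have h2 := (h1.1.drop α.length).take 3
    simpa [List.map_drop, List.map_take] using h2
  · rintro hp ⟨ω', υ, h1, h2, γ, δ, rfl⟩
    -- The word `101` is irreducible for `ε = False`, because the edge `{0, 1}` is labelled `4`. So
    -- every reduced expression of `σ_1 σ_0 σ_1` has this trace.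
    have h3 : trace υ = Tr.mk [1, 0, 1] := by
      rw [← hv]
      refine trace_eq_of_wordProd_eq ?_ h2.2 ?_
      · intro a P b hP ht
        rw [trace, hv] at ht
        have hrig : List.IsChain (fun i j => ¬ Ind i j) [1, 0, 1] := by simp [Ind]
        obtain ⟨_, γ', h4, h5, rfl⟩ := Tr.exists_append_of_mk_eq_mul hrig ht
        rw [h4, List.isChain_append] at hrig
        obtain ⟨α', β', rfl, rfl, h6⟩ := Tr.exists_append_of_mk_eq_mul hrig.1 h5.symm
        obtain rfl := Tr.mk_injOn_rigid (List.isChain_append.1 hrig.1).2.1 h6.symm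
        have hl := congrArg List.length h4
        cases hP with
        | sq i => rcases α' with _ | ⟨a, _ | ⟨b, α'⟩⟩ <;> simp at h4 hl <;> omega
        | three i j h7 h8 =>
          rcases α' with _ | ⟨a, α'⟩ <;> simp at h4 hl
          · obtain ⟨rfl, rfl, -⟩ := h4
            simp [IsFour] at h8
          · omega
        | four i j h7 h8 h9 => simp at hl; omega
      · rw [← h2.1.eq, h2.2]
        exact (cs n).length_wordProd_le _
    refine hp (trace γ) (trace δ) ?_
    rw [hw.trace_eq h h1, trace_append, trace_append, h3]

end

end CTilde

namespace CTilde

/-! ### The monomial bases of `TLC̃_n` and of its quotient -/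

section

variable {K : Type*} [Field K] {n : ℕ} {r R : K}

/-- The coordinates of an element of `TLC̃_n` in the irreducible traces. -/
noncomputable def coord (hn : 2 ≤ n) (hr : r ≠ 0) (hR : R ≠ 0) (ε : Prop) :
    TL n (r ^ 2) (R ^ 2) →ₗ[K] (Tr →₀ K) :=
  (LinearMap.applyₗ (Finsupp.single 1 1)).comp
    ((uRelations_leftOp n r R ε).lift hn hr hR).toLinearMap

theorem lift_wordU (hn : 2 ≤ n) (hr : r ≠ 0) (hR : R ≠ 0) (ε : Prop) (ω : List (Fin (n + 1))) :
    (uRelations_leftOp n r R ε).lift hn hr hR (wordU r R ω) =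
      (tlSystem n r R ε).leftMul (trace ω) := by
  induction ω with
  | nil => simp [wordU, trace, vals]
  | cons i ω ih =>
    have : wordU r R (i :: ω) = U n r R i * wordU r R ω := by simp [wordU]
    rw [this, map_mul, ih, URelations.lift_U, trace_cons, map_mul, RewritingSystem.leftMul_of]

theorem coord_wordU (hn : 2 ≤ n) (hr : r ≠ 0) (hR : R ≠ 0) (ε : Prop) (ω : List (Fin (n + 1))) :
    coord hn hr hR ε (wordU r R ω) = (tlSystem n r R ε).nf (trace ω) := by
  change (uRelations_leftOp n r R ε).lift hn hr hR (wordU r R ω) (Finsupp.single 1 1) = _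
  rw [lift_wordU, RewritingSystem.leftMul_single_one]

/-- The representation with `ε = True` satisfies the relation that generates `Lp`, so it factors
through the quotient. -/
theorem coord_eq_zero_of_mem_Lp (hn : 2 ≤ n) (hr : r ≠ 0) (hR : R ≠ 0)
    {a : TL n (r ^ 2) (R ^ 2)} (ha : a ∈ Lp n r R) : coord hn hr hR True a = 0 := by
  have h1 : Lp n r R ≤
      TwoSidedIdeal.ker ((uRelations_leftOp n r R True).lift hn hr hR) := by
    rw [Lp, TwoSidedIdeal.span_le]
    rintro _ rfl
    rw [SetLike.mem_coe, TwoSidedIdeal.mem_ker]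
    change (uRelations_leftOp n r R True).lift hn hr hR _ = 0
    rw [map_sub, map_smul, map_mul, map_mul, URelations.lift_U, URelations.lift_U,
      node_val (by omega), node_val (by omega), leftOp_one_zero_one trivial, sub_self]
  have h2 := (TwoSidedIdeal.mem_ker _).1 (h1 ha)
  change (uRelations_leftOp n r R True).lift hn hr hR a (Finsupp.single 1 1) = 0
  change (uRelations_leftOp n r R True).lift hn hr hR a = 0 at h2
  rw [h2]; rfl

/-- The homomorphism from the traces to `TLC̃_n`. -/
noncomputable def ofTrace (hn : 2 ≤ n) (hr : r ≠ 0) (hR : R ≠ 0) : Tr →* TL n (r ^ 2) (R ^ 2) :=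
  Tr.lift (extU n r R) (by
    intro i j h
    by_cases hi : i ≤ n
    · by_cases hj : j ≤ n
      · exact (uRelations_extU hn hr hR).comm i hi j hj h
      · simp [extU, hj]
    · simp [extU, hi])

theorem ofTrace_trace (hn : 2 ≤ n) (hr : r ≠ 0) (hR : R ≠ 0) (ω : List (Fin (n + 1))) :
    ofTrace hn hr hR (trace ω) = wordU r R ω := by
  induction ω with
  | nil => simp [wordU, trace, vals]
  | cons i ω ih =>
    rw [trace_cons, map_mul, ih, ofTrace, Tr.lift_of, extU, if_pos i.is_le, node_coe]
    simp [wordU]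

theorem ofTrace_eq_zero (hn : 2 ≤ n) (hr : r ≠ 0) (hR : R ≠ 0) {t : Tr}
    (h : ∃ i ∈ t.letters, n < i) : ofTrace hn hr hR t = 0 := by
  obtain ⟨i, hi, hin⟩ := h
  obtain ⟨ω, rfl⟩ := Tr.mk_surjective t
  rw [Tr.map_mk]
  refine List.prod_eq_zero (List.mem_map.2 ⟨i, Tr.mem_letters_mk.1 hi, ?_⟩)
  rw [ofTrace, Tr.lift_of, extU, if_neg (by omega)]

theorem ofTrace_rule (hn : 2 ≤ n) (hr : r ≠ 0) (hR : R ≠ 0) {P Q : List ℕ} {c : K}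
    (h : (tlSystem n r R False).Rule P c Q) :
    ofTrace hn hr hR (Tr.mk P) = c • ofTrace hn hr hR (Tr.mk Q) := by
  -- The rules also act on letters beyond `n`, where `extU` vanishes. A rule whose left side
  -- involves such a letter keeps one on its right side, so both sides are zero.
  by_cases hle : ∃ i ∈ P, n < i
  · have hQ : ∃ i ∈ Q, n < i := by
      obtain ⟨x, hx, hxn⟩ := hle
      cases h with
      | sq i => exact ⟨x, by simpa using hx, hxn⟩
      | three i j h =>
        have h1 := h.1
        have h2 : ¬ IsFour n i j := by have := h.2; tauto
        unfold IsFour at h2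
        refine ⟨i, by simp, ?_⟩
        simp only [List.mem_cons, List.not_mem_nil, or_false] at hx
        omega
      | four i j h =>
        refine ⟨x, ?_, hxn⟩
        simp only [List.mem_cons, List.not_mem_nil, or_false] at hx ⊢
        omega
    have h0 : ∀ L : List ℕ, (∃ i ∈ L, n < i) → ofTrace hn hr hR (Tr.mk L) = 0 := fun L ⟨i, hi, h⟩ =>
      ofTrace_eq_zero hn hr hR ⟨i, Tr.mem_letters_mk.2 hi, h⟩
    rw [h0 P hle, h0 Q hQ, smul_zero]
  · push Not at hle
    have hu := uRelations_extU hn hr hR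
    cases h with
    | sq i =>
      have := hu.sq i (hle i (by simp))
      simpa [Tr.mk_cons, ofTrace, tlSystem_d] using this
    | three i j h =>
      have h4 : ¬ IsFour n i j := by have := h.2; tauto
      have := hu.three i (hle i (by simp)) j (hle j (by simp)) h.1 h4
      simpa [Tr.mk_cons, ofTrace, ← mul_assoc, tlSystem_c_of_not_isFour h4] using this
    | four i j h =>
      have := hu.four i (hle i (by simp)) j (hle j (by simp)) h.1 h.2.1
      simpa [Tr.mk_cons, ofTrace, ← mul_assoc, tlSystem_c_of_isFour h.2.1] using this

/-- Every monomial is a multiple of an irreducible one. -/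
theorem exists_ofTrace_eq_smul (hn : 2 ≤ n) (hr : r ≠ 0) (hR : R ≠ 0) (t : Tr) :
    ∃ (c : K) (u : Tr), IsIrred n False u ∧ ofTrace hn hr hR t = c • ofTrace hn hr hR u := by
  induction hl : t.length using Nat.strong_induction_on generalizing t with
  | _ l ih =>
    by_cases h : (tlSystem n r R False).Irred t
    · exact ⟨1, t, irred_tlSystem_iff.1 h, (one_smul _ _).symm⟩
    · unfold RewritingSystem.Irred at h
      push Not at h
      obtain ⟨c, u, hu⟩ := h
      obtain ⟨e, v, h1, h2⟩ := ih _ (hl ▸ hu.length_lt) u rfl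
      refine ⟨c * e, v, h1, ?_⟩
      obtain ⟨a, b, P, Q, hP, rfl, rfl⟩ := hu
      rw [mul_smul, ← h2]
      simp only [map_mul, ofTrace_rule hn hr hR hP, mul_smul_comm, smul_mul_assoc]

/-- The trace of the chosen reduced expression of an element. -/
noncomputable def redTrace (w : W n) : Tr := trace ((cs n).exists_isReduced w).choose

theorem isReducedExpr_choose (w : W n) :
    IsReducedExpr ((cs n).exists_isReduced w).choose w :=
  have h := ((cs n).exists_isReduced w).choose_spec
  ⟨h.1, h.2.symm⟩

theorem redTrace_injective : Function.Injective (redTrace (n := n)) := by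
  intro w w' h
  rw [← (isReducedExpr_choose w).2, ← (isReducedExpr_choose w').2]
  exact wordProd_eq_of_reflTransGen (reflTransGen_of_trace_eq h)

theorem coord_b (hn : 2 ≤ n) (hr : r ≠ 0) (hR : R ≠ 0) {w : W n} (hw : IsFullyCommutative w) :
    coord hn hr hR False (b r R w) = Finsupp.single (redTrace w) 1 := by
  rw [b, coord_wordU, RewritingSystem.nf_of_irred]
  · rfl
  · exact irred_tlSystem_iff.2 (hw.isIrred (isReducedExpr_choose w))

/-- The only redex gained on passing from `ε = False` to `ε = True` is `101`, which a left-positive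
element avoids. -/
theorem coord_b_of_isLeftPositive (hn : 2 ≤ n) (hr : r ≠ 0) (hR : R ≠ 0) {w : W n}
    (hw : IsFullyCommutative w) (hp : IsLeftPositive w) :
    coord hn hr hR True (b r R w) = Finsupp.single (redTrace w) 1 := by
  rw [b, coord_wordU, RewritingSystem.nf_of_irred]
  · rfl
  · have h1 := hw.isIrred (isReducedExpr_choose w)
    have h2 := (isLeftPositive_iff hn hw (isReducedExpr_choose w)).1 hp
    refine irred_tlSystem_iff.2 fun a P c hP => ?_
    cases hP with
    | sq i => exact h1 a _ c (.sq i)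
    | three i j h h' =>
      rcases h' with h' | ⟨-, rfl, rfl⟩
      · exact h1 a _ c (.three i j h (.inl h'))
      · exact h2 a c
    | four i j h h' _ => exact h1 a _ c (.four i j h h' (by tauto))

/-- The monomials of the fully commutative elements span. -/
theorem span_b (hn : 2 ≤ n) (hr : r ≠ 0) (hR : R ≠ 0) :
    Submodule.span K {a : TL n (r ^ 2) (R ^ 2) | ∃ w : W n, IsFullyCommutative w ∧ b r R w = a} =
      ⊤ := by
  have h1 : ∀ t, ofTrace hn hr hR t ∈
      Submodule.span K {a | ∃ w : W n, IsFullyCommutative w ∧ b r R w = a} := by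
    intro t
    obtain ⟨c, u, hu, h⟩ := exists_ofTrace_eq_smul hn hr hR t
    rw [h]
    refine Submodule.smul_mem _ _ ?_
    by_cases hle : ∃ i ∈ u.letters, n < i
    · rw [ofTrace_eq_zero hn hr hR hle]; exact Submodule.zero_mem _
    · push Not at hle
      obtain ⟨ω, rfl⟩ := Tr.mk_surjective u
      have hω : trace (ω.map (node n)) = Tr.mk ω := by
        rw [trace, vals_map_node fun x hx => hle x (Tr.mem_letters_mk.2 hx)]
      rw [← hω] at hu ⊢
      have hfc := isFullyCommutative_of_isIrred hu
      refine Submodule.subset_span ⟨_, hfc, ?_⟩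
      rw [ofTrace_trace, b_eq_wordU r R hfc ⟨isReduced_of_isIrred hu, rfl⟩]
  -- Since `g_i` is a combination of `U_i` and `1`, the monomials in the `U_i` span the whole
  -- algebra.
  have h2 : (MonoidAlgebra.lift K (TL n (r ^ 2) (R ^ 2)) Tr (ofTrace hn hr hR)).range = ⊤ := by
    rw [eq_top_iff]
    rintro a -
    obtain ⟨x, rfl⟩ := RingQuot.mkAlgHom_surjective K (TLRel n (r ^ 2) (R ^ 2)) a
    induction x using FreeAlgebra.induction with
    | grade0 c =>
      rw [AlgHom.commutes]; exact Subalgebra.algebraMap_mem _ c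
    | grade1 i =>
      have h3 : g n (r ^ 2) (R ^ 2) i = root n r R i • U n r R i - 1 := by
        rw [U_eq, smul_smul, mul_inv_cancel₀ (root_ne_zero hr hR _), one_smul,
          add_sub_cancel_right]
      change g n (r ^ 2) (R ^ 2) i ∈ _
      rw [h3]
      refine Subalgebra.sub_mem _ (Subalgebra.smul_mem _ ?_ _) (Subalgebra.one_mem _)
      refine ⟨MonoidAlgebra.of K Tr (Tr.of i), ?_⟩
      change MonoidAlgebra.lift K _ Tr (ofTrace hn hr hR) _ = _
      rw [MonoidAlgebra.lift_of, ofTrace, Tr.lift_of, extU, if_pos i.is_le, node_coe]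
    | mul x y hx hy => rw [map_mul]; exact Subalgebra.mul_mem _ hx hy
    | add x y hx hy => rw [map_add]; exact Subalgebra.add_mem _ hx hy
  rw [eq_top_iff]
  rintro a -
  obtain ⟨x, rfl⟩ : a ∈ (MonoidAlgebra.lift K _ Tr (ofTrace hn hr hR)).range :=
    h2 ▸ Algebra.mem_top
  change MonoidAlgebra.lift K _ Tr (ofTrace hn hr hR) x ∈ _
  rw [MonoidAlgebra.lift_apply]
  exact Submodule.sum_mem _ fun t _ => Submodule.smul_mem _ _ (h1 t)

end

end CTilde

/-! ### Bases by triangularity with respect to length. -/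

namespace CTilde

section

variable {K : Type*} [Field K] {n : ℕ} {r R : K}

/-- If every `b_x`, for `x` not left-positive, is congruent modulo `Lp` to a multiple of a shorter
monomial, then the differences form a basis of `Lp` and the left-positive monomials form a basis of
the quotient. -/
theorem exists_basis_of_shorter (hn : 2 ≤ n) (hr : r ≠ 0) (hR : R ≠ 0)
    (f : NonLeftPos n → TL n (r ^ 2) (R ^ 2))
    (H : ∀ x, ∃ (c : K) (y : W n), IsFullyCommutative y ∧ (cs n).length y < (cs n).length x.1 ∧
      f x = c • b r R y)
    (hmem : ∀ x, b r R x.1 - kappa r R • f x ∈ Lp n r R) :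
    (∃ B : Module.Basis (NonLeftPos n) K (LpSubmodule n r R),
      ∀ x, (B x : TL n (r ^ 2) (R ^ 2)) = b r R x.1 - kappa r R • f x) ∧
    (∃ B : Module.Basis (LeftPos n) K (TLQuot n r R),
      ∀ w, B w = (Lp n r R).ringCon.mk' (b r R w.1)) := by
  classical
  set v : NonLeftPos n → TL n (r ^ 2) (R ^ 2) := fun x => b r R x.1 - kappa r R • f x with hv
  set u : LeftPos n → TL n (r ^ 2) (R ^ 2) := fun x => b r R x.1 with hu
  -- The correction term in `v x` is shorter than `x`, so it is invisible at any `y` at least as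
  -- long as `x`. A longest element in a linear relation therefore has coefficient zero.
  have hcoef : ∀ x y, (cs n).length x.1 ≤ (cs n).length y.1 →
      coord hn hr hR False (v x) (redTrace y.1) = if x = y then 1 else 0 := by
    intro x y hxy
    obtain ⟨c, z, hz, hl, hf⟩ := H x
    have h1 : redTrace z ≠ redTrace y.1 := fun h => by
      rw [redTrace_injective h] at hl; omega
    simp only [hv, hf, map_sub, map_smul, coord_b hn hr hR x.2.1, coord_b hn hr hR hz,
      Finsupp.sub_apply, Finsupp.smul_apply, Finsupp.single_apply, h1, if_false, smul_zero,
      sub_zero, redTrace_injective.eq_iff, Subtype.ext_iff]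
  have hli : LinearIndependent K v := by
    rw [linearIndependent_iff']
    intro s g hg
    by_contra! hne
    obtain ⟨x, hxs, hx⟩ := hne
    obtain ⟨y, hy, hmax⟩ := Finset.exists_max_image (s.filter (g · ≠ 0))
      (fun x => (cs n).length x.1) ⟨x, Finset.mem_filter.2 ⟨hxs, hx⟩⟩
    rw [Finset.mem_filter] at hy
    refine hy.2 ?_
    have h := DFunLike.congr_fun (congrArg (coord hn hr hR False) hg) (redTrace y.1)
    rw [map_sum, map_zero, Finsupp.finsetSum_apply, Finsupp.zero_apply,
      Finset.sum_eq_single_of_mem y hy.1] at h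
    · rwa [map_smul, Finsupp.smul_apply, hcoef y y le_rfl, if_pos rfl, smul_eq_mul, mul_one] at h
    · intro z hz hzy
      by_cases hgz : g z = 0
      · simp [hgz]
      · rw [map_smul, Finsupp.smul_apply, hcoef z y (hmax z (Finset.mem_filter.2 ⟨hz, hgz⟩)),
          if_neg hzy, smul_zero]
  have hspan : Submodule.span K (Set.range v) ⊔ Submodule.span K (Set.range u) = ⊤ := by
    rw [eq_top_iff, ← span_b hn hr hR, Submodule.span_le]
    rintro _ ⟨w, hw, rfl⟩
    rw [SetLike.mem_coe]
    induction hl : (cs n).length w using Nat.strong_induction_on generalizing w with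
    | _ l ih =>
      by_cases hp : IsLeftPositive w
      · exact Submodule.mem_sup_right (Submodule.subset_span ⟨⟨w, hw, hp⟩, rfl⟩)
      · obtain ⟨c, y, hy, hyl, hf⟩ := H ⟨w, hw, hp⟩
        have h1 := ih _ (hl ▸ hyl) y hy rfl
        have h2 : b r R w = v ⟨w, hw, hp⟩ + kappa r R • c • b r R y := by
          rw [hv, ← hf]; simp
        rw [h2]
        exact Submodule.add_mem _ (Submodule.mem_sup_left (Submodule.subset_span ⟨_, rfl⟩))
          (Submodule.smul_mem _ _ (Submodule.smul_mem _ _ h1))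
  have hliu : LinearIndependent K (coord hn hr hR True ∘ u) := by
    have : coord hn hr hR True ∘ u =
        (fun t => Finsupp.single t (1 : K)) ∘ fun w : LeftPos n => redTrace w.1 := by
      funext w
      exact coord_b_of_isLeftPositive hn hr hR w.2.1 w.2.2
    rw [this]
    exact (Finsupp.linearIndependent_single_one K Tr).comp _
      (redTrace_injective.comp Subtype.val_injective)
  -- The coordinates for `ε = True` vanish on `Lp` but are independent on the left-positive
  -- monomials.
  have hdisj : Disjoint (Submodule.span K (Set.range u)) (LpSubmodule n r R) :=
    (Submodule.range_ker_disjoint hliu).mono_right fun a ha =>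
      coord_eq_zero_of_mem_Lp hn hr hR ha
  have hle : Submodule.span K (Set.range v) ≤ LpSubmodule n r R := by
    rw [Submodule.span_le]
    rintro _ ⟨x, rfl⟩
    exact hmem x
  have hLp : Submodule.span K (Set.range v) = LpSubmodule n r R := by
    refine le_antisymm hle fun a ha => ?_
    -- An element of `Lp` is a combination `s` of differences plus a combination `l` of
    -- left-positive monomials. Then `l` also lies in `Lp`, so it vanishes.
    obtain ⟨s, hs, l, hl, rfl⟩ := Submodule.mem_sup.1 (hspan ▸ Submodule.mem_top : a ∈ _)
    have h1 : l ∈ LpSubmodule n r R := by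
      simpa using Submodule.sub_mem _ ha (hle hs)
    rw [Submodule.disjoint_def.1 hdisj l hl h1, add_zero]
    exact hs
  let π : TL n (r ^ 2) (R ^ 2) →ₗ[K] TLQuot n r R :=
    { (Lp n r R).ringCon.mk' with map_smul' := fun _ _ => rfl }
  have hπ : Function.Surjective π := (Lp n r R).ringCon.mk'_surjective
  have hker : LinearMap.ker π = LpSubmodule n r R := by
    ext a
    change (Lp n r R).ringCon.mk' a = 0 ↔ a ∈ Lp n r R
    rw [← TwoSidedIdeal.mem_ker, TwoSidedIdeal.ker_ringCon_mk']
  refine ⟨⟨(Module.Basis.span hli).map (LinearEquiv.ofEq _ _ hLp), fun x => ?_⟩,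
    ⟨Module.Basis.mk (v := fun w => π (u w))
      ((LinearIndependent.of_comp _ hliu).map (hker ▸ hdisj)) ?_, fun w => ?_⟩⟩
  · rw [Module.Basis.map_apply, LinearEquiv.coe_ofEq_apply, Module.Basis.span_apply]
  · have h1 : Set.range (fun w => π (u w)) = π '' Set.range u := by rw [← Set.range_comp]; rfl
    rw [h1, Submodule.span_image, ← LinearMap.range_eq_top.2 hπ, LinearMap.range_eq_map, ← hspan,
      Submodule.map_sup, hLp, ← hker, LinearMap.le_ker_iff_map.1 le_rfl, bot_sup_eq]
  · rw [Module.Basis.mk_apply]; rfl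

end

end CTilde

namespace CTilde

/-! ### Irreducibility in terms of words -/

/-- The letters of `β` that are neighbours of `i`. -/
def nb (i : ℕ) (β : List ℕ) : List ℕ := β.filter fun x => x + 1 = i ∨ i + 1 = x

@[simp] theorem nb_nil (i : ℕ) : nb i [] = [] := rfl

@[simp] theorem nb_append (i : ℕ) (β γ : List ℕ) : nb i (β ++ γ) = nb i β ++ nb i γ := by
  simp [nb]

theorem nb_cons_of_adj {i j : ℕ} (h : j + 1 = i ∨ i + 1 = j) (β : List ℕ) :
    nb i (j :: β) = j :: nb i β := by
  simp [nb, h]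

theorem nb_cons_of_not_adj {i j : ℕ} (h : ¬ (j + 1 = i ∨ i + 1 = j)) (β : List ℕ) :
    nb i (j :: β) = nb i β := by
  simp only [nb]
  rw [List.filter_cons_of_neg]
  simpa using h

theorem nb_eq_nil {i : ℕ} {β : List ℕ} : nb i β = [] ↔ ∀ x ∈ β, ¬ (x + 1 = i ∨ i + 1 = x) := by
  simp [nb, List.filter_eq_nil_iff]

theorem nb_reverse (i : ℕ) (β : List ℕ) : nb i β.reverse = (nb i β).reverse := by
  simp [nb, List.filter_reverse]

theorem indep_of_nb_eq_nil {i : ℕ} {β : List ℕ} (h : nb i β = []) (hi : i ∉ β) :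
    Tr.Indep (Tr.of i) (Tr.mk β) := by
  rw [nb_eq_nil] at h
  intro x hx y hy
  rw [Tr.letters_of, Multiset.mem_singleton] at hx
  rw [Tr.mem_letters_mk] at hy
  have h1 := h y hy
  have h2 : y ≠ i := fun h => hi (h ▸ hy)
  unfold Ind
  omega

section

variable {n : ℕ} {ε : Prop}

theorem IsIrred.of_mul {a t b : Tr} (h : IsIrred n ε (a * t * b)) : IsIrred n ε t := by
  rintro c P d hP rfl
  exact h (a * c) P (d * b) hP (by simp only [mul_assoc])

/-- Consecutive occurrences of a letter in an irreducible word. -/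
theorem IsIrred.nb_ne_nil {i : ℕ} {α β γ : List ℕ}
    (h : IsIrred n ε (Tr.mk (α ++ i :: β ++ i :: γ))) (hi : i ∉ β) : nb i β ≠ [] := by
  intro hb
  have hc := (indep_of_nb_eq_nil hb hi).commute.eq
  refine h (Tr.mk α * Tr.mk β) [i, i] (Tr.mk γ) (.sq i) ?_
  simp only [Tr.mk_append, Tr.mk_cons, Tr.mk_nil, mul_one, mul_assoc]
  rw [← mul_assoc (Tr.of i) (Tr.mk β), hc, mul_assoc]

/-- With a single neighbour `j` in the gap, everything else commutes with `i` and the gap collapses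
to `iji`, a redex on an edge labelled `3`. -/
theorem IsIrred.isFour {i j : ℕ} {α β γ : List ℕ}
    (h : IsIrred n ε (Tr.mk (α ++ i :: β ++ i :: γ))) (hi : i ∉ β) (hb : nb i β = [j]) :
    IsFour n i j := by
  by_contra h4
  have hj : j + 1 = i ∨ i + 1 = j := by
    have : j ∈ nb i β := by rw [hb]; simp
    simpa [nb] using (List.mem_filter.1 this).2
  obtain ⟨β₁, β₂, rfl, h1, -, h2⟩ := List.filter_eq_cons_iff.1 hb
  have h3 : nb i β₁ = [] := List.filter_eq_nil_iff.2 h1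
  simp only [List.mem_append, List.mem_cons, not_or] at hi
  have hc₁ := (indep_of_nb_eq_nil h3 hi.1).commute.eq
  have hc₂ := (indep_of_nb_eq_nil h2 hi.2.2).commute.eq
  refine h (Tr.mk α * Tr.mk β₁) [i, j, i] (Tr.mk β₂ * Tr.mk γ)
    (.three i j (by omega) (.inl h4)) ?_
  simp only [Tr.mk_append, Tr.mk_cons, Tr.mk_nil, mul_one, mul_assoc]
  rw [← mul_assoc (Tr.of i) (Tr.mk β₁), hc₁, mul_assoc, ← mul_assoc (Tr.mk β₂) (Tr.of i), ← hc₂,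
    mul_assoc]

/-- The conditions on the gaps let the four marked letters be brought together to the redex `ijij`;
nothing need be known about the neighbours of `j` in `β` or of `i` in `δ`. -/
theorem IsIrred.not_four {i j : ℕ} {α β γ δ η : List ℕ}
    (h : IsIrred n False (Tr.mk (α ++ i :: β ++ j :: γ ++ i :: δ ++ j :: η)))
    (hij : i + 1 = j ∨ j + 1 = i) (h4 : IsFour n i j)
    (hiβ : i ∉ β) (hiγ : i ∉ γ) (hjγ : j ∉ γ) (hjδ : j ∉ δ)
    (hβ : nb i β = []) (hγ : nb i γ = []) (hγ' : nb j γ = []) (hδ : nb j δ = []) : False := by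
  have h1 := (indep_of_nb_eq_nil hβ hiβ).commute.eq
  have h2 := (indep_of_nb_eq_nil hγ hiγ).commute.eq
  have h3 := (indep_of_nb_eq_nil hγ' hjγ).commute.eq
  have h5 := (indep_of_nb_eq_nil hδ hjδ).commute.eq
  refine h (Tr.mk α * Tr.mk β) [i, j, i, j] (Tr.mk γ * Tr.mk δ * Tr.mk η)
    (.four i j hij h4 (by tauto)) ?_
  simp only [Tr.mk_append, Tr.mk_cons, Tr.mk_nil, mul_one, mul_assoc]
  rw [← mul_assoc (Tr.of i) (Tr.mk β), h1, mul_assoc, ← mul_assoc (Tr.mk δ) (Tr.of j), ← h5,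
    mul_assoc, ← mul_assoc (Tr.mk γ) (Tr.of i), ← h2, mul_assoc, ← mul_assoc (Tr.mk γ) (Tr.of j),
    ← h3, mul_assoc]

/-- The order of two noncommuting letters is an invariant of the trace. This is the means of
comparing different words of one trace. -/
theorem filter_eq_of_mk_eq {ω ω' : List ℕ} (h : Tr.mk ω = Tr.mk ω') {i j : ℕ}
    (hij : j + 1 = i ∨ i + 1 = j) :
    ω.filter (fun x => x = i ∨ x = j) = ω'.filter (fun x => x = i ∨ x = j) := by
  rcases hij with rfl | rfl
  · have := congrArg (Tr.proj j) h
    rw [Tr.proj_mk, Tr.proj_mk] at this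
    simpa only [or_comm] using FreeMonoid.ofList.injective this
  · have := congrArg (Tr.proj i) h
    rw [Tr.proj_mk, Tr.proj_mk] at this
    exact FreeMonoid.ofList.injective this

theorem count_eq_of_mk_eq {ω ω' : List ℕ} (h : Tr.mk ω = Tr.mk ω') (i : ℕ) :
    ω.count i = ω'.count i := by
  have := congrArg Tr.letters h
  rw [Tr.letters_mk, Tr.letters_mk] at this
  exact List.Perm.count_eq (Multiset.coe_eq_coe.1 this) i

theorem append_cons_inj_of_count {X : Type*} [DecidableEq X] {i : X} {α α' γ γ' : List X}
    (h : α ++ i :: γ = α' ++ i :: γ') (hc : α.count i = α'.count i) : α = α' ∧ γ = γ' := by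
  induction α generalizing α' with
  | nil =>
    cases α' with
    | nil => simpa using h
    | cons x α' =>
      simp only [List.nil_append, List.cons_append, List.cons.injEq] at h
      rw [← h.1] at hc
      simp at hc
  | cons x α ih =>
    cases α' with
    | nil =>
      simp only [List.nil_append, List.cons_append, List.cons.injEq] at h
      rw [h.1] at hc
      simp at hc
    | cons y α' =>
      simp only [List.cons_append, List.cons.injEq] at h
      obtain ⟨rfl, h⟩ := h
      have := ih h (by simpa [List.count_cons] using hc)
      simpa using this

theorem gap_inj_of_count {X : Type*} [DecidableEq X] {i : X} {α β γ α' β' γ' : List X}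
    (h : α ++ i :: β ++ i :: γ = α' ++ i :: β' ++ i :: γ') (hc : α.count i = α'.count i)
    (hβ : i ∉ β) (hβ' : i ∉ β') : β = β' := by
  simp only [List.append_assoc, List.cons_append] at h
  obtain ⟨-, h⟩ := append_cons_inj_of_count h hc
  exact (append_cons_inj_of_count h (by
    rw [List.count_eq_zero_of_not_mem hβ, List.count_eq_zero_of_not_mem hβ'])).1

/-- Counting the occurrences of `i` to the left identifies the same gap in both words; within the
projection to `i` and `j` its content is determined. -/
theorem filter_gap_eq {i j : ℕ} {A M B α β γ : List ℕ}
    (h : Tr.mk (α ++ i :: β ++ i :: γ) = Tr.mk (A ++ i :: M ++ i :: B))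
    (hij : j + 1 = i ∨ i + 1 = j) (hc : α.count i = A.count i) (hβ : i ∉ β) (hM : i ∉ M) :
    β.filter (fun x => x = i ∨ x = j) = M.filter (fun x => x = i ∨ x = j) := by
  have h1 := filter_eq_of_mk_eq h hij
  simp only [List.filter_append, List.filter_cons, true_or, decide_true, if_true] at h1
  refine gap_inj_of_count h1 ?_ ?_ ?_
  · rw [List.count_filter (by simp), List.count_filter (by simp), hc]
  · exact fun h => hβ (List.mem_filter.1 h).1
  · exact fun h => hM (List.mem_filter.1 h).1

theorem exists_append_cons_of_lt_count {X : Type*} [DecidableEq X] {i : X} {ω : List X} {k : ℕ}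
    (h : k < ω.count i) : ∃ α γ, ω = α ++ i :: γ ∧ α.count i = k := by
  induction ω generalizing k with
  | nil => simp at h
  | cons x ω ih =>
    by_cases hx : x = i
    · subst hx
      rcases k with _ | k
      · exact ⟨[], ω, rfl, rfl⟩
      · obtain ⟨α, γ, rfl, hk⟩ := ih (k := k) (by simpa using h)
        exact ⟨x :: α, γ, rfl, by simp [hk]⟩
    · obtain ⟨α, γ, rfl, hk⟩ := ih (k := k) (by simpa [List.count_cons, hx] using h)
      exact ⟨x :: α, γ, rfl, by simp [hk, hx]⟩

/-- Transfers a gap between consecutive letters `i` to another word of the same trace. Only a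
permutation of the neighbours survives, since `i - 1` and `i + 1` commute with each other. -/
theorem exists_gap {i : ℕ} {ω A M B : List ℕ} (h : Tr.mk ω = Tr.mk (A ++ i :: M ++ i :: B))
    (hM : i ∉ M) : ∃ α β γ, ω = α ++ i :: β ++ i :: γ ∧ i ∉ β ∧ (nb i β).Perm (nb i M) := by
  have hc := count_eq_of_mk_eq h i
  have hM0 : M.count i = 0 := List.count_eq_zero_of_not_mem hM
  simp only [List.count_append, List.count_cons_self, hM0] at hc
  obtain ⟨α, ω', rfl, h1⟩ := exists_append_cons_of_lt_count (show A.count i < ω.count i by omega)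
  simp only [List.count_append, List.count_cons_self] at hc
  obtain ⟨β, γ, rfl, h2⟩ := exists_append_cons_of_lt_count (show 0 < ω'.count i by omega)
  have hβ : i ∉ β := List.count_eq_zero.1 h2
  refine ⟨α, β, γ, by simp, hβ, ?_⟩
  rw [← List.cons_append, ← List.append_assoc] at h
  have key := fun j hij => filter_gap_eq (j := j) h hij h1 hβ hM
  rw [List.perm_iff_count]
  intro x
  by_cases hx : x + 1 = i ∨ i + 1 = x
  · rw [nb, nb, List.count_filter (by simpa using hx), List.count_filter (by simpa using hx)]
    have := congrArg (List.count x) (key x hx)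
    rwa [List.count_filter (by simp), List.count_filter (by simp)] at this
  · rw [List.count_eq_zero_of_not_mem, List.count_eq_zero_of_not_mem]
    all_goals
      intro h
      exact hx (by simpa [nb] using (List.mem_filter.1 h).2)

/-- The projection to `{i, j}` locates the four letters in `ω`. Any further neighbour of `i` or `j`
in between is excluded by comparing the corresponding gaps, which in the given factorization are
just `[j]` and `[i]`. -/
theorem exists_four {i j : ℕ} (hij : j + 1 = i ∨ i + 1 = j) {ω A B : List ℕ}
    (h : Tr.mk ω = Tr.mk (A ++ [i, j, i, j] ++ B)) :
    ∃ α β γ δ η, ω = α ++ i :: β ++ j :: γ ++ i :: δ ++ j :: η ∧ i ∉ β ∧ i ∉ γ ∧ j ∉ γ ∧ j ∉ δ ∧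
      nb i β = [] ∧ nb i γ = [] ∧ nb j γ = [] ∧ nb j δ = [] := by
  have hne : i ≠ j := by omega
  have h1 := filter_eq_of_mk_eq h hij
  simp only [List.filter_append, List.append_assoc] at h1
  obtain ⟨α, ω', rfl, h2, h3⟩ := List.filter_eq_append_iff.1 h1
  simp only [List.filter_cons, true_or, or_true, decide_true, if_true, List.filter_nil,
    List.cons_append, List.nil_append] at h3
  obtain ⟨α', ω₁, rfl, ha, -, h3⟩ := List.filter_eq_cons_iff.1 h3
  obtain ⟨β, ω₂, rfl, hb, -, h3⟩ := List.filter_eq_cons_iff.1 h3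
  obtain ⟨γ, ω₃, rfl, hc, -, h3⟩ := List.filter_eq_cons_iff.1 h3
  obtain ⟨δ, η, rfl, hd, -, h3⟩ := List.filter_eq_cons_iff.1 h3
  simp only [decide_eq_true_eq, not_or] at ha hb hc hd
  have hiβ : i ∉ β := fun h => (hb i h).1 rfl
  have hiγ : i ∉ γ := fun h => (hc i h).1 rfl
  have hjγ : j ∉ γ := fun h => (hc j h).2 rfl
  have hjδ : j ∉ δ := fun h => (hd j h).2 rfl
  have hjβ : j ∉ β := fun h => (hb j h).2 rfl
  have hiα' : i ∉ α' := fun h => (ha i h).1 rfl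
  have hjα' : j ∉ α' := fun h => (ha j h).2 rfl
  have hcα : ∀ x, x = i ∨ x = j → (α ++ α').count x = A.count x := by
    intro x hx
    have h4 := congrArg (List.count x) h2
    rw [List.count_filter (by simpa using hx), List.count_filter (by simpa using hx)] at h4
    rw [List.count_append, h4, List.count_eq_zero_of_not_mem (a := x) (l := α'), add_zero]
    rcases hx with rfl | rfl <;> assumption
  refine ⟨α ++ α', β, γ, δ, η, by simp, hiβ, hiγ, hjγ, hjδ, ?_⟩
  have key₁ : ∀ x, x + 1 = i ∨ i + 1 = x → x ∈ β ++ γ → x = j := by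
    intro x hx hxm
    by_contra hxj
    have := filter_gap_eq (i := i) (j := x) (α := α ++ α') (β := β ++ j :: γ) (γ := δ ++ j :: η)
      (A := A) (M := [j]) (B := j :: B) (by simpa using h) hx (hcα i (.inl rfl))
      (by simp [hiβ, hiγ, hne]) (by simp [hne])
    have h5 : x ∈ (β ++ j :: γ).filter (fun y => y = i ∨ y = x) :=
      List.mem_filter.2 ⟨by simp only [List.mem_append, List.mem_cons] at hxm ⊢; tauto, by simp⟩
    rw [this] at h5
    simp [hxj] at h5
  have key₂ : ∀ x, x + 1 = j ∨ j + 1 = x → x ∈ γ ++ δ → x = i := by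
    intro x hx hxm
    by_contra hxj
    have := filter_gap_eq (i := j) (j := x) (α := α ++ α' ++ i :: β) (β := γ ++ i :: δ) (γ := η)
      (A := A ++ [i]) (M := [i]) (B := B) (by simpa using h) hx
      (by
        have := hcα j (.inr rfl)
        simp only [List.count_append] at this ⊢
        rw [List.count_cons_of_ne hne, List.count_cons_of_ne hne, List.count_nil,
          List.count_eq_zero_of_not_mem hjβ]
        omega)
      (by simp [hjδ, hjγ, hne.symm]) (by simp [hne.symm])
    have h5 : x ∈ (γ ++ i :: δ).filter (fun y => y = j ∨ y = x) :=
      List.mem_filter.2 ⟨by simp only [List.mem_append, List.mem_cons] at hxm ⊢; tauto, by simp⟩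
    rw [this] at h5
    simp [hxj] at h5
  simp only [nb_eq_nil]
  refine ⟨fun x hx h => hjβ ?_, fun x hx h => hjγ ?_, fun x hx h => hiγ ?_, fun x hx h => ?_⟩
  · rwa [← key₁ x h (by simp [hx])]
  · rwa [← key₁ x h (by simp [hx])]
  · rwa [← key₂ x h (by simp [hx])]
  · have := key₂ x h (by simp [hx])
    exact (hd x hx).1 this

/-- A word is irreducible if there are enough neighbours between consecutive occurrences of every
letter. -/
theorem isIrred_mk {ω : List ℕ}
    (h3 : ∀ i α β γ, ω = α ++ i :: β ++ i :: γ → i ∉ β →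
      nb i β ≠ [] ∧ ∀ j, nb i β = [j] → IsFour n i j)
    (h4 : ∀ i j α β γ δ η, ω = α ++ i :: β ++ j :: γ ++ i :: δ ++ j :: η →
      (i + 1 = j ∨ j + 1 = i) → IsFour n i j → i ∉ β → i ∉ γ → j ∉ γ → j ∉ δ →
      nb i β = [] → nb i γ = [] → nb j γ = [] → nb j δ = [] → False) :
    IsIrred n False (Tr.mk ω) := by
  intro a P b hP ht
  obtain ⟨A, rfl⟩ := Tr.mk_surjective a
  obtain ⟨B, rfl⟩ := Tr.mk_surjective b
  rw [← Tr.mk_append, ← Tr.mk_append] at ht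
  cases hP with
  | sq i =>
    obtain ⟨α, β, γ, h1, h2, h5⟩ := exists_gap (M := []) (by simpa using ht) (by simp)
    rw [nb_nil, List.perm_nil] at h5
    exact (h3 i α β γ h1 h2).1 h5
  | three i j h h' =>
    obtain ⟨α, β, γ, h1, h2, h5⟩ := exists_gap (i := i) (M := [j]) (B := B) (A := A)
      (by simpa using ht) (by simp; omega)
    rw [nb_cons_of_adj (by omega), nb_nil, List.perm_singleton] at h5
    have := (h3 i α β γ h1 h2).2 j h5
    tauto
  | four i j h h' h'' =>
    obtain ⟨α, β, γ, δ, η, h1, h2, h5, h6, h7, h8, h9, h10, h11⟩ := exists_four (by omega) ht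
    exact h4 i j α β γ δ η h1 h h' h2 h5 h6 h7 h8 h9 h10 h11

end

end CTilde

namespace CTilde

/-! ### Shrinking the palindrome `l ⋯ 1 0 1 ⋯ l` -/

section

variable {n : ℕ}

/-- The set of redexes is stable under reversal, with `ijij` going to `jiji`. Statements about the
left of a palindrome thus yield those about its right. -/
theorem IsIrred.reverse {ω : List ℕ} (h : IsIrred n False (Tr.mk ω)) :
    IsIrred n False (Tr.mk ω.reverse) := by
  refine isIrred_mk (fun i α β γ hω hi => ?_) fun i j α β γ δ η hω hij h4 h1 h2 h3 h5 h6 h7 h8 h9 => ?_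
  · have hω' : ω = γ.reverse ++ i :: β.reverse ++ i :: α.reverse := by
      rw [← List.reverse_reverse ω, hω]; simp
    rw [hω'] at h
    refine ⟨fun hb => h.nb_ne_nil (by simpa using hi) (by rw [nb_reverse, hb]; rfl),
      fun j hb => h.isFour (by simpa using hi) (by rw [nb_reverse, hb]; rfl)⟩
  · have hω' : ω = η.reverse ++ j :: δ.reverse ++ i :: γ.reverse ++ j :: β.reverse ++
        i :: α.reverse := by
      rw [← List.reverse_reverse ω, hω]; simp
    rw [hω'] at h
    refine h.not_four (by omega) (by unfold IsFour at *; omega) ?_ ?_ ?_ ?_ ?_ ?_ ?_ ?_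
    all_goals simp_all [nb_reverse]

theorem append_cons_eq_append_cons {X : Type*} {x y : X} {α β γ δ : List X}
    (h : α ++ x :: β = γ ++ y :: δ) :
    (∃ β', γ = α ++ x :: β' ∧ β = β' ++ y :: δ) ∨ (α = γ ∧ x = y ∧ β = δ) ∨
      ∃ α', α = γ ++ y :: α' ∧ δ = α' ++ x :: β := by
  rcases List.append_eq_append_iff.1 h with ⟨a, rfl, h'⟩ | ⟨a, rfl, h'⟩
  · cases a with
    | nil => rw [List.nil_append] at h'; cases h'; simp
    | cons z a =>
      simp only [List.cons_append, List.cons.injEq] at h'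
      obtain ⟨rfl, rfl⟩ := h'
      exact .inl ⟨a, rfl, rfl⟩
  · cases a with
    | nil => rw [List.nil_append] at h'; cases h'; simp
    | cons z a =>
      simp only [List.cons_append, List.cons.injEq] at h'
      obtain ⟨rfl, rfl⟩ := h'
      exact .inr (.inr ⟨a, rfl, rfl⟩)

theorem append_cons_eq_singleton {X : Type*} {x y : X} {α β : List X} (h : α ++ x :: β = [y]) :
    α = [] ∧ x = y ∧ β = [] := by
  cases α <;> simp_all

/-- The palindrome `l, …, 1, 0, 1, …, l`. -/
def palin (l : ℕ) : List ℕ := (List.range' 1 l).reverse ++ List.range (l + 1)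

theorem reverse_palin (l : ℕ) : (palin l).reverse = palin l := by
  simp [palin, List.range_eq_range', List.range'_succ]

theorem le_of_mem_palin {l x : ℕ} (h : x ∈ palin l) : x ≤ l := by
  simp [palin] at h
  omega

theorem palin_eq_append_cons {l i : ℕ} (hi : i ≤ l) : ∃ Y,
    palin l = (List.range' (i + 1) (l - i)).reverse ++ i :: Y := by
  have h0 : List.range (l + 1) = 0 :: List.range' 1 l := by
    rw [List.range_eq_range', List.range'_succ]
  rcases i with _ | i
  · exact ⟨List.range' 1 l, by simp [palin, h0]⟩
  · refine ⟨(List.range' 1 i).reverse ++ List.range (l + 1), ?_⟩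
    have h1 : List.range' 1 l = List.range' 1 i ++ (i + 1) :: List.range' (i + 1 + 1) (l - (i + 1)) := by
      rw [← List.range'_succ, show l - (i + 1) + 1 = l - i by omega, add_comm i 1,
        List.range'_append_1, show i + (l - i) = l by omega]
    simp [palin, h1]

theorem palin_eq_cons {l : ℕ} : ∃ Y, palin l = l :: Y := by
  obtain ⟨Y, h⟩ := palin_eq_append_cons (le_refl l)
  exact ⟨Y, by simpa using h⟩

theorem palin_eq_concat {l : ℕ} : ∃ Y, palin l = Y ++ [l] := by
  obtain ⟨Y, h⟩ := palin_eq_cons (l := l)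
  exact ⟨Y.reverse, by rw [← reverse_palin, h]; simp⟩

theorem palin_eq_cons_cons {l : ℕ} : ∃ Y, palin (l + 1) = (l + 1) :: l :: Y := by
  obtain ⟨Y, h⟩ := palin_eq_append_cons (Nat.le_succ l)
  exact ⟨Y, by simpa using h⟩

theorem palin_eq_zero {l : ℕ} (hl : 1 ≤ l) : ∃ Y,
    palin l = (List.range' 2 (l - 1)).reverse ++ 1 :: 0 :: 1 :: Y := by
  obtain ⟨l, rfl⟩ : ∃ k, l = k + 1 := ⟨l - 1, by omega⟩
  refine ⟨List.range' 2 l, ?_⟩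
  rw [palin, List.range_eq_range', List.range'_succ, List.range'_succ]
  simp [List.range'_succ]

theorem nb_range' {i a k : ℕ} (h : i + 1 < a) : nb i (List.range' a k) = [] := by
  rw [nb_eq_nil]
  intro x hx
  rw [List.mem_range'_1] at hx
  omega

theorem nb_palin {i l : ℕ} (h : l + 1 < i) : nb i (palin l) = [] := by
  rw [nb_eq_nil]
  intro x hx
  have := le_of_mem_palin hx
  omega

/-- A letter smaller than `l` cannot stand directly before `l ⋯ 1 0 1 ⋯ l`. -/
theorem IsIrred.nb_left_of_palin {l i : ℕ} (hil : i + 1 ≤ l) (hln : l ≤ n) {α₁ α₂ β : List ℕ}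
    (h : IsIrred n False (Tr.mk (α₁ ++ i :: α₂ ++ palin l ++ β))) (hi : i ∉ α₂)
    (hnb : nb i α₂ = []) : l = n ∧ i + 1 = l ∧ 1 ≤ i := by
  obtain ⟨Y, hY⟩ := palin_eq_append_cons (show i ≤ l by omega)
  have h1 : nb i (List.range' (i + 1) (l - i)).reverse = [i + 1] := by
    rw [show l - i = (l - i - 1) + 1 by omega, List.range'_succ, nb_reverse,
      nb_cons_of_adj (by omega), nb_range' (by omega)]
    rfl
  have h2 : i ∉ (List.range' (i + 1) (l - i)).reverse := by simp
  have h3 : IsFour n i (i + 1) := by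
    rw [hY] at h
    refine IsIrred.isFour (ε := False) (n := n) (α := α₁) (γ := Y ++ β)
      (β := α₂ ++ (List.range' (i + 1) (l - i)).reverse) ?_
      (by rw [List.mem_append]; tauto) (by rw [nb_append, h1, hnb]; rfl)
    simpa using h
  -- Being on an edge labelled `4` leaves `i = 0` or `i + 1 = n`. In the first case the `0` joins
  -- the central `1 0 1` of the palindrome to form `0101`.
  have hi0 : i ≠ 0 := by
    rintro rfl
    obtain ⟨Z, hZ⟩ := palin_eq_zero (l := l) (by omega)
    rw [hZ] at h
    refine IsIrred.not_four (n := n) (i := 0) (j := 1) (α := α₁)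
      (β := α₂ ++ (List.range' 2 (l - 1)).reverse) (γ := []) (δ := []) (η := Z ++ β)
      (by simpa using h) (by omega) (by simp [IsFour]) ?_ (by simp) (by simp) (by simp)
      ?_ rfl rfl rfl
    · simp [hi]
    · rw [nb_append, hnb, nb_reverse, nb_range' (by omega)]; rfl
  unfold IsFour at h3
  omega

theorem IsIrred.nb_right_of_palin {l i : ℕ} (hil : i + 1 ≤ l) (hln : l ≤ n) {α β₁ β₂ : List ℕ}
    (h : IsIrred n False (Tr.mk (α ++ palin l ++ (β₁ ++ i :: β₂)))) (hi : i ∉ β₁)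
    (hnb : nb i β₁ = []) : l = n ∧ i + 1 = l ∧ 1 ≤ i := by
  have := h.reverse
  refine IsIrred.nb_left_of_palin hil hln (α₁ := β₂.reverse) (α₂ := β₁.reverse) (β := α.reverse)
    ?_ (by simpa using hi) (by rw [nb_reverse, hnb]; rfl)
  simpa [reverse_palin] using this

/-- Replacing `l ⋯ 1 0 1 ⋯ l` by `l` in an irreducible word gives an irreducible word, unless the
result contains `(l + 1) l (l + 1)`. -/
theorem IsIrred.shrink {l : ℕ} (hl : 1 ≤ l) (hln : l ≤ n) {α β : List ℕ}
    (h : IsIrred n False (Tr.mk (α ++ palin l ++ β)))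
    (hC : ∀ α₁ α₂ β₁ β₂, α = α₁ ++ (l + 1) :: α₂ → β = β₁ ++ (l + 1) :: β₂ → l + 1 ∉ α₂ →
      l + 1 ∉ β₁ → nb (l + 1) α₂ = [] → nb (l + 1) β₁ = [] → False) :
    IsIrred n False (Tr.mk (α ++ l :: β)) := by
  obtain ⟨Y, hY⟩ := palin_eq_cons (l := l)
  obtain ⟨Z, hZ⟩ := palin_eq_concat (l := l)
  have notMem : ∀ {i}, l + 1 < i → i ∉ palin l := fun hi hm => by
    have := le_of_mem_palin hm; omega
  refine isIrred_mk (fun i α' β' γ hω hi => ?_)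
    fun i j α' β' γ δ η hω hij h4 hiβ hiγ hjγ hjδ hnβ hnγ hnγ' hnδ => ?_
  · rw [List.append_assoc, List.cons_append] at hω
    -- The letter `l` replacing the palindrome is located relative to the two occurrences of `i`. If
    -- it is one of them, it is matched with an end of `palin l`; only an `l` strictly between them
    -- gives a new gap.
    rcases append_cons_eq_append_cons hω with ⟨β'', rfl, rfl⟩ | ⟨rfl, rfl, rfl⟩ | ⟨α'', rfl, hω₁⟩
    · have h' : IsIrred n False (Tr.mk (α ++ palin l ++ β'' ++ i :: β' ++ i :: γ)) := by
        simpa using h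
      exact ⟨h'.nb_ne_nil hi, fun j => h'.isFour hi⟩
    · have h' : IsIrred n False (Tr.mk (α ++ Z ++ l :: β' ++ l :: γ)) := by
        simpa [hZ] using h
      exact ⟨h'.nb_ne_nil hi, fun j => h'.isFour hi⟩
    rcases append_cons_eq_append_cons hω₁.symm with
      ⟨β'', rfl, rfl⟩ | ⟨rfl, rfl, rfl⟩ | ⟨α''', rfl, rfl⟩
    · simp only [List.mem_append, List.mem_cons, not_or] at hi
      obtain ⟨hi1, hi2, hi3⟩ := hi
      have hL := fun (hil : i + 1 ≤ l) (hn : nb i α'' = []) =>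
        IsIrred.nb_left_of_palin hil hln h hi1 hn
      have hR := fun (hil : i + 1 ≤ l) (hn : nb i β'' = []) =>
        IsIrred.nb_right_of_palin hil hln h hi3 hn
      -- For `i < l` the palindrome had its own copies of `i`, so both outer parts of the gap
      -- already contain a neighbour of `i`, unless `l = n` and `i = n - 1`. The case `i = l + 1` is
      -- governed by `hC`, and larger letters do not interact with the palindrome.
      rcases lt_trichotomy i l with hil | rfl | hil
      · by_cases hil' : i + 1 = l
        · rw [nb_append, nb_cons_of_adj (.inr hil')]
          refine ⟨by simp, fun j hj => ?_⟩
          replace hj := append_cons_eq_singleton hj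
          have := hL hil (hj.1)
          unfold IsFour
          omega
        · have h1 : nb i α'' ≠ [] := fun hn => hil' (hL hil hn).2.1
          have h2 : nb i β'' ≠ [] := fun hn => hil' (hR hil hn).2.1
          rw [nb_append, nb_cons_of_not_adj (by omega)]
          refine ⟨by simp [h1], fun j hj => ?_⟩
          have := congrArg List.length hj
          have h3 := List.length_pos_iff.2 h1
          have h4 := List.length_pos_iff.2 h2
          simp at this
          omega
      · exact absurd rfl hi2
      · by_cases hil' : i = l + 1
        · subst hil'
          rw [nb_append, nb_cons_of_adj (by omega)]
          refine ⟨by simp, fun j hj => ?_⟩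
          replace hj := append_cons_eq_singleton hj
          exact absurd (hC α' α'' β'' γ rfl rfl hi1 hi3 hj.1 hj.2.2) id
        · have h' : IsIrred n False (Tr.mk (α' ++ i :: (α'' ++ palin l ++ β'') ++ i :: γ)) := by
            simpa using h
          have hi' : i ∉ α'' ++ palin l ++ β'' := by
            simp only [List.mem_append, not_or]
            exact ⟨⟨hi1, notMem (by omega)⟩, hi3⟩
          have hn : nb i (α'' ++ l :: β'') = nb i (α'' ++ palin l ++ β'') := by
            simp only [nb_append, nb_palin (show l + 1 < i by omega), List.append_nil]
            rw [nb_cons_of_not_adj (by omega)]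
          rw [hn]
          exact ⟨h'.nb_ne_nil hi', fun j => h'.isFour hi'⟩
    · have h' : IsIrred n False (Tr.mk (α' ++ l :: α'' ++ l :: (Y ++ β))) := by
        simpa [hY] using h
      exact ⟨h'.nb_ne_nil hi, fun j => h'.isFour hi⟩
    · have h' : IsIrred n False (Tr.mk (α' ++ i :: β' ++ i :: (α''' ++ palin l ++ β))) := by
        simpa using h
      exact ⟨h'.nb_ne_nil hi, fun j => h'.isFour hi⟩
  · simp only [List.append_assoc, List.cons_append] at hω
    -- The same localization for a pattern `ijij`. If `l` lies inside a gap it is no neighbour of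
    -- the relevant letters: a smaller letter contradicts the palindrome lemmas, and a larger one
    -- does not notice the palindrome. If `l` is an inner letter of the pattern, `hC` applies or the
    -- redex was already present for `l = n`.
    rcases append_cons_eq_append_cons hω with ⟨β'', rfl, rfl⟩ | ⟨rfl, rfl, rfl⟩ | ⟨α'', rfl, hω₂⟩
    · exact IsIrred.not_four (α := α ++ palin l ++ β'') (by simpa using h) hij h4 hiβ hiγ hjγ hjδ hnβ
        hnγ hnγ' hnδ
    · exact IsIrred.not_four (α := α ++ Z) (by simpa [hZ] using h) hij h4 hiβ hiγ hjγ hjδ hnβ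
        hnγ hnγ' hnδ
    rcases append_cons_eq_append_cons hω₂.symm with
      ⟨β'', rfl, rfl⟩ | ⟨rfl, rfl, rfl⟩ | ⟨α''', rfl, hω₃⟩
    · simp only [List.mem_append, List.mem_cons, not_or] at hiβ
      rw [nb_eq_nil] at hnβ
      have h1 := hnβ l (by simp)
      rcases lt_trichotomy i l with hil | rfl | hil
      · have := IsIrred.nb_left_of_palin (i := i) hil hln h hiβ.1
          (nb_eq_nil.2 fun x hx => hnβ x (by simp [hx]))
        omega
      · exact hiβ.2.1 rfl
      · refine IsIrred.not_four (α := α') (β := α'' ++ palin l ++ β'') (by simpa using h) hij h4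
          ?_ hiγ hjγ hjδ ?_ hnγ hnγ' hnδ
        · simp only [List.mem_append, not_or]
          exact ⟨⟨hiβ.1, notMem (by omega)⟩, hiβ.2.2⟩
        · rw [nb_eq_nil]
          intro x hx
          simp only [List.mem_append] at hx
          rcases hx with (hx | hx) | hx
          · exact hnβ x (by simp [hx])
          · have := le_of_mem_palin hx; omega
          · exact hnβ x (by simp [hx])
    · rcases hij with rfl | rfl
      · have := IsIrred.nb_left_of_palin (i := i) (by omega) hln h hiβ hnβ
        obtain ⟨rfl, -, hi⟩ := this
        obtain ⟨X, hX⟩ := palin_eq_cons_cons (l := i)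
        have hX' : palin (i + 1) = X.reverse ++ [i, i + 1] := by
          rw [← reverse_palin, hX]; simp
        refine IsIrred.not_four (α := α' ++ i :: α'' ++ X.reverse) (β := []) (i := i) (j := i + 1)
          (γ := γ) (δ := δ) (η := η) (by simpa [hX'] using h) (.inl rfl) h4
          (by simp) hiγ hjγ hjδ rfl hnγ hnγ' hnδ
      · exact hC _ _ _ _ rfl rfl hiβ hiγ hnβ hnγ
    rcases append_cons_eq_append_cons hω₃.symm with
      ⟨β'', rfl, rfl⟩ | ⟨rfl, rfl, rfl⟩ | ⟨α'', rfl, hω₄⟩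
    · simp only [List.mem_append, List.mem_cons, not_or] at hiγ hjγ
      rw [nb_eq_nil] at hnγ hnγ'
      have h1 := hnγ l (by simp)
      have h2 := hnγ' l (by simp)
      rcases lt_trichotomy i l with hil | rfl | hil
      · have := IsIrred.nb_right_of_palin (i := i) hil hln h hiγ.2.2
          (nb_eq_nil.2 fun x hx => hnγ x (by simp [hx]))
        omega
      · exact hiγ.2.1 rfl
      · have hjl := hjγ.2.1
        refine IsIrred.not_four (α := α') (β := β') (γ := α''' ++ palin l ++ β'')
          (by simpa using h) hij h4 hiβ ?_ ?_ hjδ hnβ ?_ ?_ hnδ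
        · simp only [List.mem_append, not_or]
          exact ⟨⟨hiγ.1, notMem (by omega)⟩, hiγ.2.2⟩
        · simp only [List.mem_append, not_or]
          exact ⟨⟨hjγ.1, notMem (by omega)⟩, hjγ.2.2⟩
        · rw [nb_eq_nil]
          intro x hx
          simp only [List.mem_append] at hx
          rcases hx with (hx | hx) | hx
          · exact hnγ x (by simp [hx])
          · have := le_of_mem_palin hx; omega
          · exact hnγ x (by simp [hx])
        · rw [nb_eq_nil]
          intro x hx
          simp only [List.mem_append] at hx
          rcases hx with (hx | hx) | hx
          · exact hnγ' x (by simp [hx])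
          · have := le_of_mem_palin hx; omega
          · exact hnγ' x (by simp [hx])
    · rcases hij with rfl | rfl
      · exact hC (α' ++ l :: β') α''' δ η (by simp) rfl hjγ hjδ hnγ' hnδ
      · have := IsIrred.nb_left_of_palin (i := j) (α₁ := α' ++ (j + 1) :: β') (α₂ := α''')
          (by omega) hln (by simpa using h) hjγ hnγ'
        obtain ⟨rfl, -, hi⟩ := this
        obtain ⟨X, hX⟩ := palin_eq_cons_cons (l := j)
        refine IsIrred.not_four (α := α') (β := β') (i := j + 1) (j := j) (γ := α''') (δ := [])
          (η := X ++ (δ ++ j :: η)) (by simpa [hX] using h) (.inr rfl) h4 hiβ hiγ hjγ (by simp) hnβ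
          hnγ hnγ' rfl
    rcases append_cons_eq_append_cons hω₄.symm with
      ⟨β'', rfl, rfl⟩ | ⟨rfl, rfl, rfl⟩ | ⟨α''', rfl, rfl⟩
    · simp only [List.mem_append, List.mem_cons, not_or] at hjδ
      rw [nb_eq_nil] at hnδ
      have h1 := hnδ l (by simp)
      rcases lt_trichotomy j l with hil | rfl | hil
      · have := IsIrred.nb_right_of_palin (i := j) hil hln h hjδ.2.2
          (nb_eq_nil.2 fun x hx => hnδ x (by simp [hx]))
        omega
      · exact hjδ.2.1 rfl
      · refine IsIrred.not_four (α := α') (β := β') (γ := γ) (δ := α'' ++ palin l ++ β'')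
          (by simpa using h) hij h4 hiβ hiγ hjγ ?_ hnβ hnγ hnγ' ?_
        · simp only [List.mem_append, not_or]
          exact ⟨⟨hjδ.1, notMem (by omega)⟩, hjδ.2.2⟩
        · rw [nb_eq_nil]
          intro x hx
          simp only [List.mem_append] at hx
          rcases hx with (hx | hx) | hx
          · exact hnδ x (by simp [hx])
          · have := le_of_mem_palin hx; omega
          · exact hnδ x (by simp [hx])
    · exact IsIrred.not_four (α := α') (β := β') (γ := γ) (η := Y ++ β) (by simpa [hY] using h) hij h4
        hiβ hiγ hjγ hjδ hnβ hnγ hnγ' hnδ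
    · exact IsIrred.not_four (α := α') (β := β') (γ := γ) (δ := δ) (η := α''' ++ palin l ++ β)
        (by simpa using h) hij h4 hiβ hiγ hjγ hjδ hnβ hnγ hnγ' hnδ

end

end CTilde

namespace CTilde

/-! ### Blocks -/

theorem append_cons_eq_append {X : Type*} {x : X} {α β ω ω' : List X}
    (h : α ++ x :: β = ω ++ ω') :
    (∃ c, ω = α ++ x :: c ∧ β = c ++ ω') ∨ ∃ c, α = ω ++ c ∧ ω' = c ++ x :: β := by
  rcases List.append_eq_append_iff.1 h with ⟨a, rfl, h'⟩ | ⟨a, rfl, h'⟩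
  · cases a with
    | nil => exact .inr ⟨[], by simp, by simpa using h'.symm⟩
    | cons z a =>
      simp only [List.cons_append, List.cons.injEq] at h'
      obtain ⟨rfl, rfl⟩ := h'
      exact .inl ⟨a, rfl, rfl⟩
  · exact .inr ⟨a, rfl, h'⟩

theorem range'_append_of_eq {a j b k : ℕ} (h : b = a + j) :
    List.range' a j ++ List.range' b k = List.range' a (j + k) := by
  subst h
  exact List.range'_append_1

theorem range_append_range' {a b k : ℕ} (h : a = b) :
    List.range a ++ List.range' b k = List.range (a + k) := by
  rw [List.range_eq_range', List.range_eq_range', range'_append_of_eq (by omega)]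

theorem block_natCast (i g : ℕ) : block i g = List.range' i (g + 1 - i) := by
  simp [block]

theorem block_neg_natCast {l : ℕ} (hl : 1 ≤ l) {g : ℕ} (hg : l ≤ g) :
    block (-(l : ℤ)) g = palin l ++ List.range' (l + 1) (g - l) := by
  have h : List.range (g + 1) = List.range (l + 1) ++ List.range' (l + 1) (g - l) := by
    rw [range_append_range' rfl]
    congr 1; omega
  rw [block, if_neg (by omega), h, palin]
  simp

theorem block_natCast_eq_cons {l g : ℕ} (hg : l ≤ g) :
    block (l : ℤ) g = l :: List.range' (l + 1) (g - l) := by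
  rw [block_natCast, show g + 1 - l = (g - l) + 1 by omega, List.range'_succ]

theorem le_of_mem_block {i : ℤ} {g x : ℕ} (hi : -(g : ℤ) ≤ i) (h : x ∈ block i g) : x ≤ g := by
  unfold block at h
  split_ifs at h
  · rw [List.mem_range'_1] at h; omega
  · simp only [List.mem_append, List.mem_reverse, List.mem_range'_1, List.mem_range] at h
    omega

theorem block_concat {i : ℤ} {g : ℕ} (hi : i ≤ g + 1) : block i g ++ [g + 1] = block i (g + 1) := by
  unfold block
  split_ifs
  · rw [show g + 1 + 1 - i.toNat = (g + 1 - i.toNat) + 1 by omega, List.range'_concat]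
    congr 2; omega
  · rw [List.append_assoc, List.range_succ (n := g + 1)]

theorem block_concat' {n : ℕ} (hn : 1 ≤ n) {i : ℤ} (hi : i ≤ n) :
    block i (n - 1) ++ [n] = block i n := by
  obtain ⟨m, rfl⟩ : ∃ m, n = m + 1 := ⟨n - 1, by omega⟩
  exact block_concat (by push_cast at hi; exact hi)

theorem block_neg_pred {n : ℕ} (hn : 2 ≤ n) : block (-((n : ℤ) - 1)) (n - 1) = palin (n - 1) := by
  have h := block_neg_natCast (l := n - 1) (g := n - 1) (by omega) le_rfl
  rw [show -((n : ℤ) - 1) = -((n - 1 : ℕ) : ℤ) by omega, h]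
  simp

theorem palin_succ (l : ℕ) : palin (l + 1) = (l + 1) :: palin l ++ [l + 1] := by
  rw [palin, palin, List.range_succ (n := l + 1), List.range'_1_concat, add_comm 1 l]
  simp

/-- The last `m` of the word is followed by an `m + 1`. -/
def Covered (m : ℕ) (ω : List ℕ) : Prop := ∀ α β, ω = α ++ m :: β → m ∉ β → m + 1 ∈ β

/-- Consecutive occurrences of `m` are separated by an `m + 1`. -/
def Separated (m : ℕ) (ω : List ℕ) : Prop :=
  ∀ α β γ, ω = α ++ m :: β ++ m :: γ → m ∉ β → m + 1 ∈ β

section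

variable {m : ℕ} {ω ω' : List ℕ}

theorem covered_of_notMem (h : m ∉ ω) : Covered m ω := by
  rintro α β rfl
  simp at h

theorem covered_of_eq {α β : List ℕ} (h : ω = α ++ (m + 1) :: β) (hm : m ∉ β) : Covered m ω := by
  rintro α' β' h' -
  rw [h] at h'
  rcases append_cons_eq_append_cons h' with ⟨β'', -, rfl⟩ | ⟨-, h, -⟩ | ⟨α'', -, rfl⟩
  · simp at hm
  · omega
  · simp

theorem Covered.append (h : Covered m ω) (h' : Covered m ω') : Covered m (ω ++ ω') := by
  intro α β he hm
  rcases List.append_eq_append_iff.1 he with ⟨a, rfl, h1⟩ | ⟨a, rfl, h1⟩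
  · exact h' a β h1 hm
  · cases a with
    | nil => exact h' [] β (by simpa using h1.symm) hm
    | cons x a =>
      simp only [List.cons_append, List.cons.injEq] at h1
      obtain ⟨rfl, rfl⟩ := h1
      simp only [List.mem_append, not_or] at hm
      exact List.mem_append_left _ (h α a rfl hm.1)

theorem Covered.flatMap {X : Type*} {f : X → List ℕ} {L : List X}
    (h : ∀ x ∈ L, Covered m (f x)) : Covered m (L.flatMap f) := by
  induction L with
  | nil => exact covered_of_notMem (by simp)
  | cons x L ih =>
    rw [List.flatMap_cons]
    exact (h x (by simp)).append (ih fun y hy => h y (by simp [hy]))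

theorem separated_of_count_le (h : ω.count m ≤ 1) : Separated m ω := by
  rintro α β γ rfl -
  simp only [List.count_append, List.count_cons_self] at h
  omega

/-- The only new gap is the one across the seam. It contains what follows the last `m` of `ω`, where
covering supplies `m + 1`. -/
theorem Separated.append (h : Separated m ω) (h' : Separated m ω') (hc : Covered m ω ∨ m ∉ ω') :
    Separated m (ω ++ ω') := by
  intro α β γ he hm
  rw [List.append_assoc, List.cons_append] at he
  rcases append_cons_eq_append he.symm with ⟨c, rfl, h1⟩ | ⟨c, rfl, rfl⟩
  · rcases append_cons_eq_append h1 with ⟨c, rfl, rfl⟩ | ⟨d, rfl, rfl⟩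
    · exact h α β c (by simp) hm
    · simp only [List.mem_append, not_or] at hm
      rcases hc with hc | hc
      · exact List.mem_append_left _ (hc α c rfl hm.1)
      · simp at hc
  · exact h' c β γ (by simp) hm

theorem Separated.flatMap {X : Type*} {f : X → List ℕ} {L : List X}
    (h : ∀ x ∈ L, Covered m (f x)) (h' : ∀ x ∈ L, Separated m (f x)) :
    Separated m (L.flatMap f) := by
  induction L with
  | nil => exact separated_of_count_le (by simp)
  | cons x L ih =>
    rw [List.flatMap_cons]
    exact (h' x (by simp)).append (ih (fun y hy => h y (by simp [hy]))
      fun y hy => h' y (by simp [hy])) (.inl (h x (by simp)))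

/-- A factor `101` would give, in every word of the trace, two consecutive letters `1` with only a
`0` as neighbour between them, hence without a `2`. -/
theorem not_factor_of_separated (h : Separated 1 ω) (a b : Tr) :
    Tr.mk ω ≠ a * Tr.mk [1, 0, 1] * b := by
  intro he
  obtain ⟨A, rfl⟩ := Tr.mk_surjective a
  obtain ⟨B, rfl⟩ := Tr.mk_surjective b
  rw [← Tr.mk_append, ← Tr.mk_append] at he
  obtain ⟨α, β, γ, h1, h2, h3⟩ := exists_gap (i := 1) (M := [0]) (A := A) (B := B)
    (by simpa using he) (by simp)
  have h4 := h α β γ h1 h2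
  have h5 : 2 ∈ nb 1 β := by simpa [nb] using h4
  simpa [nb] using h3.subset h5

/-- The last stretch of a block is increasing, so its last `m` is directly followed by `m + 1`. -/
theorem covered_block {i : ℤ} {g : ℕ} (h : m + 1 ≤ g) : Covered m (block i g) := by
  by_cases hi : i ≤ (m : ℤ) + 1
  · have : ∃ X, block i g = X ++ (m + 1) :: List.range' (m + 2) (g - (m + 1)) := by
      unfold block
      split_ifs
      · refine ⟨List.range' i.toNat (m + 1 - i.toNat), ?_⟩
        rw [show (m + 1) :: List.range' (m + 2) (g - (m + 1)) =
          List.range' (m + 1) (g - (m + 1) + 1) by rw [List.range'_succ],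
          range'_append_of_eq (by omega)]
        congr 1; omega
      · refine ⟨(List.range' 1 (-i).toNat).reverse ++ List.range (m + 1), ?_⟩
        rw [List.append_assoc, show (m + 1) :: List.range' (m + 2) (g - (m + 1)) =
          List.range' (m + 1) (g - (m + 1) + 1) by rw [List.range'_succ],
          range_append_range' rfl]
        congr 2; omega
    obtain ⟨X, hX⟩ := this
    refine covered_of_eq hX ?_
    rw [List.mem_range'_1]; omega
  · refine covered_of_notMem fun hm => ?_
    rw [block, if_pos (by omega), List.mem_range'_1] at hm
    omega

theorem count_block_le {i : ℤ} (hi : 0 ≤ i) (g : ℕ) : (block i g).count m ≤ 1 := by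
  rw [block, if_pos hi]
  exact List.nodup_iff_count_le_one.1 (List.nodup_range' (step := 1)) m

theorem separated_block {i : ℤ} (hi : 0 ≤ i) (g : ℕ) : Separated m (block i g) :=
  separated_of_count_le (count_block_le hi g)

theorem mem_block_nonneg {i : ℤ} (hi : 0 ≤ i) {g x : ℕ} : x ∈ block i g ↔ i ≤ x ∧ x ≤ g := by
  rw [block, if_pos hi, List.mem_range'_1]; omega

/-- A nonnegative block has at most one `1`. If it ends at `2` or later it covers that letter;
otherwise the following blocks end below `1`. So only negative blocks can produce `101`. -/
theorem separated_blocks {v : List (ℤ × ℕ)} (h : (v.map Prod.snd).Pairwise (· > ·))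
    (h0 : ∀ p ∈ v, 0 ≤ p.1) : Separated 1 (blocks v) := by
  induction v with
  | nil => exact separated_of_count_le (by simp [blocks])
  | cons p v ih =>
    rw [List.map_cons, List.pairwise_cons] at h
    have h1 : blocks (p :: v) = block p.1 p.2 ++ blocks v := by simp [blocks]
    rw [h1]
    refine (separated_block (h0 p (by simp)) _).append (ih h.2 fun q hq => h0 q (by simp [hq])) ?_
    by_cases hp : 2 ≤ p.2
    · exact .inl (covered_block hp)
    · refine .inr fun hm => ?_
      obtain ⟨q, hq, hm⟩ := List.mem_flatMap.1 hm
      rw [mem_block_nonneg (h0 q (by simp [hq]))] at hm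
      have := h.1 q.2 (List.mem_map_of_mem hq)
      omega

end

end CTilde

/-! ### Palindromes modulo `Lp` and the effect of shrinking them. -/

namespace CTilde

section

variable {K : Type*} [Field K] {n : ℕ} {r R : K}

/-- The homomorphism from the traces to the quotient algebra. -/
noncomputable def quotTrace (hn : 2 ≤ n) (hr : r ≠ 0) (hR : R ≠ 0) : Tr →* TLQuot n r R :=
  ((Lp n r R).ringCon.mk' : _ →* _).comp (ofTrace hn hr hR)

theorem ofTrace_mk (hn : 2 ≤ n) (hr : r ≠ 0) (hR : R ≠ 0) {ω : List ℕ} (h : ∀ x ∈ ω, x ≤ n) :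
    ofTrace hn hr hR (Tr.mk ω) = wordU r R (ω.map (node n)) := by
  rw [← ofTrace_trace hn hr hR, trace, vals_map_node h]

theorem quotTrace_rule (hn : 2 ≤ n) (hr : r ≠ 0) (hR : R ≠ 0) {P Q : List ℕ} {c : K}
    (h : (tlSystem n r R False).Rule P c Q) :
    quotTrace hn hr hR (Tr.mk P) = c • quotTrace hn hr hR (Tr.mk Q) :=
  congrArg (Lp n r R).ringCon.mk' (ofTrace_rule hn hr hR h)

theorem mk'_eq_mk'_iff {a b : TL n (r ^ 2) (R ^ 2)} :
    (Lp n r R).ringCon.mk' a = (Lp n r R).ringCon.mk' b ↔ a - b ∈ Lp n r R := by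
  rw [← sub_eq_zero, ← map_sub, ← TwoSidedIdeal.mem_ker, TwoSidedIdeal.ker_ringCon_mk']

/-- Induction outwards from the generator of `Lp`: `palin (l + 1)` reduces to `κ (l + 1) l (l + 1)`,
and the outer letters absorb `l` because that edge is labelled `3` as long as `l + 1 < n`. -/
theorem quotTrace_palin (hn : 2 ≤ n) (hr : r ≠ 0) (hR : R ≠ 0) {l : ℕ} (hl : 1 ≤ l) (hln : l < n) :
    quotTrace hn hr hR (Tr.mk (palin l)) = kappa r R • quotTrace hn hr hR (Tr.of l) := by
  induction l, hl using Nat.le_induction with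
  | base =>
    have h1 : palin 1 = [1, 0, 1] := rfl
    rw [h1, ← Tr.mk_singleton]
    change (Lp n r R).ringCon.mk' (ofTrace hn hr hR _) =
      (Lp n r R).ringCon.mk' (kappa r R • ofTrace hn hr hR _)
    rw [mk'_eq_mk'_iff, ofTrace_mk hn hr hR (by simp; omega), ofTrace_mk hn hr hR (by simp; omega)]
    refine TwoSidedIdeal.subset_span ?_
    simp [wordU, mul_assoc]
  | succ l hl ih =>
    have h4 : ¬ IsFour n (l + 1) l := by unfold IsFour; omega
    have h2 := quotTrace_rule hn hr hR (r := r) (R := R) (.three (l + 1) l ⟨.inr rfl, .inl h4⟩)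
    rw [tlSystem_c_of_not_isFour h4, one_smul, Tr.mk_singleton] at h2
    rw [palin_succ, Tr.mk_append, Tr.mk_cons, map_mul, map_mul, ih (by omega)]
    conv_rhs => rw [← h2]
    simp only [Tr.mk_cons, Tr.mk_nil, mul_one, map_mul, mul_smul_comm, smul_mul_assoc, mul_assoc]

/-- At `l = n` the last edge is labelled `4`, so the reduction stops at `n (n - 1) n`. This is the
origin of the exceptional bar for `k = 1`, `i = f = n`. -/
theorem quotTrace_palin_top (hn : 2 ≤ n) (hr : r ≠ 0) (hR : R ≠ 0) :
    quotTrace hn hr hR (Tr.mk (palin n)) =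
      kappa r R • quotTrace hn hr hR (Tr.mk [n, n - 1, n]) := by
  obtain ⟨l, rfl⟩ : ∃ l, n = l + 1 := ⟨n - 1, by omega⟩
  rw [palin_succ, Tr.mk_append, Tr.mk_cons, map_mul, map_mul,
    quotTrace_palin hn hr hR (by omega) (by omega)]
  simp only [Tr.mk_cons, Tr.mk_nil, mul_one, map_mul, mul_smul_comm, smul_mul_assoc, mul_assoc,
    Nat.add_sub_cancel]

/-- `ω'` is an irreducible word shorter than `ω`, and modulo `Lp` the monomial of `ω` is `κ c` times
that of `ω'`. -/
structure IsBar (hn : 2 ≤ n) (hr : r ≠ 0) (hR : R ≠ 0) (ω : List ℕ) (c : K) (ω' : List ℕ) :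
    Prop where
  irred : IsIrred n False (Tr.mk ω')
  le : ∀ x ∈ ω', x ≤ n
  length_lt : ω'.length < ω.length
  eq : quotTrace hn hr hR (Tr.mk ω) = kappa r R • c • quotTrace hn hr hR (Tr.mk ω')

theorem length_palin (l : ℕ) : (palin l).length = 2 * l + 1 := by
  simp [palin]; omega

/-- The covering hypothesis excludes the pattern `(l + 1) l (l + 1)`, the only obstruction in
`IsIrred.shrink`. -/
theorem isBar_shrink (hn : 2 ≤ n) (hr : r ≠ 0) (hR : R ≠ 0) {ω ω' α β : List ℕ} {l : ℕ} (hl : 1 ≤ l)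
    (hln : l < n) (hω : ω = α ++ palin l ++ β) (hω' : ω' = α ++ l :: β)
    (h : IsIrred n False (Tr.mk ω)) (hle : ∀ x ∈ ω, x ≤ n)
    (hC : Covered (l + 1) α ∨ l + 1 ∉ β) : IsBar hn hr hR ω 1 ω' := by
  subst hω hω'
  refine ⟨h.shrink hl hln.le ?_, ?_, ?_, ?_⟩
  · rintro α₁ α₂ β₁ β₂ rfl rfl h1 h2 h3 h4
    rcases hC with hC | hC
    · exact nb_eq_nil.1 h3 _ (hC α₁ α₂ rfl h1) (.inr rfl)
    · simp at hC
  · intro x hx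
    simp only [List.mem_append, List.mem_cons] at hx
    rcases hx with hx | rfl | hx
    · exact hle x (by simp [hx])
    · exact hln.le
    · exact hle x (by simp [hx])
  · simp [length_palin]; omega
  · rw [one_smul]
    simp only [Tr.mk_append, Tr.mk_cons, map_mul, quotTrace_palin hn hr hR hl hln, mul_smul_comm,
      smul_mul_assoc, mul_assoc]

theorem isIrred_top (hn : 2 ≤ n) : IsIrred n False (Tr.mk [n, n - 1, n]) := by
  refine isIrred_mk (fun i α β γ hω hi => ?_) fun i j α β γ δ η hω _ _ _ _ _ _ _ _ _ _ => ?_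
  · have hlen := congrArg List.length hω
    rcases α with _ | ⟨a, α⟩
    · rcases β with _ | ⟨b, β⟩
      · simp at hω; omega
      · simp at hω hlen
        obtain ⟨rfl, rfl, h⟩ := hω
        have : β = [] := List.eq_nil_of_length_eq_zero (by omega)
        subst this
        rw [nb_cons_of_adj (by omega)]
        simp [IsFour]
    · simp at hω hlen
      have h1 : α = [] := List.eq_nil_of_length_eq_zero (by omega)
      have h2 : β = [] := List.eq_nil_of_length_eq_zero (by omega)
      subst h1 h2
      simp at hω; omega
  · have hlen := congrArg List.length hω
    simp at hlen
    omega

/-- The case of `n ⋯ 1 0 1 ⋯ n`. -/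
theorem isBar_shrink_top (hn : 2 ≤ n) (hr : r ≠ 0) (hR : R ≠ 0) {ω ω' α β : List ℕ}
    (hω : ω = α ++ palin n ++ β) (hω' : ω' = α ++ n :: β)
    (h : IsIrred n False (Tr.mk ω)) (hle : ∀ x ∈ ω, x ≤ n)
    (hC : (∃ α', α = α' ++ [n - 1]) ∨ ∃ β', β = (n - 1) :: β') :
    IsBar hn hr hR ω (kappa r R) ω' := by
  subst hω hω'
  refine ⟨h.shrink (by omega) le_rfl ?_, ?_, ?_, ?_⟩
  · rintro α₁ α₂ β₁ β₂ rfl - - - - -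
    have := hle (n + 1) (by simp)
    omega
  · intro x hx
    simp only [List.mem_append, List.mem_cons] at hx
    rcases hx with hx | rfl | hx
    · exact hle x (by simp [hx])
    · exact le_rfl
    · exact hle x (by simp [hx])
  · simp [length_palin]; omega
  · have h1 : quotTrace hn hr hR (Tr.mk (α ++ [n, n - 1, n] ++ β)) =
        kappa r R • quotTrace hn hr hR (Tr.mk (α ++ n :: β)) := by
      rcases hC with ⟨α', rfl⟩ | ⟨β', rfl⟩
      · have h4 : IsFour n (n - 1) n := by simp [IsFour]
        have h5 := quotTrace_rule hn hr hR (r := r) (R := R)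
          (.four (n - 1) n ⟨by omega, h4, by tauto⟩)
        rw [tlSystem_c_of_isFour h4] at h5
        have := congrArg (fun x => quotTrace hn hr hR (Tr.mk α') * x *
          quotTrace hn hr hR (Tr.mk β)) h5
        simpa only [Tr.mk_append, Tr.mk_cons, Tr.mk_nil, mul_one, map_mul, mul_smul_comm,
          smul_mul_assoc, mul_assoc] using this
      · have h4 : IsFour n n (n - 1) := by simp [IsFour]
        have h5 := quotTrace_rule hn hr hR (r := r) (R := R)
          (.four n (n - 1) ⟨by omega, h4, by tauto⟩)
        rw [tlSystem_c_of_isFour h4] at h5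
        have := congrArg (fun x => quotTrace hn hr hR (Tr.mk α) * x *
          quotTrace hn hr hR (Tr.mk β')) h5
        simpa only [Tr.mk_append, Tr.mk_cons, Tr.mk_nil, mul_one, map_mul, mul_smul_comm,
          smul_mul_assoc, mul_assoc] using this
    rw [← h1]
    simp only [Tr.mk_append, map_mul, quotTrace_palin_top hn hr hR, mul_smul_comm, smul_mul_assoc]

end

end CTilde

/-! ### Negative `B`-forms and the letters of valid normal forms. -/

namespace CTilde

section

variable {K : Type*} [Field K] {n : ℕ} {r R : K}

theorem blocks_append (v v' : List (ℤ × ℕ)) : blocks (v ++ v') = blocks v ++ blocks v' := by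
  simp [blocks]

theorem blocks_singleton (p : ℤ × ℕ) : blocks [p] = block p.1 p.2 := by simp [blocks]

theorem negLastBlock_concat (v : List (ℤ × ℕ)) (p : ℤ × ℕ) :
    negLastBlock (v ++ [p]) = v ++ [(-p.1, p.2)] := by
  induction v with
  | nil => rfl
  | cons q v ih =>
    rcases v with _ | ⟨q', v⟩
    · rfl
    · simpa [negLastBlock] using ih

theorem negLast_concat (is : List ℤ) (i : ℤ) : negLast (is ++ [i]) = is ++ [-i] := by
  induction is with
  | nil => rfl
  | cons j is ih =>
    rcases is with _ | ⟨j', is⟩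
    · rfl
    · simpa [negLast] using ih

theorem IsTypeBForm.le {v : List (ℤ × ℕ)} (h : IsTypeBForm n v) : ∀ x ∈ blocks v, x ≤ n := by
  intro x hx
  obtain ⟨p, hp, hx⟩ := List.mem_flatMap.1 hx
  have h1 := h.2.1 p hp
  have := le_of_mem_block (by have := (abs_le.1 h1.2).1; omega) hx
  omega

/-- A `B`-form is negative or has only nonnegative blocks. -/
theorem IsTypeBForm.cases {v : List (ℤ × ℕ)} (h : IsTypeBForm n v) :
    (∀ p ∈ v, 0 ≤ p.1) ∨ ∃ (v' : List (ℤ × ℕ)) (l g : ℕ), v = v' ++ [(-(l : ℤ), g)] ∧ 1 ≤ l ∧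
      l ≤ g ∧ g < n ∧ ∀ p ∈ v', g < p.2 ∧ p.2 < n := by
  obtain ⟨h1, h2, h3⟩ := h
  rcases h3 with ⟨-, h3⟩ | ⟨a, m, h3, -, h4⟩ | ⟨a, l, h3, h4, h5⟩
  · exact .inl fun p hp => (h3 p hp).le
  · refine .inl fun p hp => ?_
    have : p.1 ∈ v.map Prod.fst := List.mem_map_of_mem hp
    rw [h3, List.mem_append] at this
    rcases this with h | h
    · exact (h4 _ h).le
    · rw [List.eq_of_mem_replicate h]
  · refine .inr ?_
    obtain ⟨v', w, rfl, h6, h7⟩ := List.map_eq_append_iff.1 h3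
    obtain ⟨p, w, rfl, h8, h9⟩ := List.map_eq_cons_iff.1 h7
    obtain rfl := List.map_eq_nil_iff.1 h9
    have h10 := h2 p (by simp)
    rw [h8, abs_neg, abs_of_pos h5] at h10
    refine ⟨v', l.toNat, p.2, ?_, by omega, by omega, h10.1, fun q hq => ⟨?_, (h2 q (by simp [hq])).1⟩⟩
    · rw [show -(l.toNat : ℤ) = p.1 by omega]
    · rw [List.map_append, List.pairwise_append] at h1
      exact h1.2.2 q.2 (List.mem_map_of_mem hq) p.2 (by simp)

/-- The bar operation on a negative `B`-form at the end of a word. -/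
theorem isBar_blocks (hn : 2 ≤ n) (hr : r ≠ 0) (hR : R ≠ 0) {α : List ℕ} {v : List (ℤ × ℕ)}
    (hv : IsTypeBForm n v) (hα : ∀ m, m + 1 ≤ n → Covered m α) (hα' : Separated 1 α)
    (h : IsIrred n False (Tr.mk (α ++ blocks v))) (hle : ∀ x ∈ α ++ blocks v, x ≤ n)
    (hp : ¬ Separated 1 (α ++ blocks v)) :
    IsBar hn hr hR (α ++ blocks v) 1 (α ++ blocks (negLastBlock v)) := by
  rcases hv.cases with h0 | ⟨v', l, g, rfl, hl, hlg, hgn, hv'⟩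
  · exact absurd (hα'.append (separated_blocks hv.1 h0) (.inl (hα 1 hn))) hp
  · refine isBar_shrink hn hr hR (α := α ++ blocks v') (β := List.range' (l + 1) (g - l)) hl
      (by omega) ?_ ?_ h hle ?_
    · rw [blocks_append, blocks_singleton, block_neg_natCast hl hlg]
      simp
    · rw [negLastBlock_concat, blocks_append, blocks_singleton, neg_neg,
        block_natCast_eq_cons hlg]
      simp
    -- If `l = g`, nothing follows the palindrome. Otherwise the earlier blocks of the form end
    -- beyond `g ≥ l + 1`, so they cover `l + 1`, as does `α`.
    · by_cases hlg' : l = g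
      · subst hlg'; right; simp
      · refine .inl ((hα _ (by omega)).append (Covered.flatMap fun p hp => covered_block ?_))
        have := hv' p hp
        omega

theorem flatMap_congr_of_mem {X : Type*} {f g : X → List ℕ} {L : List X}
    (h : ∀ x ∈ L, f x = g x) : L.flatMap f = L.flatMap g := by
  rw [List.flatMap, List.flatMap, List.map_congr_left h]

theorem covered_secondPrefix (hn : 2 ≤ n) {is : List ℤ} {k : ℕ} (his : ∀ i ∈ is, i ≤ n)
    {m : ℕ} (hm : m + 1 ≤ n) : Covered m ((is.flatMap fun i => block i (n - 1) ++ [n]) ++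
      (List.replicate k (block 0 (n - 1) ++ [n])).flatten) := by
  refine (Covered.flatMap fun i hi => ?_).append ?_
  · rw [block_concat' (by omega) (his i hi)]; exact covered_block hm
  · rw [← List.flatMap_id]
    refine Covered.flatMap fun i hi => ?_
    rw [List.eq_of_mem_replicate hi, block_concat' (by omega) (by omega)]; exact covered_block hm

theorem separated_secondPrefix (hn : 2 ≤ n) {is : List ℤ} {k : ℕ} (his : ∀ i ∈ is, i ≤ n)
    (his' : ∀ i ∈ is, 0 ≤ i) : Separated 1 ((is.flatMap fun i => block i (n - 1) ++ [n]) ++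
      (List.replicate k (block 0 (n - 1) ++ [n])).flatten) := by
  have h1 : ∀ i ∈ is, Covered 1 (block i (n - 1) ++ [n]) := fun i hi => by
    rw [block_concat' (by omega) (his i hi)]; exact covered_block hn
  refine (Separated.flatMap h1 fun i hi => ?_).append ?_ (.inl (Covered.flatMap h1))
  · rw [block_concat' (by omega) (his i hi)]; exact separated_block (his' i hi) _
  · rw [← List.flatMap_id]
    refine Separated.flatMap (fun i hi => ?_) fun i hi => ?_
    · rw [List.eq_of_mem_replicate hi, block_concat' (by omega) (by omega)]; exact covered_block hn
    · rw [List.eq_of_mem_replicate hi, block_concat' (by omega) (by omega)]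
      exact separated_block le_rfl _

theorem NormalForm.IsValid.le (hn : 2 ≤ n) {N : NormalForm} (h : N.IsValid n) :
    ∀ x ∈ N.word n, x ≤ n := by
  have hb : ∀ {i : ℤ}, -(n : ℤ) < i → ∀ x ∈ block i (n - 1), x ≤ n := fun {i} hi x hx => by
    have := le_of_mem_block (by omega) hx
    omega
  have hp : ∀ x ∈ palin (n - 1), x ≤ n := fun x hx => by
    have := le_of_mem_palin hx; omega
  intro x hx
  cases N with
  | zero v => exact IsTypeBForm.le h x hx
  | onePos i v =>
    obtain ⟨h1, h2, h3, -⟩ := h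
    simp only [word, List.mem_append, List.mem_singleton] at hx
    rcases hx with (hx | rfl) | hx
    · exact hb (by omega) x hx
    · rfl
    · exact h3.le x hx
  | oneNeg i h' =>
    obtain ⟨h1, h2, h3, h4⟩ := h
    simp only [word, List.mem_append, List.mem_singleton, List.mem_reverse] at hx
    rcases hx with (hx | rfl) | hx
    · exact hb (by omega) x hx
    · rfl
    · exact hb (by omega) x hx
  | oneZero h' =>
    obtain ⟨h1, h2⟩ := h
    simp only [word, List.mem_append, List.mem_singleton, List.mem_reverse] at hx
    rcases hx with (hx | rfl) | hx
    · exact hb (by omega) x hx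
    · rfl
    · exact hb (by omega) x hx
  | oneZeroTail z rs =>
    obtain ⟨h1, h2, h3⟩ := h
    simp only [word, List.mem_append, List.mem_singleton, List.mem_reverse, List.mem_flatMap] at hx
    rcases hx with ((hx | rfl) | hx) | ⟨s, hs, hx⟩
    · exact hb (by omega) x hx
    · rfl
    · exact hb (by omega) x hx
    · have h4 := (List.pairwise_cons.1 h3).1 s hs
      have := le_of_mem_block (by omega) hx
      omega
  | first i k f =>
    obtain ⟨h1, h2, h3, h4, h5⟩ := h
    simp only [word, firstWord, List.mem_append, List.mem_singleton, List.mem_reverse,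
      List.mem_flatten, block_neg_pred hn] at hx
    rcases hx with ((hx | rfl) | ⟨w, hw, hx⟩) | hx
    · exact hb (by omega) x hx
    · rfl
    · rw [List.eq_of_mem_replicate hw, List.mem_append, List.mem_singleton] at hx
      rcases hx with hx | rfl
      · exact hp x hx
      · rfl
    · exact hb (by omega) x hx
  | second is k v =>
    obtain ⟨h1, h2, h3, h4, h5, h6, h7, h8⟩ := h
    simp only [word, secondWord, List.mem_append, List.mem_flatten, List.mem_flatMap] at hx
    rcases hx with (⟨i, hi, hx⟩ | ⟨w, hw, hx⟩) | hx
    · rw [List.mem_singleton] at hx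
      rcases hx with hx | rfl
      · refine hb ?_ x hx
        -- The value `i ≤ -n` must be excluded. A negative entry is last and forces `k = 0`, so it
        -- has a predecessor `j` with `n ≥ j > |i|`.
        by_contra hlt
        have h9 := h7 i hi (by omega)
        obtain ⟨is', j, rfl⟩ : ∃ is' j, is = is' ++ [j] :=
          ⟨_, _, (List.dropLast_append_getLast (List.ne_nil_of_mem hi)).symm⟩
        have hij : i = j := by
          by_contra hij
          have : i ∈ is' := by simpa [hij] using hi
          have := h5 i (by simpa using this)
          omega
        subst hij
        rw [h9.1] at h1
        simp only [List.length_append, List.length_singleton] at h1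
        obtain ⟨j, hj⟩ := List.exists_mem_of_length_pos (l := is') (by omega)
        rw [List.map_append, List.pairwise_append] at h3
        have h10 := h3.2.2 _ (List.mem_map_of_mem hj) |i| (by simp)
        have h11 := h4 j (by simp [hj])
        have h12 := h5 j (by simp [hj])
        rw [abs_of_pos h12, abs_of_neg (by omega : i < 0)] at h10
        omega
      · rfl
    · rw [List.eq_of_mem_replicate hw, List.mem_append, List.mem_singleton] at hx
      rcases hx with hx | rfl
      · exact hb (by omega) x hx
      · rfl
    · exact h2.le x hx

end

end CTilde

/-! ### The bar operator on every normal form. -/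

namespace CTilde

section

variable {K : Type*} [Field K] {n : ℕ} {r R : K}

theorem exists_block_eq_concat {i : ℤ} {g : ℕ} (hi : i ≤ g) : ∃ X, block i g = X ++ [g] := by
  unfold block
  split_ifs
  · refine ⟨List.range' i.toNat (g - i.toNat), ?_⟩
    rw [show g + 1 - i.toNat = (g - i.toNat) + 1 by omega, List.range'_1_concat]
    congr 2; omega
  · exact ⟨(List.range' 1 (-i).toNat).reverse ++ List.range g, by
      rw [List.range_succ, List.append_assoc]⟩

/-- In every family the bar shrinks one palindrome. The families and subcases without a negative
block are separated words, which `hp` rules out. For the first type with `f ≥ 0` the palindrome has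
radius `n`. -/
theorem NormalForm.IsValid.isBar (hn : 2 ≤ n) (hr : r ≠ 0) (hR : R ≠ 0) {N : NormalForm}
    (hN : N.IsValid n) (h : IsIrred n False (Tr.mk (N.word n))) (hp : ¬ Separated 1 (N.word n)) :
    IsBar hn hr hR (N.word n) (N.barCoeff n (kappa r R)) (N.barWord n) := by
  have hle := hN.le hn
  have hneg : ∀ {l : ℕ}, 1 ≤ l → l < n →
      block (-(l : ℤ)) (n - 1) = palin l ++ List.range' (l + 1) (n - 1 - l) := fun hl hln =>
    block_neg_natCast hl (by omega)
  have hpos : ∀ {l : ℕ}, l < n → block (l : ℤ) (n - 1) = l :: List.range' (l + 1) (n - 1 - l) :=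
    fun hln => block_natCast_eq_cons (by omega)
  cases N with
  | zero v =>
    exact isBar_blocks hn hr hR (α := []) hN (fun m _ => covered_of_notMem (by simp))
      (separated_of_count_le (by simp)) h hle hp
  | onePos i v =>
    obtain ⟨h1, h2, h3, -⟩ := hN
    refine isBar_blocks hn hr hR (α := block i (n - 1) ++ [n]) h3 (fun m hm => ?_) ?_ h hle hp
    · rw [block_concat' (by omega) h2]; exact covered_block hm
    · rw [block_concat' (by omega) h2]; exact separated_block h1.le _
  | oneNeg i f =>
    obtain ⟨h1, h2, h3, h4⟩ := hN
    simp only [word, barWord, barCoeff] at *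
    split_ifs with hf
    · obtain ⟨l, rfl⟩ : ∃ l : ℕ, i = -(l : ℤ) := ⟨(-i).toNat, by omega⟩
      refine isBar_shrink hn hr hR (α := []) (l := l)
        (β := List.range' (l + 1) (n - 1 - l) ++ [n] ++ (block f (n - 1)).reverse)
        (by omega) (by omega) ?_ ?_ h hle (.inl (covered_of_notMem (by simp)))
      · rw [hneg (by omega) (by omega)]; simp
      · rw [neg_neg, hpos (by omega)]; simp
    · obtain ⟨l, rfl⟩ : ∃ l : ℕ, f = -(l : ℤ) := ⟨(-f).toNat, by omega⟩
      refine isBar_shrink hn hr hR (l := l) (β := [])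
        (α := block i (n - 1) ++ [n] ++ (List.range' (l + 1) (n - 1 - l)).reverse)
        (by omega) (by omega) ?_ ?_ h hle (.inr (by simp))
      · rw [hneg (by omega) (by omega)]; simp [reverse_palin]
      · rw [neg_neg, hpos (by omega)]; simp
  | oneZero f =>
    obtain ⟨h1, h2⟩ := hN
    simp only [word, barWord, barCoeff] at *
    have hf : f < 0 := by
      by_contra hf
      refine hp (Separated.append ?_ ?_ (.inl ?_))
      · rw [block_concat' (by omega) (by omega)]; exact separated_block le_rfl _
      · refine separated_of_count_le ?_
        rw [List.count_reverse]
        exact count_block_le (by omega) _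
      · rw [block_concat' (by omega) (by omega)]; exact covered_block hn
    obtain ⟨l, rfl⟩ : ∃ l : ℕ, f = -(l : ℤ) := ⟨(-f).toNat, by omega⟩
    refine isBar_shrink hn hr hR (l := l) (β := [])
      (α := block 0 (n - 1) ++ [n] ++ (List.range' (l + 1) (n - 1 - l)).reverse)
      (by omega) (by omega) ?_ ?_ h hle (.inr (by simp))
    · rw [hneg (by omega) (by omega)]; simp [reverse_palin]
    · rw [neg_neg, hpos (by omega)]; simp
  | oneZeroTail z rs =>
    obtain ⟨h1, h2, h3⟩ := hN
    rw [List.pairwise_cons] at h3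
    refine absurd ?_ hp
    have hs : Separated 1 (rs.flatMap fun s => block 0 s) := by
      have := separated_blocks (v := rs.map fun s => ((0 : ℤ), s)) (by simpa using h3.2) (by simp)
      simpa [blocks, List.flatMap_map] using this
    have hc : Covered 1 (block 0 (n - 1) ++ [n]) := by
      rw [block_concat' (by omega) (by omega)]; exact covered_block hn
    refine Separated.append (Separated.append ?_ ?_ (.inl hc)) hs ?_
    · rw [block_concat' (by omega) (by omega)]; exact separated_block le_rfl _
    · refine separated_of_count_le ?_
      rw [List.count_reverse]
      exact count_block_le (by omega) _
    · by_cases hz : 2 ≤ z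
      · refine .inl (hc.append (covered_of_notMem fun hm => ?_))
        rw [List.mem_reverse, mem_block_nonneg (by omega)] at hm
        omega
      · refine .inr fun hm => ?_
        obtain ⟨s, hs, hm⟩ := List.mem_flatMap.1 hm
        rw [mem_block_nonneg le_rfl] at hm
        have := h3.1 s hs
        omega
  | first i k f =>
    obtain ⟨h1, h2, h3, h4, h5⟩ := hN
    obtain ⟨k, rfl⟩ : ∃ m, k = m + 1 := ⟨k - 1, by omega⟩
    have hpal : palin n = n :: palin (n - 1) ++ [n] := by
      have := palin_succ (n - 1)
      rwa [show n - 1 + 1 = n by omega] at this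
    -- The first two letters `n` and the block `[-(n - 1), n - 1]` between them together form `palin
    -- n`.
    have hw : firstWord n i (k + 1) f = block i (n - 1) ++ palin n ++
        ((List.replicate k (block (-((n : ℤ) - 1)) (n - 1) ++ [n])).flatten ++
          (block f (n - 1)).reverse) := by
      rw [firstWord, List.replicate_succ, List.flatten_cons, block_neg_pred hn, hpal]
      simp
    simp only [word, barWord, barCoeff] at *
    by_cases hf : f < 0
    · rw [if_pos hf, if_pos (.inl hf)]
      obtain ⟨l, rfl⟩ : ∃ l : ℕ, f = -(l : ℤ) := ⟨(-f).toNat, by omega⟩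
      refine isBar_shrink hn hr hR (l := l) (β := [])
        (α := block i (n - 1) ++ [n] ++
          (List.replicate (k + 1) (block (-((n : ℤ) - 1)) (n - 1) ++ [n])).flatten ++
          (List.range' (l + 1) (n - 1 - l)).reverse)
        (by omega) (by omega) ?_ ?_ h hle (.inr (by simp))
      · rw [firstWord, hneg (by omega) (by omega)]; simp [reverse_palin]
      · rw [firstWord, neg_neg, hpos (by omega)]; simp
    · rw [if_neg hf]
      by_cases hs : k + 1 = 1 ∧ f = n ∧ i = n
      -- Here the whole word is `palin n`: there is no adjacent `n - 1`, hence no second `κ`.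
      · rw [if_pos hs, if_pos (.inr hs)]
        obtain ⟨hk, rfl, rfl⟩ := hs
        obtain rfl : k = 0 := by omega
        have he : block (n : ℤ) (n - 1) = [] := by
          rw [block_natCast, show n - 1 + 1 - n = 0 by omega]; rfl
        refine ⟨isIrred_top hn, ?_, ?_, ?_⟩
        · intro x hx; simp at hx; omega
        · rw [hw]; simp [length_palin]; omega
        · rw [hw, he, one_smul]
          simpa using quotTrace_palin_top hn hr hR
      · rw [if_neg hs, if_neg (by tauto)]
        refine isBar_shrink_top hn hr hR hw ?_ h hle ?_
        · simp [firstWord]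
        -- An adjacent `n - 1` ends the initial block unless that block is empty. If it is empty,
        -- the next letter begins either another palindrome or `[f, n - 1]⁻¹`, which is nonempty
        -- because `f = n` is excluded by `hs`.
        · by_cases hi : i = n
          · right
            rcases k with _ | k
            · obtain ⟨X, hX⟩ := exists_block_eq_concat (i := f) (g := n - 1) (by omega)
              exact ⟨X.reverse, by simp [hX]⟩
            · obtain ⟨Y, hY⟩ := palin_eq_cons (l := n - 1)
              rw [List.replicate_succ, List.flatten_cons, block_neg_pred hn, hY]
              exact ⟨_, rfl⟩
          · left
            exact exists_block_eq_concat (by omega)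
  | second is k v =>
    obtain ⟨h1, h2, h3, h4, h5, h6, h7, h8⟩ := hN
    simp only [word, barWord, barCoeff] at *
    split_ifs with hex
    · obtain ⟨i, hi, hi0⟩ := hex
      obtain ⟨rfl, rfl, hi'⟩ := h7 i hi hi0
      obtain ⟨is', j, rfl⟩ : ∃ is' j, is = is' ++ [j] :=
        ⟨_, _, (List.dropLast_append_getLast (List.ne_nil_of_mem hi)).symm⟩
      have hij : i = j := by
        by_contra hij
        have : i ∈ is' := by simpa [hij] using hi
        have := h5 i (by simpa using this)
        omega
      subst hij
      simp only [List.length_append, List.length_singleton] at h1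
      obtain ⟨j, hj⟩ := List.exists_mem_of_length_pos (l := is') (by omega)
      rw [List.map_append, List.pairwise_append] at h3
      have h10 := h3.2.2 _ (List.mem_map_of_mem hj) |i| (by simp)
      have h11 := h4 j (by simp [hj])
      have h12 := h5 j (by simp [hj])
      rw [abs_of_pos h12, abs_of_neg hi0] at h10
      obtain ⟨l, rfl⟩ : ∃ l : ℕ, i = -(l : ℤ) := ⟨(-i).toNat, by omega⟩
      refine isBar_shrink hn hr hR (l := l) (β := List.range' (l + 1) (n - 1 - l) ++ [n])
        (α := is'.flatMap fun i => block i (n - 1) ++ [n])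
        (by omega) (by omega) ?_ ?_ h hle (.inl (Covered.flatMap fun i hi => ?_))
      · rw [secondWord, List.flatMap_append, List.flatMap_singleton, hneg (by omega) (by omega)]
        simp [blocks]
      · rw [secondWord, negLast_concat, List.flatMap_append, List.flatMap_singleton, neg_neg,
          hpos (by omega)]
        simp [blocks]
      · rw [block_concat' (by omega) (h4 i (by simp [hi])).2]
        exact covered_block (by omega)
    · push Not at hex
      exact isBar_blocks hn hr hR h2 (fun m hm => covered_secondPrefix hn (fun i hi => (h4 i hi).2) hm)
        (separated_secondPrefix hn (fun i hi => (h4 i hi).2) hex) h hle hp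

/-- The properties of the bar operator that follow from the existence of normal forms. -/
theorem barMonomial_spec (hn : 2 ≤ n) (hr : r ≠ 0) (hR : R ≠ 0) {x : W n}
    (hx : IsFullyCommutative x) (hx' : ¬ IsLeftPositive x)
    (hN : ∃ N : NormalForm, N.IsNormalFormOf x) :
    (∃ (c : K) (y : W n), IsFullyCommutative y ∧ (cs n).length y < (cs n).length x ∧
      barMonomial r R x = c • b r R y) ∧
    b r R x - kappa r R • barMonomial r R x ∈ Lp n r R := by
  have hnf : (normalForm x).IsNormalFormOf x := Classical.epsilon_spec hN
  have hle := hnf.1.le hn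
  have htr : trace (((normalForm x).word n).map (node n)) = Tr.mk ((normalForm x).word n) := by
    rw [trace, vals_map_node hle]
  have hir := hx.isIrred hnf.2
  have hns : ¬ Separated 1 ((normalForm x).word n) := fun hs => hx' <|
    (isLeftPositive_iff hn hx hnf.2).2 fun a c => htr ▸ not_factor_of_separated hs a c
  rw [htr] at hir
  have hbar := hnf.1.isBar hn hr hR hir hns
  have htr' : trace (((normalForm x).barWord n).map (node n)) =
      Tr.mk ((normalForm x).barWord n) := by
    rw [trace, vals_map_node hbar.le]
  have hir' := hbar.irred
  rw [← htr'] at hir'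
  have hfc : IsFullyCommutative (bar x) := isFullyCommutative_of_isIrred hir'
  have hre : IsReducedExpr (((normalForm x).barWord n).map (node n)) (bar x) :=
    ⟨isReduced_of_isIrred hir', rfl⟩
  refine ⟨⟨_, bar x, hfc, ?_, rfl⟩, ?_⟩
  · have h1 := hre.1.eq
    have h2 := hnf.2.1.eq
    rw [hre.2, List.length_map] at h1
    rw [hnf.2.2, List.length_map] at h2
    rw [h1, h2]
    exact hbar.length_lt
  · rw [← mk'_eq_mk'_iff, barMonomial, b_eq_wordU r R hx hnf.2, b_eq_wordU r R hfc hre,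
      ← ofTrace_mk hn hr hR hle, ← ofTrace_mk hn hr hR hbar.le]
    exact hbar.eq

end

end CTilde

namespace CTilde

/-! ### Existence of block decompositions -/

section

variable {n : ℕ}

theorem block_eq_append {i : ℤ} {m g : ℕ} (hi : i ≤ m + 1) (hm : m ≤ g) :
    block i g = block i m ++ List.range' (m + 1) (g - m) := by
  unfold block
  split_ifs
  · rw [range'_append_of_eq (by omega)]; congr 1; omega
  · rw [List.append_assoc, range_append_range' rfl]; congr 2; omega

theorem block_pred {i : ℤ} {g : ℕ} (hi : 0 < i) (hig : i ≤ g + 1) :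
    block (i - 1) g = (i - 1).toNat :: block i g := by
  rw [block, block, if_pos (by omega), if_pos hi.le,
    show g + 1 - (i - 1).toNat = (g + 1 - i.toNat) + 1 by omega, List.range'_succ]
  congr 2; omega

theorem block_neg_succ (a g : ℕ) : block (-((a + 1 : ℕ) : ℤ)) g = (a + 1) :: block (-(a : ℤ)) g := by
  rw [block, if_neg (by omega)]
  rcases a with _ | a
  · simp [block, List.range_eq_range']
  · rw [block, if_neg (by omega), neg_neg, neg_neg, Int.toNat_natCast, Int.toNat_natCast,
      List.range'_1_concat (n := a + 1), add_comm 1 (a + 1)]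
    simp

theorem block_eq_natAbs_cons {i : ℤ} {g : ℕ} (h : i.natAbs ≤ g) : ∃ T, block i g = i.natAbs :: T := by
  rcases le_or_gt 0 i with hi | hi
  · obtain ⟨l, rfl⟩ : ∃ l : ℕ, i = l := ⟨i.toNat, by omega⟩
    exact ⟨_, block_natCast_eq_cons (by omega)⟩
  · obtain ⟨l, rfl⟩ : ∃ l : ℕ, i = -((l + 1 : ℕ) : ℤ) := ⟨(-i).toNat - 1, by omega⟩
    refine ⟨block (-(l : ℤ)) g, ?_⟩
    rw [block_neg_succ, Int.natAbs_neg, Int.natAbs_natCast]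

theorem IsIrred.of_infix {ω υ : List ℕ} {ε : Prop} (h : IsIrred n ε (Tr.mk ω)) (hυ : υ <:+: ω) :
    IsIrred n ε (Tr.mk υ) := by
  obtain ⟨α, β, rfl⟩ := hυ
  rw [Tr.mk_append, Tr.mk_append] at h
  exact h.of_mul

/-- Sequences of blocks `[l_t, g_t]` where the `g_t` are at most `n` and decrease strictly, except
that the value `n` may be repeated. -/
def IsBlockSeq (n : ℕ) (L : List (ℤ × ℕ)) : Prop :=
  (∀ p ∈ L, p.2 ≤ n ∧ p.1.natAbs ≤ p.2 ∧ p.1 ≠ -(n : ℤ)) ∧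
    L.Pairwise fun p q => q.2 < p.2 ∨ (p.2 = n ∧ q.2 = n)

theorem blocks_cons (p : ℤ × ℕ) (L : List (ℤ × ℕ)) : blocks (p :: L) = block p.1 p.2 ++ blocks L := by
  simp [blocks]

/-- The block runs through `j - 1` to `j` after letters that are at most `j - 2`. The two letters
`j` are therefore separated by a single neighbour `j - 1`, on an edge labelled `3`. -/
theorem not_isIrred_cons_block {i : ℤ} {g j : ℕ} (hj : j < n) (hjg : j ≤ g) (hi : i ≤ (j : ℤ) - 1)
    (hi' : -i < (j : ℤ) - 1) {β : List ℕ} (h : IsIrred n False (Tr.mk (j :: (block i g ++ β)))) :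
    False := by
  obtain ⟨j, rfl⟩ : ∃ k, j = k + 2 := ⟨j - 2, by omega⟩
  have h1 : block i g = block i j ++ (j + 1) :: (j + 2) :: List.range' (j + 3) (g - (j + 2)) := by
    rw [block_eq_append (m := j) (by omega) (by omega), show g - j = g - (j + 2) + 1 + 1 by omega,
      List.range'_succ, List.range'_succ]
  have h2 : ∀ x ∈ block i j, x ≤ j := fun x hx => le_of_mem_block (by omega) hx
  rw [h1] at h
  have h3 : IsFour n (j + 2) (j + 1) := by
    refine IsIrred.isFour (n := n) (ε := False) (i := j + 2) (j := j + 1) (α := [])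
      (β := block i j ++ [j + 1]) (γ := List.range' (j + 3) (g - (j + 2)) ++ β)
      (by simpa using h) ?_ ?_
    · intro hm
      rw [List.mem_append, List.mem_singleton] at hm
      rcases hm with hm | hm
      · have := h2 _ hm; omega
      · omega
    · rw [nb_append, nb_cons_of_adj (by omega), nb_nil, nb_eq_nil.2, List.nil_append]
      intro x hx
      have := h2 x hx
      omega
  unfold IsFour at h3
  omega

/-- The new letter `j` opens a block if it is larger than `g` or equal to `n`, prolongs the first
block if `i = j + 1` or `i = -(j - 1)`, and passes that block if `i > j + 1`. Every other position
creates a redex. The last clause, on the ends of the new blocks, preserves their order when `j`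
passes a block. -/
theorem IsBlockSeq.exists_insert (hn : 2 ≤ n) {j : ℕ} (hj : j ≤ n) {L : List (ℤ × ℕ)} (hL : IsBlockSeq n L)
    (h : IsIrred n False (Tr.mk (j :: blocks L))) :
    ∃ L', IsBlockSeq n L' ∧ Tr.mk (blocks L') = Tr.mk (j :: blocks L) ∧
      ∀ p ∈ L', p.2 = j ∨ ∃ q ∈ L, p.2 = q.2 := by
  have hjj : block (j : ℤ) j = [j] := by rw [block_natCast_eq_cons le_rfl]; simp
  induction L with
  | nil =>
    refine ⟨[((j : ℤ), j)], ⟨?_, by simp⟩, ?_, by simp⟩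
    · rintro p hp
      rw [List.mem_singleton.1 hp]
      simp only; omega
    · rw [blocks_singleton, hjj]; rfl
  | cons p L ih =>
    obtain ⟨i, g⟩ := p
    obtain ⟨h1, h2⟩ := hL
    rw [List.pairwise_cons] at h2
    have hp := h1 (i, g) (by simp)
    simp only at hp h2
    by_cases hnew : g < j ∨ j = n
    · refine ⟨((j : ℤ), j) :: (i, g) :: L, ⟨?_, ?_⟩, ?_, ?_⟩
      · intro q hq
        rcases List.mem_cons.1 hq with rfl | hq
        · simp; omega
        · exact h1 q hq
      · refine List.pairwise_cons.2 ⟨fun q hq => ?_, List.pairwise_cons.2 h2⟩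
        rcases List.mem_cons.1 hq with rfl | hq
        · simp only; omega
        · have := h2.1 q hq
          have := (h1 q (by simp [hq])).1
          simp only
          omega
      · rw [blocks_cons, hjj]; rfl
      · intro q hq
        rcases List.mem_cons.1 hq with rfl | hq
        · exact .inl rfl
        · exact .inr ⟨q, hq, rfl⟩
    have extend : ∀ i' : ℤ, i'.natAbs ≤ g → i' ≠ -(n : ℤ) → block i' g = j :: block i g →
        ∃ L', IsBlockSeq n L' ∧ Tr.mk (blocks L') = Tr.mk (j :: blocks ((i, g) :: L)) ∧
          ∀ p ∈ L', p.2 = j ∨ ∃ q ∈ (i, g) :: L, p.2 = q.2 := by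
      intro i' h3 h4 h5
      refine ⟨(i', g) :: L, ⟨?_, ?_⟩, ?_, ?_⟩
      · intro q hq
        rcases List.mem_cons.1 hq with rfl | hq
        · exact ⟨hp.1, h3, h4⟩
        · exact h1 q (by simp [hq])
      · exact List.pairwise_cons.2 h2
      · rw [blocks_cons, h5, blocks_cons]; rfl
      · intro q hq
        rcases List.mem_cons.1 hq with rfl | hq
        · exact .inr ⟨(i, g), by simp, rfl⟩
        · exact .inr ⟨q, by simp [hq], rfl⟩
    rw [blocks_cons] at h
    simp only at h
    have hne : j ≠ i.natAbs := by
      rintro rfl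
      obtain ⟨T, hT⟩ := block_eq_natAbs_cons hp.2.1
      rw [hT] at h
      exact IsIrred.nb_ne_nil (ε := False) (n := n) (i := i.natAbs) (α := []) (β := [])
        (γ := T ++ blocks L) (by simpa using h) (by simp) rfl
    have hup : ¬ (i ≤ (j : ℤ) - 1 ∧ -i < (j : ℤ) - 1) := fun hc =>
      not_isIrred_cons_block (by omega) (by omega) hc.1 hc.2 h
    rcases lt_or_ge 0 i with hi | hi
    · rcases lt_or_ge (j + 1 : ℤ) i with hji | hji
      · have hind : Tr.Indep (Tr.of j) (Tr.mk (block i g)) := by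
          refine indep_of_nb_eq_nil (nb_eq_nil.2 fun x hx => ?_) fun hx => ?_
          all_goals
            rw [mem_block_nonneg hi.le] at hx
            omega
        have hmk : Tr.mk (j :: (block i g ++ blocks L)) =
            Tr.mk (block i g) * Tr.mk (j :: blocks L) := by
          rw [Tr.mk_cons, Tr.mk_append, ← mul_assoc, hind.commute.eq, mul_assoc, Tr.mk_cons]
        rw [hmk, ← mul_one (Tr.mk (j :: blocks L)), ← mul_assoc] at h
        obtain ⟨L', h3, h4, h5⟩ := ih ⟨fun q hq => h1 q (by simp [hq]), h2.2⟩ h.of_mul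
        refine ⟨(i, g) :: L', ⟨?_, ?_⟩, ?_, ?_⟩
        · intro q hq
          rcases List.mem_cons.1 hq with rfl | hq
          · exact hp
          · exact h3.1 q hq
        · refine List.pairwise_cons.2 ⟨fun q hq => ?_, h3.2⟩
          rcases h5 q hq with h6 | ⟨q', hq', h6⟩
          · simp only; omega
          · have := h2.1 q' hq'
            simp only; omega
        · rw [blocks_cons, blocks_cons, Tr.mk_append, h4, ← hmk]
        · intro q hq
          rcases List.mem_cons.1 hq with rfl | hq
          · exact .inr ⟨(i, g), by simp, rfl⟩
          · rcases h5 q hq with h6 | ⟨q', hq', h6⟩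
            · exact .inl h6
            · exact .inr ⟨q', by simp [hq'], h6⟩
      · have hij : i = j + 1 := by omega
        subst hij
        refine extend j (by omega) (by omega) ?_
        have := block_pred (i := (j : ℤ) + 1) (g := g) (by omega) (by omega)
        simpa using this
    · obtain ⟨a, rfl⟩ : ∃ a : ℕ, i = -(a : ℤ) := ⟨(-i).toNat, by omega⟩
      rcases lt_trichotomy j (a + 1) with hja | rfl | hja
      · exfalso
        rw [block_neg_natCast (by omega) (by omega)] at h
        have := IsIrred.nb_left_of_palin (n := n) (l := a) (i := j) (α₁ := []) (α₂ := [])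
          (β := List.range' (a + 1) (g - a) ++ blocks L) (by omega) (by omega)
          (by simpa using h) (by simp) rfl
        omega
      · exact extend (-((a + 1 : ℕ) : ℤ)) (by omega) (by omega) (block_neg_succ a g)
      · omega

/-- Every irreducible word is equivalent to a sequence of blocks. -/
theorem exists_isBlockSeq (hn : 2 ≤ n) {ω : List ℕ} (hω : ∀ x ∈ ω, x ≤ n) (h : IsIrred n False (Tr.mk ω)) :
    ∃ L, IsBlockSeq n L ∧ Tr.mk (blocks L) = Tr.mk ω := by
  induction ω with
  | nil => exact ⟨[], ⟨by simp, by simp⟩, rfl⟩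
  | cons j ω ih =>
    obtain ⟨L, h1, h2⟩ := ih (fun x hx => hω x (by simp [hx]))
      (h.of_infix (List.suffix_cons j ω).isInfix)
    have h3 : Tr.mk (j :: blocks L) = Tr.mk (j :: ω) := by rw [Tr.mk_cons, Tr.mk_cons, h2]
    obtain ⟨L', h4, h5, -⟩ := h1.exists_insert hn (hω j (by simp)) (h3 ▸ h)
    exact ⟨L', h4, h5.trans h3⟩

end

end CTilde

namespace CTilde

/-! ### Existence of normal forms -/

section

variable {n : ℕ}

/-- The relation between the parameters of neighbouring blocks. -/
def Dominates (x y : ℤ) : Prop := (0 < x ∧ (y.natAbs : ℤ) < x) ∨ (x = 0 ∧ y = 0)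

theorem Dominates.trans {x y z : ℤ} (h : Dominates x y) (h' : Dominates y z) : Dominates x z := by
  unfold Dominates at *; omega

theorem pairwise_of_adjacent {X : Type*} {S : X → X → Prop} {l : List X}
    (ht : ∀ {x y z}, S x y → S y z → S x z)
    (h : ∀ α β x y, l = α ++ x :: y :: β → S x y) : l.Pairwise S := by
  induction l with
  | nil => exact .nil
  | cons x l ih =>
    have h1 := ih fun α β y z hl => h (x :: α) β y z (by simp [hl])
    refine List.pairwise_cons.2 ⟨fun y hy => ?_, h1⟩
    cases l with
    | nil => simp at hy
    | cons z l =>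
      have h2 : S x z := h [] l x z rfl
      rcases List.mem_cons.1 hy with rfl | hy
      · exact h2
      · exact ht h2 ((List.pairwise_cons.1 h1).1 y hy)

/-- A letter `a` after a block that ends with `a, a + 1, …`. -/
theorem IsIrred.ascending {i : ℤ} {a g : ℕ} {α β γ : List ℕ}
    (h : IsIrred n False (Tr.mk (α ++ block i g ++ β ++ a :: γ))) (hi : i ≤ a) (hag : a < g)
    (hgn : g ≤ n) (ha : a ∉ β) (hβ : nb a β = []) : (a = 0 ∧ i = 0) ∨ a + 1 = n := by
  have h1 : block i g = block i a ++ (a + 1) :: List.range' (a + 2) (g - (a + 1)) := by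
    rw [block_eq_append (m := a) (by omega) (by omega), show g - a = g - (a + 1) + 1 by omega,
      List.range'_succ]
  obtain ⟨X, hX⟩ := exists_block_eq_concat hi
  have h4 : IsFour n a (a + 1) := by
    rw [h1, hX] at h
    refine IsIrred.isFour (n := n) (ε := False) (i := a) (j := a + 1) (α := α ++ X)
      (β := (a + 1) :: List.range' (a + 2) (g - (a + 1)) ++ β) (γ := γ)
      (by simpa using h) ?_ ?_
    · simp only [List.cons_append, List.mem_cons, List.mem_append, List.mem_range'_1, not_or]
      exact ⟨by omega, by omega, ha⟩
    · rw [List.cons_append, nb_cons_of_adj (by omega), nb_append, nb_range' (by omega), hβ]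
      rfl
  by_contra hc
  have ha0 : a = 0 ∧ i < 0 := by unfold IsFour at h4; omega
  obtain ⟨rfl, hi0⟩ := ha0
  -- For `a = 0` and `i < 0` the block contains `1 0 1`, and the following `0` completes the redex
  -- `1010`.
  have h2 : ∃ Y, block i 0 = Y ++ [1, 0] := by
    refine ⟨(List.range' 2 ((-i).toNat - 1)).reverse, ?_⟩
    rw [block, if_neg (by omega), show (-i).toNat = (-i).toNat - 1 + 1 by omega, List.range'_succ]
    simp
  obtain ⟨Y, hY⟩ := h2
  rw [h1, hY] at h
  refine IsIrred.not_four (n := n) (i := 1) (j := 0) (α := α ++ Y) (β := []) (γ := [])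
    (δ := List.range' 2 (g - 1) ++ β) (η := γ) (by simpa using h) (by omega) (by simp [IsFour])
    (by simp) (by simp) (by simp) ?_ rfl rfl rfl ?_
  · simp [ha]
  · rw [nb_append, nb_range' (by omega), hβ]; rfl

/-- Apply `IsIrred.ascending` to the first letter `|l|` of the second block. The edge `{n - 1, n}`,
labelled `4`, is responsible for the exception. -/
theorem IsIrred.dominates {i l : ℤ} {g g' : ℕ}
    (h : IsIrred n False (Tr.mk (block i g ++ block l g'))) (hg : g ≤ n) (hl : l.natAbs ≤ g')
    (hl' : l.natAbs < g) : Dominates i l ∨ l.natAbs + 1 = n := by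
  obtain ⟨T, hT⟩ := block_eq_natAbs_cons hl
  rw [hT] at h
  by_cases hi : i ≤ l.natAbs
  · rcases IsIrred.ascending (n := n) (α := []) (β := []) (by simpa using h) hi hl' hg (by simp) rfl
      with h1 | h1
    · left; unfold Dominates; omega
    · exact .inr h1
  · left; unfold Dominates; omega

theorem block_top (n : ℕ) : block (n : ℤ) n = [n] := by
  rw [block_natCast_eq_cons le_rfl]; simp

theorem IsIrred.lt_of_block_top {i i' : ℤ} (hi : i ≤ n) (hi' : i' ≤ n) {β : List ℕ}
    (h : IsIrred n False (Tr.mk (block i n ++ (block i' n ++ β)))) : i' < n := by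
  by_contra hc
  obtain rfl : i' = n := by omega
  obtain ⟨X, hX⟩ := exists_block_eq_concat hi
  rw [block_top, hX] at h
  exact IsIrred.nb_ne_nil (n := n) (ε := False) (i := n) (α := X) (β := []) (γ := β)
    (by simpa using h) (by simp) rfl

theorem block_eq_append_pair (hn : 2 ≤ n) {i : ℤ} (hi : i < n) (hi' : -((n : ℤ) - 1) < i) :
    ∃ Y, block i n = Y ++ [n - 1, n] ∧ ∀ x ∈ Y, x + 1 < n := by
  obtain ⟨m, rfl⟩ : ∃ m, n = m + 2 := ⟨n - 2, by omega⟩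
  refine ⟨block i m, ?_, fun x hx => ?_⟩
  · rw [block_eq_append (m := m) (by omega) (by omega), show m + 2 - m = 2 by omega]
    simp [List.range'_succ]
  · have := le_of_mem_block (by omega) hx
    omega

theorem exists_block_eq_append_pair (hn : 2 ≤ n) {i : ℤ} (hi : i < n) :
    ∃ Y, block i n = Y ++ [n - 1, n] := by
  obtain ⟨m, rfl⟩ : ∃ m, n = m + 2 := ⟨n - 2, by omega⟩
  refine ⟨block i m, ?_⟩
  rw [block_eq_append (m := m) (by omega) (by omega), show m + 2 - m = 2 by omega]
  simp [List.range'_succ]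

/-- In the exceptional case `|i'| = n - 1`, a positive `i'` gives the redex `(n - 1) n (n - 1) n`
unless `i = n`, where domination holds. The surviving value `-(n - 1)` is the source of the first
type. -/
theorem IsIrred.dominates_top (hn : 2 ≤ n) {i i' : ℤ}
    (h : IsIrred n False (Tr.mk (block i n ++ block i' n))) (hi : i ≤ n) (hi' : i'.natAbs ≤ n)
    (hi'' : i' ≠ -(n : ℤ)) : Dominates i i' ∨ i' = -((n : ℤ) - 1) := by
  have hlt : i' < n := IsIrred.lt_of_block_top (β := []) hi (by omega) (by simpa using h)
  rcases h.dominates le_rfl hi' (by omega) with h1 | h1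
  · exact .inl h1
  · by_cases hneg : i' = -((n : ℤ) - 1)
    · exact .inr hneg
    · obtain rfl : i' = ((n - 1 : ℕ) : ℤ) := by omega
      by_cases hin : i = n
      · left; unfold Dominates; omega
      · exfalso
        obtain ⟨Y, hY⟩ := exists_block_eq_append_pair hn (show i < n by omega)
        have h2 : block ((n - 1 : ℕ) : ℤ) n = [n - 1, n] := by
          rw [block_natCast_eq_cons (by omega), show n - 1 + 1 = n by omega,
            show n - (n - 1) = 1 by omega]
          rfl
        rw [hY, h2] at h
        exact IsIrred.not_four (n := n) (i := n - 1) (j := n) (α := Y) (β := []) (γ := [])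
          (δ := []) (η := []) (by simpa using h) (by omega) (by simp [IsFour]) (by simp) (by simp)
          (by simp) (by simp) rfl rfl rfl rfl

/-- Two blocks that end with `n` cannot be followed by `n - 1`, unless the second one is
`[-(n - 1), n]`. -/
theorem IsIrred.eq_of_pred_top (hn : 2 ≤ n) {x y : ℤ} {β : List ℕ}
    (h : IsIrred n False (Tr.mk (block x n ++ (block y n ++ (n - 1) :: β)))) (hx : x ≤ n)
    (hy : y ≤ n) (hy' : -(n : ℤ) < y) : y = -((n : ℤ) - 1) := by
  by_contra hne
  have hlt := IsIrred.lt_of_block_top hx hy h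
  obtain ⟨Y, hY, hY'⟩ := block_eq_append_pair hn hlt (by omega)
  obtain ⟨X, hX⟩ := exists_block_eq_concat hx
  rw [hX, hY] at h
  refine IsIrred.not_four (n := n) (i := n) (j := n - 1) (α := X) (β := Y) (γ := [])
    (δ := []) (η := β) (by simpa using h) (by omega) (by simp [IsFour]) ?_ (by simp)
    (by simp) (by simp) ?_ rfl rfl rfl
  · intro hm; have := hY' _ hm; omega
  · rw [nb_eq_nil]; intro z hz; have := hY' z hz; omega

/-- Blocks after `[i, n]` with `i ≤ 0`. -/
theorem exists_reverse_block_eq (hn : 2 ≤ n) {i : ℤ} (hi : i ≤ 0) {α : List ℕ} {v : List (ℤ × ℕ)}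
    (hv : ∀ p ∈ v, p.1.natAbs ≤ p.2) (hv' : v.Pairwise fun p q => q.2 < p.2)
    (hv0 : i < 0 ∨ ∀ p ∈ v, p.1 ≠ 0) {c : ℕ} (hc : c ≤ n) (hvc : ∀ p ∈ v, p.2 < c)
    (h : IsIrred n False (Tr.mk (α ++ block i n ++ ((block c (n - 1)).reverse ++ blocks v)))) :
    ∃ f : ℤ, -(n : ℤ) < f ∧ f ≤ n ∧
      (block c (n - 1)).reverse ++ blocks v = (block f (n - 1)).reverse := by
  induction v generalizing c with
  | nil => exact ⟨c, by omega, by omega, by simp [blocks]⟩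
  | cons p v ih =>
    obtain ⟨l, g⟩ := p
    have h1 := hv (l, g) (by simp)
    have h2 := hvc (l, g) (by simp)
    simp only at h1 h2
    rw [List.pairwise_cons] at hv'
    have hcb : ∀ x ∈ (block (c : ℤ) (n - 1)).reverse, c ≤ x := fun x hx => by
      rw [List.mem_reverse, mem_block_nonneg (by omega)] at hx
      omega
    -- The word already descends from `n - 1` to `c`, and the next block must continue with `c - 1`.
    -- A smaller first letter, already present in the ascent to `n`, would recur without enough
    -- neighbours in between.
    have hlc : l.natAbs + 1 = c := by
      by_contra hne
      obtain ⟨T, hT⟩ := block_eq_natAbs_cons h1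
      rw [blocks_cons] at h
      simp only [hT] at h
      have := IsIrred.ascending (n := n) (i := i) (a := l.natAbs) (g := n) (α := α)
        (β := (block c (n - 1)).reverse) (γ := T ++ blocks v) (by simpa using h) (by omega)
        (by omega) le_rfl (fun hm => by have := hcb _ hm; omega)
        (nb_eq_nil.2 fun x hx => by have := hcb _ hx; omega)
      rcases this with h3 | h3
      · rcases hv0 with h4 | h4
        · omega
        · exact h4 (l, g) (by simp) (by simp only; omega)
      · omega
    obtain rfl : g = l.natAbs := by omega
    subst hlc
    rcases le_or_gt 0 l with hl | hl
    · obtain ⟨a, rfl⟩ : ∃ a : ℕ, l = a := ⟨l.toNat, by omega⟩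
      rw [Int.natAbs_natCast] at *
      have h3 : (block ((a + 1 : ℕ) : ℤ) (n - 1)).reverse ++ blocks (((a : ℤ), a) :: v) =
          (block (a : ℤ) (n - 1)).reverse ++ blocks v := by
        rw [blocks_cons, block_natCast_eq_cons (l := a) (g := n - 1) (by omega), block_natCast,
          block_top, show n - 1 + 1 - (a + 1) = n - 1 - a by omega]
        simp
      rw [h3] at h ⊢
      refine ih (fun q hq => hv q (by simp [hq])) hv'.2 ?_ (by omega) (fun q hq => hv'.1 q hq) h
      exact hv0.imp id fun h4 q hq => h4 q (by simp [hq])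
    · obtain ⟨a, rfl⟩ : ∃ a : ℕ, l = -(a : ℤ) := ⟨(-l).toNat, by omega⟩
      rw [Int.natAbs_neg, Int.natAbs_natCast] at *
      have h3 : block (-(a : ℤ)) a = palin a := by
        rw [block_neg_natCast (by omega) le_rfl]; simp
      -- Nothing can follow a negative block: its palindrome would be followed directly by a smaller
      -- letter.
      have hv0 : v = [] := by
        rcases v with _ | ⟨⟨l', g'⟩, v⟩
        · rfl
        · exfalso
          have h4 := hv'.1 (l', g') (by simp)
          have h5 := hv (l', g') (by simp)
          simp only at h4 h5
          obtain ⟨T, hT⟩ := block_eq_natAbs_cons h5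
          rw [blocks_cons, blocks_cons] at h
          simp only [h3, hT] at h
          have := IsIrred.nb_right_of_palin (n := n) (l := a) (i := l'.natAbs)
            (α := α ++ block i n ++ (block ((a + 1 : ℕ) : ℤ) (n - 1)).reverse) (β₁ := [])
            (β₂ := T ++ blocks v) (by omega) (by omega) (by simpa using h) (by simp) rfl
          omega
      subst hv0
      refine ⟨-(a : ℤ), by omega, by omega, ?_⟩
      rw [blocks_singleton, h3, block_neg_natCast (l := a) (g := n - 1) (by omega) (by omega),
        block_natCast, show n - 1 + 1 - (a + 1) = n - 1 - a by omega]
      simp [reverse_palin]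

/-- Blocks after `[i, n]` with `i > 0`. -/
theorem eq_sub_or_lt_of_isIrred (hn : 2 ≤ n) {i : ℤ} (hi : 0 < i) {v : List (ℤ × ℕ)}
    (hv : ∀ p ∈ v, p.1.natAbs ≤ p.2) (hv' : v.Pairwise fun p q => q.2 < p.2)
    (hd : v.Pairwise fun p q => Dominates p.1 q.1) {c : ℕ} (hc : c ≤ n) (hvc : ∀ p ∈ v, p.2 < c)
    (h : IsIrred n False (Tr.mk (block i n ++ ((block c (n - 1)).reverse ++ blocks v)))) :
    ∀ (j : ℕ) (hj : j < v.length), v[j].1 = (c : ℤ) - (j + 1) ∨ v[j].1 < i := by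
  induction v generalizing c with
  | nil => intro j hj; simp at hj
  | cons p v ih =>
    obtain ⟨l, g⟩ := p
    have h1 := hv (l, g) (by simp)
    have h2 := hvc (l, g) (by simp)
    simp only at h1 h2
    rw [List.pairwise_cons] at hv' hd
    -- Once a block starts below `i`, domination keeps all later ones below `i`. While `l ≥ i`, the
    -- letter `l` recurs from `[i, n]`, so it must continue the descent and equal `c - 1`.
    rcases lt_or_ge l i with hli | hli
    · intro j hj
      right
      rcases j with _ | j
      · exact hli
      · have := hd.1 (v[j]'(by simpa using hj)) (List.getElem_mem _)
        simp only [List.getElem_cons_succ]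
        unfold Dominates at this
        simp only at this
        omega
    · obtain ⟨a, rfl⟩ : ∃ a : ℕ, l = a := ⟨l.toNat, by omega⟩
      rw [Int.natAbs_natCast] at h1
      have hcb : ∀ x ∈ (block (c : ℤ) (n - 1)).reverse, c ≤ x := fun x hx => by
        rw [List.mem_reverse, mem_block_nonneg (by omega)] at hx
        omega
      have hlc : a + 1 = c := by
        by_contra hne
        rw [blocks_cons] at h
        simp only [block_natCast_eq_cons h1] at h
        have := IsIrred.ascending (n := n) (i := i) (a := a) (g := n) (α := [])
          (β := (block c (n - 1)).reverse) (γ := List.range' (a + 1) (g - a) ++ blocks v)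
          (by simpa using h) (by omega)
          (by omega) le_rfl (fun hm => by have := hcb _ hm; omega)
          (nb_eq_nil.2 fun x hx => by have := hcb _ hx; omega)
        omega
      obtain rfl : g = a := by omega
      subst hlc
      have h3 : (block ((g + 1 : ℕ) : ℤ) (n - 1)).reverse ++ blocks (((g : ℤ), g) :: v) =
          (block (g : ℤ) (n - 1)).reverse ++ blocks v := by
        rw [blocks_cons, block_natCast_eq_cons (l := g) (g := n - 1) (by omega), block_natCast,
          block_top, show n - 1 + 1 - (g + 1) = n - 1 - g by omega]
        simp
      rw [h3] at h
      have h4 := ih (fun q hq => hv q (by simp [hq])) hv'.2 hd.2 (by omega)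
        (fun q hq => hv'.1 q hq) h
      intro j hj
      rcases j with _ | j
      · left; simp
      · have := h4 j (by simpa using hj)
        simp only [List.getElem_cons_succ]
        push_cast
        omega

end

end CTilde

/-! ### From block sequences to valid normal forms. -/

namespace CTilde

section

variable {n : ℕ}

/-- A positive entry bounds the absolute values of all later ones, zero is followed only by zeros,
and a negative entry can only be last. These are exactly the three shapes of a `B`-form. -/
theorem cases_of_pairwise_dominates {ls : List ℤ} (h : ls.Pairwise Dominates) :
    (ls.Pairwise (· > ·) ∧ ∀ l ∈ ls, 0 < l) ∨
    (∃ (a : List ℤ) (m : ℕ), ls = a ++ List.replicate (m + 1) 0 ∧ a.Pairwise (· > ·) ∧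
      ∀ l ∈ a, 0 < l) ∨
    (∃ (a : List ℤ) (l : ℤ), ls = a ++ [-l] ∧ (a ++ [l]).Pairwise (· > ·) ∧ 0 < l) := by
  induction ls with
  | nil => exact .inl ⟨.nil, by simp⟩
  | cons x ls ih =>
    rw [List.pairwise_cons] at h
    rcases lt_trichotomy x 0 with hx | rfl | hx
    · have : ls = [] := List.eq_nil_iff_forall_not_mem.2 fun y hy => by
        have := h.1 y hy; unfold Dominates at this; omega
      subst this
      exact .inr (.inr ⟨[], -x, by simp, by simp, by omega⟩)
    · refine .inr (.inl ⟨[], ls.length, ?_, .nil, by simp⟩)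
      rw [List.nil_append, List.replicate_succ]
      congr 1
      refine List.eq_replicate_of_mem fun y hy => ?_
      have := h.1 y hy; unfold Dominates at this; omega
    · have hlt : ∀ y ∈ ls, (y.natAbs : ℤ) < x := fun y hy => by
        have := h.1 y hy; unfold Dominates at this; omega
      rcases ih h.2 with ⟨h1, h2⟩ | ⟨a, m, rfl, h1, h2⟩ | ⟨a, l, rfl, h1, h2⟩
      · refine .inl ⟨List.pairwise_cons.2 ⟨fun y hy => ?_, h1⟩, ?_⟩
        · have := hlt y hy; omega
        · intro y hy
          rcases List.mem_cons.1 hy with rfl | hy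
          · exact hx
          · exact h2 y hy
      · refine .inr (.inl ⟨x :: a, m, rfl, List.pairwise_cons.2 ⟨fun y hy => ?_, h1⟩, ?_⟩)
        · have := hlt y (by simp [hy]); omega
        · intro y hy
          rcases List.mem_cons.1 hy with rfl | hy
          · exact hx
          · exact h2 y hy
      · refine .inr (.inr ⟨x :: a, l, rfl, List.pairwise_cons.2 ⟨fun y hy => ?_, h1⟩, h2⟩)
        rcases List.mem_append.1 hy with hy | hy
        · have := hlt y (by simp [hy]); omega
        · obtain rfl := List.mem_singleton.1 hy
          have := hlt (-y) (by simp); omega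

theorem isTypeBForm_of_dominates {v : List (ℤ × ℕ)} (hv : ∀ p ∈ v, p.2 < n ∧ p.1.natAbs ≤ p.2)
    (hv' : v.Pairwise fun p q => q.2 < p.2) (hd : v.Pairwise fun p q => Dominates p.1 q.1) :
    IsTypeBForm n v := by
  refine ⟨List.pairwise_map.2 hv', fun p hp => ⟨(hv p hp).1, ?_⟩, ?_⟩
  · have := (hv p hp).2
    rw [Int.abs_eq_natAbs]; omega
  · have := cases_of_pairwise_dominates (List.pairwise_map.2 hd)
    simpa only [List.mem_map, forall_exists_index, and_imp, forall_apply_eq_imp_iff₂] using this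

theorem ne_zero_of_pairwise_dominates {ls : List ℤ} (h : ls.Pairwise Dominates) {x : ℤ}
    (hx : x ∈ ls) (hx0 : x < 0) : ∀ y ∈ ls, y ≠ 0 := by
  obtain ⟨α, β, rfl⟩ := List.append_of_mem hx
  rw [List.pairwise_append, List.pairwise_cons] at h
  intro y hy
  rw [List.mem_append, List.mem_cons] at hy
  rcases hy with hy | rfl | hy
  · have := h.2.2 y hy x (by simp); unfold Dominates at this; omega
  · omega
  · have := h.2.1.1 y hy; unfold Dominates at this; omega

theorem pairwise_dominates_blocks {v : List (ℤ × ℕ)} (hv : ∀ p ∈ v, p.2 < n ∧ p.1.natAbs ≤ p.2)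
    (hv' : v.Pairwise fun p q => q.2 < p.2) (h : IsIrred n False (Tr.mk (blocks v))) :
    v.Pairwise fun p q => Dominates p.1 q.1 := by
  refine pairwise_of_adjacent (fun h h' => h.trans h') fun α β p q hvp => ?_
  subst hvp
  have h1 : IsIrred n False (Tr.mk (block p.1 p.2 ++ block q.1 q.2)) :=
    h.of_infix ⟨blocks α, blocks β, by simp [blocks]⟩
  have hp := hv p (by simp)
  have hq := hv q (by simp)
  have hpq : q.2 < p.2 := by
    rw [List.pairwise_append, List.pairwise_cons] at hv'
    exact hv'.2.1.1 q (by simp)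
  rcases h1.dominates hp.1.le hq.2 (by omega) with h2 | h2
  · exact h2
  · omega

theorem flatMap_block_concat (hn : 2 ≤ n) {is : List ℤ} (his : ∀ i ∈ is, i ≤ n) :
    (is.flatMap fun i => block i (n - 1) ++ [n]) = is.flatMap fun i => block i n :=
  flatMap_congr_of_mem fun i hi => block_concat' (by omega) (his i hi)

/-- An irreducible sequence of blocks that contains a negative block is a normal form. -/
theorem exists_isValid (hn : 2 ≤ n) {is : List ℤ} {v : List (ℤ × ℕ)}
    (his : ∀ i ∈ is, i.natAbs ≤ n ∧ i ≠ -(n : ℤ)) (hv : ∀ p ∈ v, p.2 < n ∧ p.1.natAbs ≤ p.2)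
    (hv' : v.Pairwise fun p q => q.2 < p.2)
    (h : IsIrred n False (Tr.mk ((is.flatMap fun i => block i n) ++ blocks v)))
    (hp : ¬ Separated 1 ((is.flatMap fun i => block i n) ++ blocks v)) :
    ∃ N : NormalForm, N.IsValid n ∧ N.word n = (is.flatMap fun i => block i n) ++ blocks v := by
  have his' : ∀ i ∈ is, i ≤ n := fun i hi => by have := his i hi; omega
  have hd := pairwise_dominates_blocks hv hv' (h.of_infix (List.suffix_append _ _).isInfix)
  have hB := isTypeBForm_of_dominates hv hv' hd
  -- Without any negative block the whole word would be separated, against `hp`.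
  have hneg : (∀ i ∈ is, 0 ≤ i) → ∃ p ∈ v, p.1 < 0 := by
    intro h0
    by_contra! hc
    refine hp (Separated.append (Separated.flatMap (fun i _ => covered_block hn)
      fun i hi => separated_block (h0 i hi) _) (separated_blocks hB.1 hc)
      (.inl (Covered.flatMap fun i _ => covered_block hn)))
  have hne0 : (∃ p ∈ v, p.1 < 0) → ∀ p ∈ v, p.1 ≠ 0 := by
    rintro ⟨p, hp, hp0⟩ q hq
    exact ne_zero_of_pairwise_dominates (List.pairwise_map.2 hd) (List.mem_map_of_mem hp) hp0 q.1
      (List.mem_map_of_mem hq)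
  have htop : block (n : ℤ) (n - 1) = [] := by
    rw [block_natCast, show n - 1 + 1 - n = 0 by omega]; rfl
  rcases is with _ | ⟨i, _ | ⟨i₂, is⟩⟩
  · exact ⟨.zero v, hB, by simp [NormalForm.word]⟩
  · have hi := his i (by simp)
    rw [List.flatMap_singleton] at *
    have hvn : ∀ p ∈ v, p.2 < n := fun p hp => (hv p hp).1
    rcases lt_trichotomy i 0 with hi0 | rfl | hi0
    · obtain ⟨f, h1, h2, h3⟩ := exists_reverse_block_eq hn hi0.le (α := []) (fun p hp => (hv p hp).2)
        hv' (.inl hi0) le_rfl hvn (by simpa [htop] using h)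
      refine ⟨.oneNeg i f, ⟨by omega, hi0, h1, h2⟩, ?_⟩
      rw [htop, List.reverse_nil, List.nil_append] at h3
      rw [NormalForm.word, block_concat' (by omega) (by omega), h3]
    · obtain ⟨f, h1, h2, h3⟩ := exists_reverse_block_eq hn le_rfl (α := [])
        (fun p hp => (hv p hp).2) hv' (.inr (hne0 (hneg (by simp)))) le_rfl hvn
        (by simpa [htop] using h)
      refine ⟨.oneZero f, ⟨h1, h2⟩, ?_⟩
      rw [htop, List.reverse_nil, List.nil_append] at h3
      rw [NormalForm.word, block_concat' (by omega) (by omega), h3]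
    · refine ⟨.onePos i v, ⟨hi0, by omega, hB, ?_⟩, ?_⟩
      · exact eq_sub_or_lt_of_isIrred hn hi0 (fun p hp => (hv p hp).2) hv' hd le_rfl hvn
          (by simpa [htop] using h)
      · rw [NormalForm.word, block_concat' (by omega) (by omega)]
  -- at least two blocks ending with `n`
  have hadj : ∀ α β x y, i :: i₂ :: is = α ++ x :: y :: β → Dominates x y ∨ y = -((n : ℤ) - 1) := by
    intro α β x y he
    rw [he] at h his
    have hx := his x (by simp)
    have hy := his y (by simp)
    exact IsIrred.dominates_top hn (h.of_infix ⟨α.flatMap fun i => block i n,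
      (β.flatMap fun i => block i n) ++ blocks v, by simp⟩) (by omega) hy.1 hy.2
  have hpred : ∀ α β x y T, (i :: i₂ :: is).flatMap (fun i => block i n) ++ blocks v =
      α ++ (block x n ++ (block y n ++ (n - 1) :: T)) ++ β → x ∈ i :: i₂ :: is → y ∈ i :: i₂ :: is →
      y = -((n : ℤ) - 1) := by
    intro α β x y T he hx hy
    have hx := his x hx
    have hy := his y hy
    exact IsIrred.eq_of_pred_top hn (h.of_infix ⟨α, β, he.symm⟩) (by omega) (by omega) (by omega)
  obtain ⟨T, hT⟩ := palin_eq_cons (l := n - 1)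
  have hbn : block (-((n : ℤ) - 1)) n = (n - 1) :: (T ++ [n]) := by
    rw [← block_concat' (by omega) (by omega), block_neg_pred hn, hT]; rfl
  -- The value of the second top block decides between the first type and the second type.
  by_cases hi₂ : i₂ = -((n : ℤ) - 1)
  -- A negative parameter dominates nothing, so the exceptional value propagates to all later top
  -- blocks.
  · have hall : ∀ j ∈ i₂ :: is, j = -((n : ℤ) - 1) := by
      have key : ∀ (α β : List ℤ), i :: i₂ :: is = α ++ β → α ≠ [] → (∀ x ∈ β.head?, x = -((n : ℤ) - 1)) →
          ∀ x ∈ β, x = -((n : ℤ) - 1) := by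
        intro α β
        induction β generalizing α with
        | nil => simp
        | cons x β ih =>
          intro he hα hx
          have hx' : x = -((n : ℤ) - 1) := hx x (by simp)
          have h1 := ih (α ++ [x]) (by simpa using he) (by simp) (by
            intro y hy
            rcases β with _ | ⟨z, β⟩
            · simp at hy
            · obtain rfl : z = y := by simpa using hy
              rcases hadj α β x z he with h2 | h2
              · unfold Dominates at h2; omega
              · exact h2)
          intro y hy
          rcases List.mem_cons.1 hy with rfl | hy
          · exact hx'
          · exact h1 y hy
      exact key [i] (i₂ :: is) rfl (by simp) (by simpa using hi₂)
    have hrep : i₂ :: is = List.replicate (is.length + 1) (-((n : ℤ) - 1)) := by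
      have := List.eq_replicate_of_mem hall
      simpa using this
    have hword : (i :: i₂ :: is).flatMap (fun i => block i n) =
        block i n ++ (List.replicate (is.length + 1) (block (-((n : ℤ) - 1)) n)).flatten := by
      rw [List.flatMap_cons, hrep, List.flatMap, List.map_replicate]
    have hword' : (i :: i₂ :: is).flatMap (fun i => block i n) =
        (block i n ++ (List.replicate is.length (block (-((n : ℤ) - 1)) n)).flatten) ++
          block (-((n : ℤ) - 1)) n := by
      rw [hword, List.replicate_succ', List.flatten_append]
      simp
    obtain ⟨f, h1, h2, h3⟩ := exists_reverse_block_eq hn (i := -((n : ℤ) - 1)) (by omega)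
      (α := block i n ++ (List.replicate is.length (block (-((n : ℤ) - 1)) n)).flatten)
      (fun p hp => (hv p hp).2)
      hv' (.inl (by omega)) le_rfl (fun p hp => (hv p hp).1) (by
        rw [hword'] at h
        simpa [htop] using h)
    have hi := his i (by simp)
    refine ⟨.first i (is.length + 1) f, ⟨by omega, by omega, by omega, h1, h2⟩, ?_⟩
    rw [htop, List.reverse_nil, List.nil_append] at h3
    rw [NormalForm.word, NormalForm.firstWord, block_concat' (by omega) (by omega),
      block_concat' (by omega) (by omega), hword, h3]
  -- A block `[-(n - 1), n]` begins with `n - 1`. By `hpred`, if two top blocks precede it, the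
  -- nearer one has the exceptional value too, and the exception would travel back to `i₂`.
  have htail : ∀ j ∈ i₂ :: is, j ≠ -((n : ℤ) - 1) := by
    have key : ∀ (is' α : List ℤ) (x y : ℤ), i :: i₂ :: is = α ++ x :: y :: is' →
        y ≠ -((n : ℤ) - 1) → ∀ z ∈ y :: is', z ≠ -((n : ℤ) - 1) := by
      intro is'
      induction is' with
      | nil => intro α x y _ hy z hz; simpa [List.mem_singleton.1 hz] using hy
      | cons z is' ih =>
        intro α x y he hy w hw
        rcases List.mem_cons.1 hw with rfl | hw
        · exact hy
        · refine ih (α ++ [x]) y z (by simpa using he) ?_ w hw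
          rintro rfl
          refine hy (hpred (α.flatMap fun i => block i n) ((is'.flatMap fun i => block i n) ++ blocks v)
            x y (T ++ [n]) ?_ (by simp [he]) (by simp [he]))
          rw [he, List.flatMap_append, List.flatMap_cons, List.flatMap_cons, List.flatMap_cons, hbn]
          simp
    exact key is [] i i₂ rfl hi₂
  have hdi : (i :: i₂ :: is).Pairwise Dominates := by
    refine pairwise_of_adjacent (fun h h' => h.trans h') fun α β x y he => ?_
    refine (hadj α β x y he).resolve_right (htail y ?_)
    rcases α with _ | ⟨a, α⟩
    · simp only [List.nil_append, List.cons.injEq] at he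
      simp [he.2]
    · simp only [List.cons_append, List.cons.injEq] at he
      simp [he.2]
  obtain ⟨is', z, hz⟩ : ∃ is' z, i :: i₂ :: is = is' ++ [z] :=
    ⟨_, _, (List.dropLast_append_getLast (by simp)).symm⟩
  obtain ⟨is'', y, rfl⟩ : ∃ is'' y, is' = is'' ++ [y] := by
    have hlen := congrArg List.length hz
    have hne : is' ≠ [] := by rintro rfl; simp at hlen
    exact ⟨_, _, (List.dropLast_append_getLast hne).symm⟩
  have hlen : 2 ≤ (i :: i₂ :: is).length := by simp
  have hz' : z ≠ -((n : ℤ) - 1) := by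
    refine htail z ?_
    rcases is'' with _ | ⟨a, α⟩
    · simp only [List.nil_append, List.cons_append, List.cons.injEq] at hz
      simp [hz.2]
    · simp only [List.cons_append, List.cons.injEq] at hz
      simp [hz.2]
  generalize i :: i₂ :: is = js at *
  subst hz
  -- If `|l_1| = n - 1`, then an `n - 1` follows two top blocks and `hpred` would give `z = -(n -
  -- 1)`.
  have hhead : ∀ p ∈ v.head?, Dominates z p.1 := by
    intro p hp
    obtain ⟨v, rfl⟩ : ∃ v', v = p :: v' := by
      cases v with
      | nil => simp at hp
      | cons q v => simp at hp; exact ⟨v, by rw [hp]⟩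
    have hp' := hv p (by simp)
    have h1 : IsIrred n False (Tr.mk (block z n ++ block p.1 p.2)) :=
      h.of_infix ⟨(is'' ++ [y]).flatMap fun i => block i n, blocks v, by simp [blocks]⟩
    refine (h1.dominates le_rfl hp'.2 (by omega)).resolve_right fun h2 => hz' ?_
    obtain ⟨T', hT'⟩ := block_eq_natAbs_cons hp'.2
    refine hpred (is''.flatMap fun i => block i n) (blocks v) y z T' ?_ (by simp) (by simp)
    rw [blocks_cons, hT', show n - 1 = p.1.natAbs by omega]
    simp
  have hword : NormalForm.secondWord n (is'' ++ [y] ++ [z]) 0 v =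
      (is'' ++ [y] ++ [z]).flatMap (fun i => block i n) ++ blocks v := by
    rw [NormalForm.secondWord, flatMap_block_concat hn his', List.replicate_zero, List.flatten_nil,
      List.append_nil]
  have hdz : ∀ x ∈ is'' ++ [y], Dominates x z := by
    rw [List.pairwise_append] at hdi
    exact fun x hx => hdi.2.2 x hx z (by simp)
  have hvalid : z ≠ 0 → (z < 0 → v = []) → NormalForm.IsValid n
      (.second (is'' ++ [y] ++ [z]) 0 v) := by
    intro hz0 hzv
    have hpos : ∀ x ∈ is'' ++ [y], 0 < x := fun x hx => by
      have := hdz x hx; unfold Dominates at this; omega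
    have hnz : ∀ x ∈ is'' ++ [y] ++ [z], x ≠ 0 := fun x hx => by
      rw [List.mem_append, List.mem_singleton] at hx
      rcases hx with hx | rfl
      · exact (hpos x hx).ne'
      · exact hz0
    refine ⟨by omega, hB, ?_, fun x hx => ⟨abs_pos.2 (hnz x hx), his' x hx⟩, ?_, by omega, ?_, ?_⟩
    · refine List.pairwise_map.2 (hdi.imp_of_mem fun {a c} ha hc hac => ?_)
      have h1 := hnz c hc
      unfold Dominates at hac
      rw [Int.abs_eq_natAbs, Int.abs_eq_natAbs]
      omega
    · rw [List.dropLast_concat]; exact hpos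
    · intro x hx hx0
      rw [List.mem_append, List.mem_singleton] at hx
      rcases hx with hx | rfl
      · have := hpos x hx; omega
      · exact ⟨rfl, hzv hx0, hz'⟩
    · intro _ x hx hx0 p hp
      rw [List.getLast?_concat, Option.mem_some_iff] at hx
      subst hx
      have := hhead p hp
      unfold Dominates at this
      rw [Int.abs_eq_natAbs]; omega
  refine ⟨.second (is'' ++ [y] ++ [z]) 0 v, hvalid ?_ ?_, hword⟩
  -- If the last top parameter were `0`, the negative block would have to occur in `v`. But `0`
  -- dominates only `0`, and a form with a negative entry has no zero entry. So `k = 0` suffices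
  -- here.
  · rintro rfl
    obtain ⟨p, hp, hp0⟩ := hneg fun x hx => by
      rw [List.mem_append, List.mem_singleton] at hx
      rcases hx with hx | rfl
      · have := hdz x hx; unfold Dominates at this; omega
      · rfl
    cases v with
    | nil => simp at hp
    | cons q v =>
      have h1 := hhead q (by simp)
      have h2 := hne0 ⟨p, hp, hp0⟩ q (by simp)
      unfold Dominates at h1
      omega
  · intro hz0
    cases v with
    | nil => rfl
    | cons q v =>
      have h1 := hhead q (by simp)
      unfold Dominates at h1
      omega

theorem IsBlockSeq.exists_eq_append {L : List (ℤ × ℕ)} (h : IsBlockSeq n L) :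
    ∃ (is : List ℤ) (v : List (ℤ × ℕ)), L = is.map (fun i => (i, n)) ++ v ∧ (∀ p ∈ v, p.2 < n) ∧
      v.Pairwise fun p q => q.2 < p.2 := by
  obtain ⟨h1, h2⟩ := h
  induction L with
  | nil => exact ⟨[], [], rfl, by simp, .nil⟩
  | cons p L ih =>
    rw [List.pairwise_cons] at h2
    by_cases hp : p.2 = n
    · obtain ⟨is, v, rfl, h3, h4⟩ := ih (fun q hq => h1 q (by simp [hq])) h2.2
      exact ⟨p.1 :: is, v, by simp [← hp], h3, h4⟩
    · have hpn := (h1 p (by simp)).1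
      have hlt : ∀ q ∈ L, q.2 < p.2 := fun q hq => by have := h2.1 q hq; omega
      refine ⟨[], p :: L, rfl, fun q hq => ?_, List.pairwise_cons.2 ⟨hlt, ?_⟩⟩
      · rcases List.mem_cons.1 hq with rfl | hq
        · omega
        · have := hlt q hq; omega
      · refine h2.2.imp_of_mem fun {a c} ha hc hac => ?_
        have := hlt a ha
        omega

/-- A fully commutative element that is not left-positive has a normal form. -/
theorem exists_isNormalFormOf (hn : 2 ≤ n) {x : W n} (hx : IsFullyCommutative x)
    (hx' : ¬ IsLeftPositive x) : ∃ N : NormalForm, N.IsNormalFormOf x := by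
  have hω := isReducedExpr_choose x
  set ω := ((cs n).exists_isReduced x).choose
  have hir := hx.isIrred hω
  obtain ⟨L, hL, hLω⟩ := exists_isBlockSeq hn (ω := vals ω) (fun _ => le_of_mem_vals) hir
  obtain ⟨is, v, rfl, hv, hv'⟩ := hL.exists_eq_append
  have hw : blocks (is.map (fun i => (i, n)) ++ v) =
      (is.flatMap fun i => block i n) ++ blocks v := by
    simp [blocks, List.flatMap_map]
  rw [hw] at hLω
  have htr : trace ω = Tr.mk ((is.flatMap fun i => block i n) ++ blocks v) := hLω.symm
  have hir' := hir
  rw [htr] at hir'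
  obtain ⟨N, hN, hNw⟩ := exists_isValid hn
    (fun i hi => (hL.1 (i, n) (by simp [hi])).2)
    (fun p hp => ⟨hv p hp, (hL.1 p (by simp [hp])).2.1⟩) hv' hir' fun hs => hx' <|
      (isLeftPositive_iff hn hx hω).2 fun a c => htr ▸ not_factor_of_separated hs a c
  refine ⟨N, hN, ?_⟩
  rw [hNw]
  exact hω.congr (exists_trace_eq htr).2

end

end CTilde

theorem mainTheorem2 {K : Type*} [Field K] [IsAlgClosed K] (n : ℕ) (hn : 2 ≤ n)
    (r R : K) (hr : r ≠ 0) (hR : R ≠ 0) :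
    (∃ B : Module.Basis (CTilde.NonLeftPos n) K (CTilde.LpSubmodule n r R),
      ∀ x : CTilde.NonLeftPos n,
        (B x : CTilde.TL n (r ^ 2) (R ^ 2)) =
          CTilde.b r R x.1 - CTilde.kappa r R • CTilde.barMonomial r R x.1) ∧
    (∃ B : Module.Basis (CTilde.LeftPos n) K (CTilde.TLQuot n r R),
      ∀ w : CTilde.LeftPos n,
        B w = (CTilde.Lp n r R).ringCon.mk' (CTilde.b r R w.1)) := by
  have h := fun x : CTilde.NonLeftPos n => CTilde.barMonomial_spec hn hr hR x.2.1 x.2.2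
    (CTilde.exists_isNormalFormOf hn x.2.1 x.2.2)
  exact CTilde.exists_basis_of_shorter hn hr hR (fun x => CTilde.barMonomial r R x.1)
    (fun x => (h x).1) fun x => (h x).2
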